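/- **Setting.** Let $T\ge 0$, let $\mathcal M^0=\{1,\dots,\kappa^0\}$, $\mathcal M^1=\{1,\dots,\kappa^1\}$ be finite sets of global and local modes, and consider, for states $X^n_t\in\mathbb R^{d_X^n}$ and actions $U^n_t\in\mathbb R^{d_U^n}$ ($n=0,1$), with $X_t=(X^0_t,X^1_t)$, $U_t=(U^0_t,U^1_t)$, $W_t=(W^0_t,W^1_t)$, $$X_{t+1}=A(M^0_t,M^1_t)X_t+B(M^0_t,M^1_t)U_t+W_t,\quad A=\begin{bmatrix}A^{00}(m^0)&0\\A^{10}(m^{0},m^1)&A^{11}(m^{0},m^1)\end{bmatrix},\quad B=\begin{bmatrix}B^{00}(m^0)&0\\B^{10}(m^{0},m^1)&B^{11}(m^{0},m^1)\end{bmatrix}.$$ The random variables $X_0^n,W_t^n,M_t^n,\Gamma_t$ ($n=0,1$, $0\le t\le T$) are mutually independent; $X_0^n$ has law $\pi_{X_0^n}$ and finite second moment; $W^n_t$ has mean zero and finite second moment; $M_t^n$ has law $\pi_{M^n}$ for all $t$, with $\pi_{M^1}(m)>0$ for all $m\in\mathcal M^1$; $\Gamma_t\in\{0,1\}$ with $\mathbb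 P(\Gamma_t=i)=p(i)$ for all $t$. The channel output is $(Z_t,\tilde Z_t)=(X^1_t,M^1_t)$ if $\Gamma_t=1$ and $(\emptyset,\emptyset)$ if $\Gamma_t=0$. Controller $C^0$ plays $U^0_t=\lambda^0_t(H^0_t)$ with $H^0_t=(X^0_{0:t},M^0_{0:t},Z_{0:t},\tilde Z_{0:t},U^0_{0:t-1})$, controller $C^1$ plays $U^1_t=\lambda^1_t(H^0_t,X^1_t,M^1_t)$, with Borel measurable $\lambda^n_t$. A strategy pair is feasible if all $X^n_t,U^n_t$, $0\le t\le T$, have finite second moments. Problem 1 is to minimize over feasible pairs $$J(\lambda^0,\lambda^1)=\mathbb E\Big[\sum_{t=0}^T X_t^{\top}Q_t(M^0_t,M^1_t)X_t+U_t^{\top}R_t(M^0_t,M^1_t)U_t\Big],$$ where all $Q_t(m^0,m^1)$ are symmetric positive semidefinite and all $R_t(m^0,m^1)$ symmetric positive definite. **Gains.** Let $\tilde{\mathcal M}^1=\mathcal M^1\cup\{\emptyset\}$, $D=[A\ B]$, $D^{11}=[A^{11}\ B^{11}]$, $C_t=\mathrm{diag}(Q_t,R_t)$, $C_t^{11}=\mathrm{diag}(Q_t^{11},R_t^{11})$;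 let $L_m$ be the matrix with $L_m\,(x,u^0,q(1),\dots,q(\kappa^1))=(x,u^0,q(m))$; let $D^{aug}(m^0,m^1)=D(m^0,m^1)L_{m^1}$, $D^\emptyset(m^0)=\sum_{m^1}\pi_{M^1}(m^1)D^{aug}(m^0,m^1)$, $C^\emptyset_t(m^0)=\sum_{m^1}\pi_{M^1}(m^1)L_{m^1}^\top C_t(m^0,m^1)L_{m^1}$. $[\cdot]_{1\bullet}$ denotes the block row of the local state. For families of matrices indexed by $\mathcal M^0\times\tilde{\mathcal M}^1$ put $$\Psi(G^1,G^2)=p(0)\sum_{m^0}\pi_{M^0}(m^0)G^1(m^0,\emptyset)+p(1)\sum_{m^0,m^1}\pi_{M^0}(m^0)\pi_{M^1}(m^1)G^2(m^0,m^1),\qquad \Pi(G)=\Psi(G,G).$$ For a block matrix $G=\begin{bmatrix}G^{11}&G^{12}\\G^{21}&G^{22}\end{bmatrix}$ let $SC(G)=G^{11}-G^{12}(G^{22})^{-1}G^{21}$. Starting from $P_{T+1}=0$, $\tilde P_{T+1}=0$, and writing $\Psi_{t+1}=\Psi(\tilde P_{t+1},P^{11}_{t+1})$ where $P^{11}$ is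 the local-state block of $P$, define backwards, for $t=T,\dots,0$, $$H_t(m^0,\emptyset)=C_t^\emptyset+(D^\emptyset)^\top\Pi(P_{t+1})D^\emptyset+\sum_{m^1}\pi_{M^1}(m^1)[D^{aug}]_{1\bullet}^\top\Psi_{t+1}[D^{aug}]_{1\bullet}-[D^\emptyset]_{1\bullet}^\top\Psi_{t+1}[D^\emptyset]_{1\bullet},$$ $$H_t(m^0,m^1)=C_t+D^\top\Pi(P_{t+1})D,\qquad \tilde H_t(m^0,m^1)=C_t^{11}+(D^{11})^\top\Psi_{t+1}D^{11},$$ $$P_t(m^0,\tilde z)=SC(H_t(m^0,\tilde z)),\quad \tilde P_t(m^0,m^1)=SC(\tilde H_t(m^0,m^1)),\quad \tilde P_t(m^0,\emptyset)=\sum_{m^1}\pi_{M^1}(m^1)SC(\tilde H_t(m^0,m^1)),$$ where $H_t$ is partitioned into state and action blocks ($X$, $U$) and $\tilde H_t$ into local state and local action blocks, and $$K_t(m^0,\tilde z)=-\big(H_t^{UU}(m^0,\tilde z)\big)^{-1}H_t^{UX}(m^0,\tilde z),\qquad \tilde K_t(m^0,m^1)=-\big(\tilde H_t^{U^1U^1}(m^0,m^1)\big)^{-1}\tilde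 H_t^{U^1X^1}(m^0,m^1).$$ **Candidate strategies.** Given $\hat x^1_t$, define $u^{0*}_t,\bar q^*_t,\tilde q^*_t$ as follows. If $\tilde z_t=\emptyset$: $(u^{0*}_t,\bar q^*_t(1),\dots,\bar q^*_t(\kappa^1))=K_t(m^0_t,\emptyset)(x^0_t,\hat x^1_t)$ and $\tilde q^*_t(x^1,m^1)=\tilde K_t(m^0_t,m^1)(x^1-\hat x^1_t)$. If $\tilde z_t=l\in\mathcal M^1$: $(u^{0*}_t,\bar q^*_t(l))=K_t(m^0_t,l)(x^0_t,\hat x^1_t)$, $\bar q^*_t(m^1)=0$ for $m^1\ne l$, and $\tilde q^*_t=0$. The estimate $\hat x^1_t$ is the function of the realized common information $h^0_t$ given recursively by $\hat x^1_0=x^1_0$ if $z_0=x^1_0$, $\hat x^1_0=\int x\,\pi_{X^1_0}(dx)$ if $z_0=\emptyset$, and $$\hat x^1_{t+1}=\begin{cases}x^1_{t+1}&\text{if }z_{t+1}=x^1_{t+1},\\ \sum_{m^1}\pi_{M^1}(m^1)[D(m^0_t,m^1)]_{1\bullet}\,(x^0_t,\hat x^1_t,u^{0*}_t,\bar q^*_t(m^1))&\text{if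 }z_{t+1}=\emptyset,\ \tilde z_t=\emptyset,\\ [D(m^0_t,m^1_t)]_{1\bullet}\,(x^0_t,\hat x^1_t,u^{0*}_t,\bar q^*_t(m^1_t))&\text{if }z_{t+1}=\emptyset,\ \tilde z_t=m^1_t.\end{cases}$$ **Theorem.** The strategy pair in which $C^0$ plays $u^{0*}_t$ and $C^1$ plays $u^{1*}_t=\bar q^*_t(m^1_t)+\tilde q^*_t(x^1_t,m^1_t)$ for $t=0,\dots,T$ is feasible and optimal for Problem 1, i.e. it minimizes $J$ over all feasible strategy pairs. Moreover, under this pair, for every $t\le T$, almost surely, $\hat x^1_t$ is the mean $\mu(\theta_t)$ of the conditional distribution $\theta_t$ of $X^1_t$ given $H^0_t$, that is, $\hat x^1_t=\mathbb E[X^1_t\mid H^0_t]$. -/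

import Mathlib

open MeasureTheory ProbabilityTheory
open scoped Matrix

noncomputable section

namespace NCS

/-- Dimensions of the states and of the control actions of the global plant / controller `0` and
the local plant / controller `1`, and the numbers of global and local modes. -/
structure Dims where
  x0 : ℕ
  x1 : ℕ
  u0 : ℕ
  u1 : ℕ
  κ0 : ℕ
  κ1 : ℕ

namespace Dims

variable (d : Dims)

/-- Global states. -/
abbrev X0 : Type := Fin d.x0 → ℝ
/-- Local states. -/
abbrev X1 : Type := Fin d.x1 → ℝ
/-- Actions of the global controller. -/
abbrev U0 : Type := Fin d.u0 → ℝ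
/-- Actions of the local controller. -/
abbrev U1 : Type := Fin d.u1 → ℝ
/-- Global modes. -/
abbrev M0 : Type := Fin d.κ0
/-- Local modes. -/
abbrev M1 : Type := Fin d.κ1

/-- Index set of the components of `vec(x⁰, x¹)`. -/
abbrev IX : Type := Fin d.x0 ⊕ Fin d.x1
/-- Index set of the components of `vec(u⁰, u¹)`. -/
abbrev IU : Type := Fin d.u0 ⊕ Fin d.u1
/-- Index set of the components of `vec(u⁰, q(1), …, q(κ¹))`. -/
abbrev IQ : Type := Fin d.u0 ⊕ (Fin d.κ1 × Fin d.u1)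

/-- Output of the channel: `Sum.inl a` if `a` is received, `Sum.inr ()` (the symbol `∅`) if the
packet is dropped. -/
abbrev Received (α : Type) : Type := α ⊕ Unit

/-- The common information `(x⁰_{0:t}, m⁰_{0:t}, z_{0:t}, z̃_{0:t}, u⁰_{0:t-1})` at time `t`. -/
abbrev Hist (t : ℕ) : Type :=
  (Fin (t + 1) → d.X0) × (Fin (t + 1) → d.M0) × (Fin (t + 1) → Received d.X1) ×
    (Fin (t + 1) → Received d.M1) × (Fin t → d.U0)

variable {d}

/-- The current global state `x⁰_t`. -/
def Hist.x0 {t : ℕ} (h : d.Hist t) : d.X0 := h.1 (Fin.last t)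
/-- The current global mode `m⁰_t`. -/
def Hist.m0 {t : ℕ} (h : d.Hist t) : d.M0 := h.2.1 (Fin.last t)
/-- The current channel output `z_t`. -/
def Hist.z {t : ℕ} (h : d.Hist t) : Received d.X1 := h.2.2.1 (Fin.last t)
/-- The current channel output `z̃_t`. -/
def Hist.zt {t : ℕ} (h : d.Hist t) : Received d.M1 := h.2.2.2.1 (Fin.last t)

/-- The common information at time `t` contained in that at time `t + 1`. -/
def Hist.past {t : ℕ} (h : d.Hist (t + 1)) : d.Hist t :=
  (fun i => h.1 i.castSucc, fun i => h.2.1 i.castSucc, fun i => h.2.2.1 i.castSucc,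
    fun i => h.2.2.2.1 i.castSucc, fun i => h.2.2.2.2 i.castSucc)

/-- The common information at time `0`. -/
def Hist.start (x : d.X0) (m : d.M0) (z : Received d.X1) (zt : Received d.M1) : d.Hist 0 :=
  (fun _ => x, fun _ => m, fun _ => z, fun _ => zt, Fin.elim0)

/-- The common information at time `t + 1`: that at time `t`, the action `u⁰_t`, and the new
observations. -/
def Hist.extend {t : ℕ} (h : d.Hist t) (u : d.U0) (x : d.X0) (m : d.M0) (z : Received d.X1)
    (zt : Received d.M1) : d.Hist (t + 1) :=
  (Fin.snoc (α := fun _ => d.X0) h.1 x, Fin.snoc (α := fun _ => d.M0) h.2.1 m,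
    Fin.snoc (α := fun _ => Received d.X1) h.2.2.1 z,
    Fin.snoc (α := fun _ => Received d.M1) h.2.2.2.1 zt,
    Fin.snoc (α := fun _ => d.U0) h.2.2.2.2 u)

end Dims

open Dims

/-- The data of the problem: system matrices, cost matrices, and the distributions of the primitive
random variables (the packet goes through iff the link variable is `true`). -/
structure System (d : Dims) where
  A00 : d.M0 → Matrix (Fin d.x0) (Fin d.x0) ℝ
  A10 : d.M0 → d.M1 → Matrix (Fin d.x1) (Fin d.x0) ℝ
  A11 : d.M0 → d.M1 → Matrix (Fin d.x1) (Fin d.x1) ℝ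
  B00 : d.M0 → Matrix (Fin d.x0) (Fin d.u0) ℝ
  B10 : d.M0 → d.M1 → Matrix (Fin d.x1) (Fin d.u0) ℝ
  B11 : d.M0 → d.M1 → Matrix (Fin d.x1) (Fin d.u1) ℝ
  Q : ℕ → d.M0 → d.M1 → Matrix d.IX d.IX ℝ
  R : ℕ → d.M0 → d.M1 → Matrix d.IU d.IU ℝ
  lawX0 : Measure d.X0
  lawX1 : Measure d.X1
  lawW0 : ℕ → Measure d.X0
  lawW1 : ℕ → Measure d.X1
  lawM0 : Measure d.M0
  lawM1 : Measure d.M1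
  lawΓ : Measure Bool

/-- The primitive random variables: initial states, noises, modes and link states. -/
structure Primitives (d : Dims) (Ω : Type*) where
  x0 : Ω → d.X0
  x1 : Ω → d.X1
  w0 : ℕ → Ω → d.X0
  w1 : ℕ → Ω → d.X1
  m0 : ℕ → Ω → d.M0
  m1 : ℕ → Ω → d.M1
  γ : ℕ → Ω → Bool

/-- Indices of the primitive random variables up to the horizon `T`. -/
inductive Src (T : ℕ) : Type
  | x0 : Src T
  | x1 : Src T
  | w0 : Fin (T + 1) → Src T
  | w1 : Fin (T + 1) → Src T
  | m0 : Fin (T + 1) → Src T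
  | m1 : Fin (T + 1) → Src T
  | γ : Fin (T + 1) → Src T

/-- The space in which a primitive random variable takes its values. -/
def Src.Space (d : Dims) {T : ℕ} : Src T → Type
  | .x0 => d.X0
  | .x1 => d.X1
  | .w0 _ => d.X0
  | .w1 _ => d.X1
  | .m0 _ => d.M0
  | .m1 _ => d.M1
  | .γ _ => Bool

instance Src.instMeasurableSpace (d : Dims) {T : ℕ} : ∀ i : Src T, MeasurableSpace (i.Space d)
  | .x0 => inferInstanceAs (MeasurableSpace d.X0)
  | .x1 => inferInstanceAs (MeasurableSpace d.X1)
  | .w0 _ => inferInstanceAs (MeasurableSpace d.X0)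
  | .w1 _ => inferInstanceAs (MeasurableSpace d.X1)
  | .m0 _ => inferInstanceAs (MeasurableSpace d.M0)
  | .m1 _ => inferInstanceAs (MeasurableSpace d.M1)
  | .γ _ => inferInstanceAs (MeasurableSpace Bool)

/-- The primitive random variables as one family. -/
def Primitives.family {d : Dims} {Ω : Type*} (ξ : Primitives d Ω) {T : ℕ} :
    ∀ i : Src T, Ω → i.Space d
  | .x0 => ξ.x0
  | .x1 => ξ.x1
  | .w0 t => ξ.w0 t
  | .w1 t => ξ.w1 t
  | .m0 t => ξ.m0 t
  | .m1 t => ξ.m1 t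
  | .γ t => ξ.γ t

namespace System

variable {d : Dims} (S : System d)

/-- The assumptions on the cost matrices, the noises and the initial states. -/
structure Standing (T : ℕ) : Prop where
  Q_psd : ∀ t ≤ T, ∀ m0 m1, (S.Q t m0 m1).PosSemidef
  R_pd : ∀ t ≤ T, ∀ m0 m1, (S.R t m0 m1).PosDef
  x0_sq : MemLp id 2 S.lawX0
  x1_sq : MemLp id 2 S.lawX1
  w0_sq : ∀ t ≤ T, MemLp id 2 (S.lawW0 t)
  w1_sq : ∀ t ≤ T, MemLp id 2 (S.lawW1 t)
  w0_mean : ∀ t ≤ T, ∫ w, w ∂(S.lawW0 t) = 0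
  w1_mean : ∀ t ≤ T, ∫ w, w ∂(S.lawW1 t) = 0

/-- The primitive random variables have the prescribed distributions and are independent. -/
structure Realizes {Ω : Type*} [MeasurableSpace Ω] (P : Measure Ω) (T : ℕ)
    (ξ : Primitives d Ω) : Prop where
  measurable : ∀ i : Src T, Measurable (ξ.family i)
  indep : iIndepFun (fun i : Src T => ξ.family i) P
  law_x0 : P.map ξ.x0 = S.lawX0
  law_x1 : P.map ξ.x1 = S.lawX1
  law_w0 : ∀ t ≤ T, P.map (ξ.w0 t) = S.lawW0 t
  law_w1 : ∀ t ≤ T, P.map (ξ.w1 t) = S.lawW1 t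
  law_m0 : ∀ t ≤ T, P.map (ξ.m0 t) = S.lawM0
  law_m1 : ∀ t ≤ T, P.map (ξ.m1 t) = S.lawM1
  law_γ : ∀ t ≤ T, P.map (ξ.γ t) = S.lawΓ

/-- The probability of the global mode `m`. -/
def π0 (m : d.M0) : ℝ := S.lawM0.real {m}
/-- The probability of the local mode `m`. -/
def π1 (m : d.M1) : ℝ := S.lawM1.real {m}
/-- The probability of the link state `b`. -/
def p (b : Bool) : ℝ := S.lawΓ.real {b}

/-! ### System matrices -/

/-- `A(m⁰, m¹)`. -/
def A (m0 : d.M0) (m1 : d.M1) : Matrix d.IX d.IX ℝ :=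
  Matrix.fromBlocks (S.A00 m0) 0 (S.A10 m0 m1) (S.A11 m0 m1)

/-- `B(m⁰, m¹)`. -/
def B (m0 : d.M0) (m1 : d.M1) : Matrix d.IX d.IU ℝ :=
  Matrix.fromBlocks (S.B00 m0) 0 (S.B10 m0 m1) (S.B11 m0 m1)

/-- `D = [A B]`. -/
def D (m0 : d.M0) (m1 : d.M1) : Matrix d.IX (d.IX ⊕ d.IU) ℝ :=
  Matrix.fromCols (S.A m0 m1) (S.B m0 m1)

/-- `vec(x⁰, x¹, u⁰, u¹)`. -/
def vec (x0 : d.X0) (x1 : d.X1) (u0 : d.U0) (u1 : d.U1) : d.IX ⊕ d.IU → ℝ :=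
  Sum.elim (Sum.elim x0 x1) (Sum.elim u0 u1)

/-! ### Closed-loop behaviour -/

/-- A strategy of the global controller: `λ⁰_t` acts on the common information. -/
abbrev Strategy0 (d : Dims) : Type := ∀ t : ℕ, d.Hist t → d.U0

/-- A strategy of the local controller: `λ¹_t` acts on the common information and on the current
local state and mode. -/
abbrev Strategy1 (d : Dims) : Type := ∀ t : ℕ, d.Hist t × d.X1 × d.M1 → d.U1

section ClosedLoop

variable {Ω : Type*} (ξ : Primitives d Ω) (l0 : Strategy0 d) (l1 : Strategy1 d)

/-- The channel: its input is received iff the link state is `true`. -/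
def channel {α : Type} (b : Bool) (a : α) : Received α := if b then Sum.inl a else Sum.inr ()

/-- The common information `H⁰_t` and the local state `X¹_t` under the strategies `l0`, `l1`. -/
def run (ω : Ω) : ∀ t : ℕ, d.Hist t × d.X1
  | 0 => (Hist.start (ξ.x0 ω) (ξ.m0 0 ω) (channel (ξ.γ 0 ω) (ξ.x1 ω))
      (channel (ξ.γ 0 ω) (ξ.m1 0 ω)), ξ.x1 ω)
  | t + 1 =>
    let h := (run ω t).1
    let x1 := (run ω t).2
    let m1 := ξ.m1 t ω
    let u0 := l0 t h
    let u1 := l1 t (h, x1, m1)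
    let next : d.IX → ℝ :=
      S.A h.m0 m1 *ᵥ Sum.elim h.x0 x1 + S.B h.m0 m1 *ᵥ Sum.elim u0 u1
        + Sum.elim (ξ.w0 t ω) (ξ.w1 t ω)
    let y0 : d.X0 := fun i => next (Sum.inl i)
    let y1 : d.X1 := fun i => next (Sum.inr i)
    (h.extend u0 y0 (ξ.m0 (t + 1) ω) (channel (ξ.γ (t + 1) ω) y1)
      (channel (ξ.γ (t + 1) ω) (ξ.m1 (t + 1) ω)), y1)

/-- The common information `H⁰_t`. -/
def hist (t : ℕ) (ω : Ω) : d.Hist t := (S.run ξ l0 l1 ω t).1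
/-- The global state `X⁰_t`. -/
def state0 (t : ℕ) (ω : Ω) : d.X0 := (S.hist ξ l0 l1 t ω).x0
/-- The local state `X¹_t`. -/
def state1 (t : ℕ) (ω : Ω) : d.X1 := (S.run ξ l0 l1 ω t).2
/-- The action `U⁰_t`. -/
def action0 (t : ℕ) (ω : Ω) : d.U0 := l0 t (S.hist ξ l0 l1 t ω)
/-- The action `U¹_t`. -/
def action1 (t : ℕ) (ω : Ω) : d.U1 :=
  l1 t (S.hist ξ l0 l1 t ω, S.state1 ξ l0 l1 t ω, ξ.m1 t ω)

/-- The instantaneous cost `xᵀ Q_t x + uᵀ R_t u`. -/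
def cost (t : ℕ) (x0 : d.X0) (x1 : d.X1) (m0 : d.M0) (m1 : d.M1) (u0 : d.U0) (u1 : d.U1) : ℝ :=
  Sum.elim x0 x1 ⬝ᵥ (S.Q t m0 m1 *ᵥ Sum.elim x0 x1) +
    Sum.elim u0 u1 ⬝ᵥ (S.R t m0 m1 *ᵥ Sum.elim u0 u1)

variable [MeasurableSpace Ω] (P : Measure Ω) (T : ℕ)

/-- The total expected cost `J(λ⁰, λ¹)`. -/
def J : ℝ :=
  ∫ ω, ∑ t ∈ Finset.range (T + 1),
    S.cost t (S.state0 ξ l0 l1 t ω) (S.state1 ξ l0 l1 t ω) (ξ.m0 t ω) (ξ.m1 t ω)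
      (S.action0 ξ l0 l1 t ω) (S.action1 ξ l0 l1 t ω) ∂P

/-- Borel measurable strategies under which all states and actions have finite second moments. -/
structure Feasible : Prop where
  measurable0 : ∀ t ≤ T, Measurable (l0 t)
  measurable1 : ∀ t ≤ T, Measurable (l1 t)
  state0_sq : ∀ t ≤ T, MemLp (S.state0 ξ l0 l1 t) 2 P
  state1_sq : ∀ t ≤ T, MemLp (S.state1 ξ l0 l1 t) 2 P
  action0_sq : ∀ t ≤ T, MemLp (S.action0 ξ l0 l1 t) 2 P
  action1_sq : ∀ t ≤ T, MemLp (S.action1 ξ l0 l1 t) 2 P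

/-- `(l0, l1)` solves the decentralized control problem. -/
def IsOptimal : Prop :=
  S.Feasible ξ l0 l1 P T ∧
    ∀ (k0 : Strategy0 d) (k1 : Strategy1 d), S.Feasible ξ k0 k1 P T →
      S.J ξ l0 l1 P T ≤ S.J ξ k0 k1 P T

end ClosedLoop

/-! ### Operators, recursions and gains -/

/-- `Π(G)`: the mean of `G(M⁰, Z̃)`. -/
def PiOp {ι : Type} (G : d.M0 → Received d.M1 → Matrix ι ι ℝ) : Matrix ι ι ℝ :=
  S.p false • (∑ m0, S.π0 m0 • G m0 (Sum.inr ())) +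
    S.p true • (∑ m0, ∑ m1, (S.π0 m0 * S.π1 m1) • G m0 (Sum.inl m1))

/-- `Ψ(G¹, G²) = p(0) Π(G¹, 0) + p(1) Π(G², 1)`. -/
def PsiOp {ι : Type} (G1 G2 : d.M0 → Received d.M1 → Matrix ι ι ℝ) : Matrix ι ι ℝ :=
  S.p false • (∑ m0, S.π0 m0 • G1 m0 (Sum.inr ())) +
    S.p true • (∑ m0, ∑ m1, (S.π0 m0 * S.π1 m1) • G2 m0 (Sum.inl m1))

/-- The Schur complement of the lower right block. -/
def SC {ι κ : Type} [Fintype κ] [DecidableEq κ] (G : Matrix (ι ⊕ κ) (ι ⊕ κ) ℝ) : Matrix ι ι ℝ :=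
  G.toBlocks₁₁ - G.toBlocks₁₂ * G.toBlocks₂₂⁻¹ * G.toBlocks₂₁

/-- `-(G²²)⁻¹ G²¹`. -/
def gain {ι κ : Type} [Fintype κ] [DecidableEq κ] (G : Matrix (ι ⊕ κ) (ι ⊕ κ) ℝ) :
    Matrix κ ι ℝ :=
  -(G.toBlocks₂₂⁻¹ * G.toBlocks₂₁)

/-- `L_m`: maps `vec(x, u⁰, q(1), …, q(κ¹))` to `vec(x, u⁰, q(m))`. -/
def L (m : d.M1) : Matrix (d.IX ⊕ d.IU) (d.IX ⊕ d.IQ) ℝ :=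
  Matrix.fromBlocks 1 0 0
    (Matrix.fromBlocks 1 0 0 (Matrix.of fun i j => if j.1 = m ∧ j.2 = i then 1 else 0))

/-- `D¹¹ = [A¹¹ B¹¹]`. -/
def D11 (m0 : d.M0) (m1 : d.M1) : Matrix (Fin d.x1) (Fin d.x1 ⊕ Fin d.u1) ℝ :=
  Matrix.fromCols (S.A11 m0 m1) (S.B11 m0 m1)

/-- `D^aug`. -/
def Daug (m0 : d.M0) (m1 : d.M1) : Matrix d.IX (d.IX ⊕ d.IQ) ℝ := S.D m0 m1 * L m1

/-- `D^∅`. -/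
def Dempty (m0 : d.M0) : Matrix d.IX (d.IX ⊕ d.IQ) ℝ := ∑ m1, S.π1 m1 • S.Daug m0 m1

/-- `C_t`. -/
def C (t : ℕ) (m0 : d.M0) (m1 : d.M1) : Matrix (d.IX ⊕ d.IU) (d.IX ⊕ d.IU) ℝ :=
  Matrix.fromBlocks (S.Q t m0 m1) 0 0 (S.R t m0 m1)

/-- `C_t^∅`. -/
def Cempty (t : ℕ) (m0 : d.M0) : Matrix (d.IX ⊕ d.IQ) (d.IX ⊕ d.IQ) ℝ :=
  ∑ m1, S.π1 m1 • ((L m1)ᵀ * S.C t m0 m1 * L m1)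

/-- `C_t¹¹`. -/
def C11 (t : ℕ) (m0 : d.M0) (m1 : d.M1) :
    Matrix (Fin d.x1 ⊕ Fin d.u1) (Fin d.x1 ⊕ Fin d.u1) ℝ :=
  Matrix.fromBlocks (S.Q t m0 m1).toBlocks₂₂ 0 0 (S.R t m0 m1).toBlocks₂₂

/-- The matrices `P` indexed by `m⁰` and `z̃`. -/
abbrev PFam (d : Dims) : Type := d.M0 → Received d.M1 → Matrix d.IX d.IX ℝ
/-- The matrices `P̃` indexed by `m⁰` and `z̃`. -/
abbrev PtFam (d : Dims) : Type := d.M0 → Received d.M1 → Matrix (Fin d.x1) (Fin d.x1) ℝ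

section Step

/-! In this section `G`, `Gt` stand for `P_{t+1}`, `P̃_{t+1}`. -/

variable (t : ℕ) (G : PFam d) (Gt : PtFam d)

/-- `Ψ(P̃_{t+1}, P_{t+1}¹¹)`. -/
def Psi11 : Matrix (Fin d.x1) (Fin d.x1) ℝ := S.PsiOp Gt (fun m0 z => (G m0 z).toBlocks₂₂)

/-- `E_t^∅`. -/
def Eempty (m0 : d.M0) : Matrix (d.IX ⊕ d.IQ) (d.IX ⊕ d.IQ) ℝ :=
  (S.Dempty m0)ᵀ * S.PiOp G * S.Dempty m0

/-- `F_t^∅`. -/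
def Fempty (m0 : d.M0) : Matrix (d.IX ⊕ d.IQ) (d.IX ⊕ d.IQ) ℝ :=
  (∑ m1, S.π1 m1 • ((S.Daug m0 m1).toRows₂ᵀ * S.Psi11 G Gt * (S.Daug m0 m1).toRows₂)) -
    (S.Dempty m0).toRows₂ᵀ * S.Psi11 G Gt * (S.Dempty m0).toRows₂

/-- `H_t(m⁰, ∅)`. -/
def Hempty (m0 : d.M0) : Matrix (d.IX ⊕ d.IQ) (d.IX ⊕ d.IQ) ℝ :=
  S.Cempty t m0 + S.Eempty G m0 + S.Fempty G Gt m0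

/-- `H_t(m⁰, m¹)`. -/
def Hmode (m0 : d.M0) (m1 : d.M1) : Matrix (d.IX ⊕ d.IU) (d.IX ⊕ d.IU) ℝ :=
  S.C t m0 m1 + (S.D m0 m1)ᵀ * S.PiOp G * S.D m0 m1

/-- `H̃_t(m⁰, m¹)`. -/
def Htilde (m0 : d.M0) (m1 : d.M1) :
    Matrix (Fin d.x1 ⊕ Fin d.u1) (Fin d.x1 ⊕ Fin d.u1) ℝ :=
  S.C11 t m0 m1 + (S.D11 m0 m1)ᵀ * S.Psi11 G Gt * S.D11 m0 m1

/-- `P_t`. -/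
def stepP : PFam d
  | m0, Sum.inr _ => SC (S.Hempty t G Gt m0)
  | m0, Sum.inl m1 => SC (S.Hmode t G m0 m1)

/-- `P̃_t`. -/
def stepPt : PtFam d
  | m0, Sum.inr _ => ∑ m1, S.π1 m1 • SC (S.Htilde t G Gt m0 m1)
  | m0, Sum.inl m1 => SC (S.Htilde t G Gt m0 m1)

end Step

variable (T : ℕ)

/-- `(P_t, P̃_t)` with `t = T + 1 - k`, by backward recursion from `(P_{T+1}, P̃_{T+1}) = 0`. -/
def riccati : ℕ → PFam d × PtFam d
  | 0 => (0, 0)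
  | k + 1 => (S.stepP (T - k) (riccati k).1 (riccati k).2,
      S.stepPt (T - k) (riccati k).1 (riccati k).2)

/-- `P_t`. -/
def Pmat (t : ℕ) : PFam d := (S.riccati T (T + 1 - t)).1
/-- `P̃_t`. -/
def Ptmat (t : ℕ) : PtFam d := (S.riccati T (T + 1 - t)).2

/-- `K_t(m⁰, ∅)`. -/
def Kempty (t : ℕ) (m0 : d.M0) : Matrix d.IQ d.IX ℝ :=
  gain (S.Hempty t (S.Pmat T (t + 1)) (S.Ptmat T (t + 1)) m0)

/-- `K_t(m⁰, m¹)`. -/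
def Kmode (t : ℕ) (m0 : d.M0) (m1 : d.M1) : Matrix d.IU d.IX ℝ :=
  gain (S.Hmode t (S.Pmat T (t + 1)) m0 m1)

/-- `K̃_t(m⁰, m¹)`. -/
def Ktilde (t : ℕ) (m0 : d.M0) (m1 : d.M1) : Matrix (Fin d.u1) (Fin d.x1) ℝ :=
  gain (S.Htilde t (S.Pmat T (t + 1)) (S.Ptmat T (t + 1)) m0 m1)

/-! ### The optimal strategies -/

/-- `u⁰*_t` as a function of `m⁰_t, z̃_t, x⁰_t` and the estimate `x̂¹_t`. -/
def uStar (t : ℕ) (m0 : d.M0) (zt : Received d.M1) (x0 : d.X0) (xh : d.X1) : d.U0 :=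
  match zt with
  | Sum.inr _ => fun i => (S.Kempty T t m0 *ᵥ Sum.elim x0 xh) (Sum.inl i)
  | Sum.inl l => fun i => (S.Kmode T t m0 l *ᵥ Sum.elim x0 xh) (Sum.inl i)

/-- `q̄*_t(m¹)`. -/
def qbar (t : ℕ) (m0 : d.M0) (zt : Received d.M1) (x0 : d.X0) (xh : d.X1) (m1 : d.M1) : d.U1 :=
  match zt with
  | Sum.inr _ => fun i => (S.Kempty T t m0 *ᵥ Sum.elim x0 xh) (Sum.inr (m1, i))
  | Sum.inl l =>
    if m1 = l then fun i => (S.Kmode T t m0 l *ᵥ Sum.elim x0 xh) (Sum.inr i) else 0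

/-- `q̃*_t(x¹, m¹)`. -/
def qtilde (t : ℕ) (m0 : d.M0) (zt : Received d.M1) (xh : d.X1) (x1 : d.X1) (m1 : d.M1) : d.U1 :=
  match zt with
  | Sum.inr _ => S.Ktilde T t m0 m1 *ᵥ (x1 - xh)
  | Sum.inl _ => 0

/-- `[D(m⁰, m¹)]_{1•} vec(x⁰_t, x̂¹_t, u⁰*_t, q̄*_t(m¹))`. -/
def propagate (t : ℕ) (m0 : d.M0) (zt : Received d.M1) (x0 : d.X0) (xh : d.X1) (m1 : d.M1) :
    d.X1 :=
  (S.D m0 m1).toRows₂ *ᵥ vec x0 xh (S.uStar T t m0 zt x0 xh) (S.qbar T t m0 zt x0 xh m1)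

/-- The recursive estimate `x̂¹_t` as a function of the common information. -/
def xhat : ∀ t : ℕ, d.Hist t → d.X1
  | 0, h =>
    match h.z with
    | Sum.inl x => x
    | Sum.inr _ => ∫ x, x ∂S.lawX1
  | t + 1, h =>
    match h.z with
    | Sum.inl x => x
    | Sum.inr _ =>
      let g := h.past
      match g.zt with
      | Sum.inr _ => ∑ m1, S.π1 m1 • S.propagate T t g.m0 g.zt g.x0 (xhat t g) m1
      | Sum.inl l => S.propagate T t g.m0 g.zt g.x0 (xhat t g) l

/-- The strategy of the global controller: `u⁰*_t`. -/
def optStrategy0 : Strategy0 d := fun t h => S.uStar T t h.m0 h.zt h.x0 (S.xhat T t h)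

/-- The strategy of the local controller: `q̄*_t(m¹_t) + q̃*_t(x¹_t, m¹_t)`. -/
def optStrategy1 : Strategy1 d := fun t i =>
  S.qbar T t i.1.m0 i.1.zt i.1.x0 (S.xhat T t i.1) i.2.2 +
    S.qtilde T t i.1.m0 i.1.zt (S.xhat T t i.1) i.2.1 i.2.2

/-- The common belief `θ_t`: the conditional distribution of `X¹_t` given `H⁰_t = h`. -/
def belief {Ω : Type*} [MeasurableSpace Ω] (P : Measure Ω) [IsFiniteMeasure P]
    (ξ : Primitives d Ω) (l0 : Strategy0 d) (l1 : Strategy1 d) (t : ℕ) (h : d.Hist t) :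
    Measure d.X1 :=
  condDistrib (S.state1 ξ l0 l1 t) (S.hist ξ l0 l1 t) P h

end System

end NCS

end

/-! For an arbitrary feasible pair, only first conditional moments are needed. Let `b` be the
conditional mean of the local action given $(H^0_t, M^1_t)$, and let `est` be the estimator of the
local state driven by $U^0$ and `b`. The error of `est` and the deviation of $U^1_t$ from `b`
(together `dev`) are orthogonal, in the sense of `Orth`, to all square integrable functions of
$(H^0_t, M^1_t)$. By Pythagoras (`integral_qf_add`), each expected quadratic cost is a cost of the
conditional means plus a cost of the deviations. The means are steered by $u^0$ and the table $m
\mapsto b(h,m)$, that is, by one vector $(u^0, q(1), \dots, q(\kappa^1))$; the deviations are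
steered by the private part of $U^1$. The two minimizations decouple.

The orthogonality propagates in time (`StateMean.succ`). The next local state is a prediction plus
an innovation plus noise, and the innovation is the spread `modeDev` of the mode-conditional means
around their average, which produces the variance term of $H_t(m^0, \emptyset)$, plus $D^{11}$
applied to `dev`. Since $A$ and $B$ are block triangular, the next global state is a function of the
old common information and $W^0_t$, so it reveals nothing about the innovation. A transmission then
either reveals $X^1$, and the error becomes zero, or reveals nothing, and the history coincides with
its version `Hist.erase` before transmission. Averaging over the fresh modes and link state turns
the value after transmission into the value before it, with matrices $\Pi(P)$ and $\Psi(\tilde P,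
P^{11})$ (`StateMean.integral_postValue`); the block $P^{11}$ enters because on reception the former
error is absorbed into the known state.

The expected stage cost plus the next value is therefore a form $H_t$ in the means, plus a form
$\tilde H_t$ in the deviations, plus a constant from the noise (`integral_step`). Completing squares
in the action blocks leaves the Schur complements $P_t$ and $\tilde P_t$: an inequality for every
pair (`step_le`), an equality for the stated gains (`step_eq`). Telescoping bounds every cost below
by the same number `optCost`, which the candidate attains because its mean local action is $\bar
q^*$ and its deviation is $\tilde K_t$ times the estimation error. The claim on $\hat x^1$ is the
orthogonality itself, read through `condExp_eq_of_orth`.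

Positivity of all mode probabilities serves twice: it makes the action block of $H_t(m^0,
\emptyset)$ invertible, and it makes the quantities attached to modes that did not occur integrable.
-/

noncomputable section

namespace NCS

open Dims

/-! ### Quadratic forms -/

section QuadraticForms

variable {ι κ : Type*} [Fintype ι] [Fintype κ]

/-- The quadratic form `xᵀ A x`. -/
def qf (A : Matrix ι ι ℝ) (x : ι → ℝ) : ℝ := x ⬝ᵥ (A *ᵥ x)

lemma qf_add (A B : Matrix ι ι ℝ) (x : ι → ℝ) : qf (A + B) x = qf A x + qf B x := by
  simp [qf, Matrix.add_mulVec]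

lemma qf_sub (A B : Matrix ι ι ℝ) (x : ι → ℝ) : qf (A - B) x = qf A x - qf B x := by
  simp [qf, Matrix.sub_mulVec]

lemma qf_smul (c : ℝ) (A : Matrix ι ι ℝ) (x : ι → ℝ) : qf (c • A) x = c * qf A x := by
  simp [qf, Matrix.smul_mulVec]

lemma qf_zero (x : ι → ℝ) : qf (0 : Matrix ι ι ℝ) x = 0 := by
  simp [qf]

lemma qf_vec_zero (A : Matrix ι ι ℝ) : qf A 0 = 0 := by
  simp [qf]

lemma qf_sum {α : Type*} (s : Finset α) (A : α → Matrix ι ι ℝ) (x : ι → ℝ) :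
    qf (∑ a ∈ s, A a) x = ∑ a ∈ s, qf (A a) x := by
  simp [qf, Matrix.sum_mulVec, dotProduct_sum]

lemma qf_conj (A : Matrix ι ι ℝ) (B : Matrix ι κ ℝ) (x : κ → ℝ) :
    qf (Bᵀ * A * B) x = qf A (B *ᵥ x) := by
  simp only [qf, ← Matrix.mulVec_mulVec, Matrix.dotProduct_mulVec, Matrix.vecMul_transpose]

lemma qf_apply (A : Matrix ι ι ℝ) (x : ι → ℝ) : qf A x = ∑ i, ∑ j, A i j * (x i * x j) := by
  simp only [qf, dotProduct, Matrix.mulVec, Finset.mul_sum]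
  exact Finset.sum_congr rfl fun i _ => Finset.sum_congr rfl fun j _ => by ring

lemma qf_fromBlocks_diag (A : Matrix ι ι ℝ) (B : Matrix κ κ ℝ) (x : ι → ℝ) (y : κ → ℝ) :
    qf (Matrix.fromBlocks A 0 0 B) (Sum.elim x y) = qf A x + qf B y := by
  simp [qf, Matrix.fromBlocks_mulVec, sumElim_dotProduct_sumElim]

lemma qf_elim_zero_left (H : Matrix (ι ⊕ κ) (ι ⊕ κ) ℝ) (y : κ → ℝ) :
    qf H (Sum.elim 0 y) = qf H.toBlocks₂₂ y := by
  rw [← Matrix.fromBlocks_toBlocks H]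
  simp [qf, Matrix.fromBlocks_mulVec, sumElim_dotProduct_sumElim]

/-- The weighted variance identity for quadratic forms. -/
lemma sum_qf_sub_mean {α : Type*} [Fintype α] (w : α → ℝ) (hw : ∑ a, w a = 1)
    (A : Matrix ι ι ℝ) (y : α → ι → ℝ) :
    ∑ a, w a * qf A (y a - ∑ a', w a' • y a') =
      ∑ a, w a * qf A (y a) - qf A (∑ a, w a • y a) := by
  set z := ∑ a', w a' • y a' with hz
  -- The matrix need not be symmetric, so the two cross terms are kept apart; after summation each
  -- of them equals `qf A z`.
  have h1 : ∀ a, w a * qf A (y a - z) =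
      w a * qf A (y a) - (w a • y a) ⬝ᵥ (A *ᵥ z) - z ⬝ᵥ (A *ᵥ (w a • y a)) + w a * qf A z := by
    intro a
    simp only [qf, Matrix.mulVec_sub, dotProduct_sub, sub_dotProduct, Matrix.mulVec_smul,
      dotProduct_smul, smul_dotProduct, smul_eq_mul]
    ring
  simp only [h1, Finset.sum_add_distrib, Finset.sum_sub_distrib, ← sum_dotProduct,
    ← dotProduct_sum, ← Matrix.mulVec_sum, ← Finset.sum_mul, hw, ← hz]
  simp only [qf]
  ring

lemma posSemidef_iff_qf {A : Matrix ι ι ℝ} :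
    A.PosSemidef ↔ A.IsHermitian ∧ ∀ x, 0 ≤ qf A x := by
  rw [Matrix.posSemidef_iff_dotProduct_mulVec]; simp [qf]

lemma posDef_iff_qf {A : Matrix ι ι ℝ} :
    A.PosDef ↔ A.IsHermitian ∧ ∀ x, x ≠ 0 → 0 < qf A x := by
  rw [Matrix.posDef_iff_dotProduct_mulVec]; simp [qf]

lemma posSemidef_conj {A : Matrix ι ι ℝ} (hA : A.PosSemidef) (B : Matrix ι κ ℝ) :
    (Bᵀ * A * B).PosSemidef := by
  simpa using hA.conjTranspose_mul_mul_same B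

lemma posSemidef_fromBlocks_diag {A : Matrix ι ι ℝ} {B : Matrix κ κ ℝ} (hA : A.PosSemidef)
    (hB : B.PosSemidef) : (Matrix.fromBlocks A 0 0 B).PosSemidef := by
  refine posSemidef_iff_qf.2 ⟨Matrix.IsHermitian.fromBlocks hA.1 (by simp) hB.1, fun x => ?_⟩
  rw [← Sum.elim_comp_inl_inr x, qf_fromBlocks_diag]
  exact add_nonneg ((posSemidef_iff_qf.1 hA).2 _) ((posSemidef_iff_qf.1 hB).2 _)

end QuadraticForms

section Blocks

variable {ι κ : Type*}

lemma posSemidef_toBlocks₂₂ {H : Matrix (ι ⊕ κ) (ι ⊕ κ) ℝ} (hH : H.PosSemidef) :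
    H.toBlocks₂₂.PosSemidef := hH.submatrix Sum.inr

lemma posDef_toBlocks₂₂ {H : Matrix (ι ⊕ κ) (ι ⊕ κ) ℝ} (hH : H.PosDef) :
    H.toBlocks₂₂.PosDef := hH.submatrix Sum.inr_injective

end Blocks

namespace System

/-! ### Schur complements as minima over the action block. -/

section Schur

variable {ι κ : Type} [Fintype ι] [Fintype κ] [DecidableEq κ]

/-- Completion of the square. -/
lemma qf_eq_SC_add {H : Matrix (ι ⊕ κ) (ι ⊕ κ) ℝ} (hH : H.IsHermitian)
    (hU : H.toBlocks₂₂.PosDef) (x : ι → ℝ) (v : κ → ℝ) :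
    qf H (Sum.elim x v) = qf (SC H) x + qf H.toBlocks₂₂ (v - gain H *ᵥ x) := by
  have hB : H.toBlocks₂₁ = H.toBlocks₁₂ᴴ := by
    ext i j
    exact (hH.apply (Sum.inr i) (Sum.inl j)).symm
  let _ := hU.isUnit.invertible
  have h := Matrix.schur_complement_eq₂₂ H.toBlocks₁₁ H.toBlocks₁₂ x v hU.1
  rw [← hB, Matrix.fromBlocks_toBlocks] at h
  simp only [star_trivial, ← Matrix.dotProduct_mulVec] at h
  rw [qf, h, qf, qf, SC, gain, Matrix.neg_mulVec, sub_neg_eq_add, add_comm v, add_comm]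

/-- The completed square is nonnegative. This is the source of every inequality in the lower bound;
`qf_gain` is the matching equality case, where the square vanishes. -/
lemma SC_le_qf {H : Matrix (ι ⊕ κ) (ι ⊕ κ) ℝ} (hH : H.IsHermitian)
    (hU : H.toBlocks₂₂.PosDef) (x : ι → ℝ) (v : κ → ℝ) :
    qf (SC H) x ≤ qf H (Sum.elim x v) := by
  rw [qf_eq_SC_add hH hU]
  linarith [(posSemidef_iff_qf.1 hU.posSemidef).2 (v - gain H *ᵥ x)]

lemma qf_gain {H : Matrix (ι ⊕ κ) (ι ⊕ κ) ℝ} (hH : H.IsHermitian)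
    (hU : H.toBlocks₂₂.PosDef) (x : ι → ℝ) :
    qf H (Sum.elim x (gain H *ᵥ x)) = qf (SC H) x := by
  rw [qf_eq_SC_add hH hU, sub_self, qf_vec_zero, add_zero]

lemma SC_posSemidef {H : Matrix (ι ⊕ κ) (ι ⊕ κ) ℝ} (hH : H.PosSemidef)
    (hU : H.toBlocks₂₂.PosDef) : (SC H).PosSemidef := by
  have hB : H.toBlocks₂₁ = H.toBlocks₁₂ᴴ := by
    ext i j
    exact (hH.1.apply (Sum.inr i) (Sum.inl j)).symm
  let _ := hU.isUnit.invertible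
  have h := Matrix.PosDef.fromBlocks₂₂ H.toBlocks₁₁ H.toBlocks₁₂ hU
  rw [← hB, Matrix.fromBlocks_toBlocks] at h
  exact h.1 hH

end Schur

/-! ### The quadratic forms of the matrices in the recursion. -/

variable {d : Dims} (S : System d)

lemma L_mulVec (m : d.M1) (x : d.IX → ℝ) (u : d.U0) (q : Fin d.κ1 × Fin d.u1 → ℝ) :
    (L m : Matrix (d.IX ⊕ d.IU) (d.IX ⊕ d.IQ) ℝ) *ᵥ Sum.elim x (Sum.elim u q) =
      Sum.elim x (Sum.elim u fun i => q (m, i)) := by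
  have h : (Matrix.of fun (i : Fin d.u1) (j : Fin d.κ1 × Fin d.u1) =>
      if j.1 = m ∧ j.2 = i then (1 : ℝ) else 0) *ᵥ q = fun i => q (m, i) := by
    ext i
    simp [Matrix.mulVec, dotProduct, Fintype.sum_prod_type, ite_and]
  simp [L, Matrix.fromBlocks_mulVec, h]

lemma toRows₂_mulVec {ι₁ ι₂ κ : Type*} [Fintype κ] (M : Matrix (ι₁ ⊕ ι₂) κ ℝ) (x : κ → ℝ) :
    M.toRows₂ *ᵥ x = (M *ᵥ x) ∘ Sum.inr := rfl

/-- The vector `vec(x, u⁰, q(1), …, q(κ¹))`. -/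
def aug (x : d.IX → ℝ) (u : d.U0) (q : d.M1 → d.U1) : d.IX ⊕ d.IQ → ℝ :=
  Sum.elim x (Sum.elim u fun j => q j.1 j.2)

lemma L_mulVec_aug (m : d.M1) (x : d.IX → ℝ) (u : d.U0) (q : d.M1 → d.U1) :
    L m *ᵥ aug x u q = Sum.elim x (Sum.elim u (q m)) := L_mulVec ..

lemma Dempty_mulVec (m0 : d.M0) (a : d.IX ⊕ d.IQ → ℝ) :
    S.Dempty m0 *ᵥ a = ∑ m, S.π1 m • (S.D m0 m *ᵥ (L m *ᵥ a)) := by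
  simp [Dempty, Daug, Matrix.sum_mulVec, Matrix.smul_mulVec, Matrix.mulVec_mulVec]

/-- The difference defining `Fempty` is a mean of squares minus the square of the mean, hence the
variance, over the unobserved local mode, of the predicted local state. This form gives its
positivity and identifies it with the cost of `modeDev`. -/
lemma qf_Fempty (hπ : ∑ m, S.π1 m = 1) (G : PFam d) (Gt : PtFam d) (m0 : d.M0)
    (a : d.IX ⊕ d.IQ → ℝ) :
    qf (S.Fempty G Gt m0) a = ∑ m, S.π1 m * qf (S.Psi11 G Gt)
      ((S.D m0 m *ᵥ (L m *ᵥ a)) ∘ Sum.inr -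
        (∑ m', S.π1 m' • (S.D m0 m' *ᵥ (L m' *ᵥ a))) ∘ Sum.inr) := by
  have hc : (∑ m', S.π1 m' • (S.D m0 m' *ᵥ (L m' *ᵥ a))) ∘ Sum.inr =
      ∑ m', S.π1 m' • ((S.D m0 m' *ᵥ (L m' *ᵥ a)) ∘ Sum.inr : Fin d.x1 → ℝ) := by
    ext i; simp
  have h := sum_qf_sub_mean S.π1 hπ (S.Psi11 G Gt)
    (fun m => (S.D m0 m *ᵥ (L m *ᵥ a)) ∘ Sum.inr)
  rw [hc, h, Fempty, qf_sub, qf_sum]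
  simp only [qf_smul, qf_conj, toRows₂_mulVec, Dempty_mulVec, hc, Daug, ← Matrix.mulVec_mulVec]

/-- Everything is brought under one average over the mode, including the term in the mean that does
not depend on it; this is possible because the weights sum to one. In this shape it is compared with
`avg` in `avg_eq_meanValue`. -/
lemma qf_Hempty (hπ : ∑ m, S.π1 m = 1) (t : ℕ) (G : PFam d) (Gt : PtFam d) (m0 : d.M0)
    (a : d.IX ⊕ d.IQ → ℝ) :
    qf (S.Hempty t G Gt m0) a = ∑ m, S.π1 m * (qf (S.C t m0 m) (L m *ᵥ a) +
      qf (S.PiOp G) (∑ m', S.π1 m' • (S.D m0 m' *ᵥ (L m' *ᵥ a))) + qf (S.Psi11 G Gt)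
      ((S.D m0 m *ᵥ (L m *ᵥ a)) ∘ Sum.inr -
        (∑ m', S.π1 m' • (S.D m0 m' *ᵥ (L m' *ᵥ a))) ∘ Sum.inr)) := by
  simp only [Hempty, qf_add, qf_Fempty S hπ, mul_add, Finset.sum_add_distrib, Eempty, qf_conj,
    Dempty_mulVec, Cempty, qf_sum, qf_smul]
  rw [← Finset.sum_mul, hπ, one_mul]

lemma qf_Hmode (t : ℕ) (G : PFam d) (m0 : d.M0) (m1 : d.M1) (z : d.IX ⊕ d.IU → ℝ) :
    qf (S.Hmode t G m0 m1) z = qf (S.C t m0 m1) z + qf (S.PiOp G) (S.D m0 m1 *ᵥ z) := by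
  simp only [Hmode, qf_add, qf_conj]

lemma qf_Htilde (t : ℕ) (G : PFam d) (Gt : PtFam d) (m0 : d.M0) (m1 : d.M1)
    (z : Fin d.x1 ⊕ Fin d.u1 → ℝ) :
    qf (S.Htilde t G Gt m0 m1) z =
      qf (S.C11 t m0 m1) z + qf (S.Psi11 G Gt) (S.D11 m0 m1 *ᵥ z) := by
  simp only [Htilde, qf_add, qf_conj]

lemma π0_nonneg (m : d.M0) : 0 ≤ S.π0 m := measureReal_nonneg
lemma π1_nonneg (m : d.M1) : 0 ≤ S.π1 m := measureReal_nonneg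
lemma p_nonneg (b : Bool) : 0 ≤ S.p b := measureReal_nonneg

/-! ### Positivity of the recursion. -/

section Positivity

variable {S} {T : ℕ}

lemma PsiOp_posSemidef {ι : Type} {G1 G2 : d.M0 → Received d.M1 → Matrix ι ι ℝ}
    (h1 : ∀ m0 z, (G1 m0 z).PosSemidef) (h2 : ∀ m0 z, (G2 m0 z).PosSemidef) :
    (S.PsiOp G1 G2).PosSemidef := by
  refine Matrix.PosSemidef.add (.smul ?_ (S.p_nonneg _)) (.smul ?_ (S.p_nonneg _))
  · exact Matrix.posSemidef_sum _ fun m0 _ => (h1 m0 _).smul (S.π0_nonneg m0)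
  · exact Matrix.posSemidef_sum _ fun m0 _ => Matrix.posSemidef_sum _ fun m1 _ =>
      (h2 m0 _).smul (mul_nonneg (S.π0_nonneg m0) (S.π1_nonneg m1))

lemma Psi11_posSemidef {G : PFam d} {Gt : PtFam d} (hG : ∀ m0 z, (G m0 z).PosSemidef)
    (hGt : ∀ m0 z, (Gt m0 z).PosSemidef) : (S.Psi11 G Gt).PosSemidef :=
  PsiOp_posSemidef hGt fun m0 z => posSemidef_toBlocks₂₂ (hG m0 z)

lemma C_posSemidef (hS : S.Standing T) {t : ℕ} (ht : t ≤ T) (m0 : d.M0) (m1 : d.M1) :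
    (S.C t m0 m1).PosSemidef :=
  posSemidef_fromBlocks_diag (hS.Q_psd t ht m0 m1) (hS.R_pd t ht m0 m1).posSemidef

lemma Hmode_posSemidef (hS : S.Standing T) {t : ℕ} (ht : t ≤ T) {G : PFam d}
    (hG : ∀ m0 z, (G m0 z).PosSemidef)
    (m0 : d.M0) (m1 : d.M1) :
    (S.Hmode t G m0 m1).PosSemidef ∧ (S.Hmode t G m0 m1).toBlocks₂₂.PosDef := by
  have h1 : ((S.D m0 m1)ᵀ * S.PiOp G * S.D m0 m1).PosSemidef :=
    -- `PiOp G` unfolds to `PsiOp G G`.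
    posSemidef_conj (PsiOp_posSemidef hG hG) _
  exact ⟨(C_posSemidef hS ht m0 m1).add h1,
    (hS.R_pd t ht m0 m1).add_posSemidef (posSemidef_toBlocks₂₂ h1)⟩

lemma Htilde_posSemidef (hS : S.Standing T) {t : ℕ} (ht : t ≤ T) {G : PFam d} {Gt : PtFam d}
    (hG : ∀ m0 z, (G m0 z).PosSemidef) (hGt : ∀ m0 z, (Gt m0 z).PosSemidef)
    (m0 : d.M0) (m1 : d.M1) :
    (S.Htilde t G Gt m0 m1).PosSemidef ∧ (S.Htilde t G Gt m0 m1).toBlocks₂₂.PosDef := by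
  have h1 : ((S.D11 m0 m1)ᵀ * S.Psi11 G Gt * S.D11 m0 m1).PosSemidef :=
    posSemidef_conj (Psi11_posSemidef hG hGt) _
  have h2 := posDef_toBlocks₂₂ (hS.R_pd t ht m0 m1)
  exact ⟨(posSemidef_fromBlocks_diag (posSemidef_toBlocks₂₂ (hS.Q_psd t ht m0 m1))
      h2.posSemidef).add h1, h2.add_posSemidef (posSemidef_toBlocks₂₂ h1)⟩

/-- On the action block the form is the average of $R_t(m^0, m)$ at $(u^0, q(m))$. A nonzero action
vector has a nonzero piece $(u^0, q(m))$ for some $m$, and that mode has positive weight. -/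
lemma Cempty_posSemidef (hS : S.Standing T) (hpos : ∀ m : d.M1, 0 < S.π1 m)
    (hπ : ∑ m, S.π1 m = 1) {t : ℕ} (ht : t ≤ T) (m0 : d.M0) :
    (S.Cempty t m0).PosSemidef ∧ (S.Cempty t m0).toBlocks₂₂.PosDef := by
  have h1 : (S.Cempty t m0).PosSemidef := Matrix.posSemidef_sum _ fun m1 _ =>
    (posSemidef_conj (C_posSemidef hS ht m0 m1) _).smul (S.π1_nonneg m1)
  refine ⟨h1, posDef_iff_qf.2 ⟨(posSemidef_toBlocks₂₂ h1).1, fun v hv => ?_⟩⟩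
  have hval : ∀ m, S.π1 m * qf (S.C t m0 m) (L m *ᵥ Sum.elim 0 v) =
      S.π1 m * qf (S.R t m0 m) (Sum.elim (v ∘ Sum.inl) fun i => v (Sum.inr (m, i))) := by
    intro m
    conv_lhs => rw [← Sum.elim_comp_inl_inr v, L_mulVec, C, qf_fromBlocks_diag, qf_vec_zero,
      zero_add]
    rfl
  rw [← qf_elim_zero_left, Cempty, qf_sum]
  simp only [qf_smul, qf_conj, hval]
  have hR := fun m => posDef_iff_qf.1 (hS.R_pd t ht m0 m)
  have hR' := fun m => (posSemidef_iff_qf.1 (hS.R_pd t ht m0 m).posSemidef).2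
  obtain ⟨m, hm⟩ : ∃ m : d.M1,
      (Sum.elim (v ∘ Sum.inl) fun i => v (Sum.inr (m, i)) : d.IU → ℝ) ≠ 0 := by
    by_contra! hcon
    -- The component $u^0$ is seen only through some mode, so at least one mode must exist; this
    -- follows from the weights summing to one.
    obtain ⟨m, -⟩ : ∃ m : d.M1, True := by
      by_contra! hne
      have : IsEmpty d.M1 := ⟨fun m => (hne m).elim⟩
      simp at hπ
    refine hv (funext fun j => ?_)
    rcases j with i | ⟨m', i⟩
    · exact congrFun (hcon m) (Sum.inl i)
    · exact congrFun (hcon m') (Sum.inr i)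
  exact Finset.sum_pos' (fun m _ => mul_nonneg (S.π1_nonneg m) (hR' m _))
    ⟨m, Finset.mem_univ m, mul_pos (hpos m) ((hR m).2 _ hm)⟩

lemma Fempty_posSemidef (hπ : ∑ m, S.π1 m = 1) {G : PFam d} {Gt : PtFam d}
    (hG : ∀ m0 z, (G m0 z).PosSemidef) (hGt : ∀ m0 z, (Gt m0 z).PosSemidef) (m0 : d.M0) :
    (S.Fempty G Gt m0).PosSemidef := by
  have hΨ : (S.Psi11 G Gt).PosSemidef := Psi11_posSemidef hG hGt
  refine posSemidef_iff_qf.2 ⟨?_, fun x => ?_⟩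
  · exact Matrix.IsHermitian.sub (Matrix.posSemidef_sum _ fun m1 _ =>
      (posSemidef_conj hΨ _).smul (S.π1_nonneg m1)).1 (posSemidef_conj hΨ _).1
  · rw [qf_Fempty S hπ]
    exact Finset.sum_nonneg fun m _ => mul_nonneg (S.π1_nonneg m) ((posSemidef_iff_qf.1 hΨ).2 _)

lemma Hempty_posSemidef (hS : S.Standing T) (hpos : ∀ m : d.M1, 0 < S.π1 m)
    (hπ : ∑ m, S.π1 m = 1) {t : ℕ} (ht : t ≤ T) {G : PFam d} {Gt : PtFam d}
    (hG : ∀ m0 z, (G m0 z).PosSemidef) (hGt : ∀ m0 z, (Gt m0 z).PosSemidef) (m0 : d.M0) :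
    (S.Hempty t G Gt m0).PosSemidef ∧ (S.Hempty t G Gt m0).toBlocks₂₂.PosDef := by
  have hC := Cempty_posSemidef hS hpos hπ ht m0
  have hE : (S.Eempty G m0).PosSemidef := posSemidef_conj (PsiOp_posSemidef hG hG) _
  have hF := Fempty_posSemidef hπ hG hGt m0
  exact ⟨(hC.1.add hE).add hF,
    (hC.2.add_posSemidef (posSemidef_toBlocks₂₂ hE)).add_posSemidef (posSemidef_toBlocks₂₂ hF)⟩

/-- Each step takes Schur complements of positive semidefinite matrices whose action block is
positive definite, because the control cost is, so positivity and invertibility are carried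
backwards together. -/
lemma riccati_posSemidef (hS : S.Standing T) (hpos : ∀ m : d.M1, 0 < S.π1 m)
    (hπ : ∑ m, S.π1 m = 1) (k : ℕ) :
    (∀ m0 z, ((S.riccati T k).1 m0 z).PosSemidef) ∧
      ∀ m0 z, ((S.riccati T k).2 m0 z).PosSemidef := by
  induction k with
  | zero => exact ⟨fun _ _ => Matrix.PosSemidef.zero, fun _ _ => Matrix.PosSemidef.zero⟩
  | succ k ih =>
    have ht : T - k ≤ T := Nat.sub_le _ _
    have hH := fun m0 m1 => Htilde_posSemidef hS ht ih.1 ih.2 m0 m1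
    refine ⟨?_, ?_⟩
    · rintro m0 (m1 | _)
      · have h := Hmode_posSemidef hS ht ih.1 m0 m1
        exact SC_posSemidef h.1 h.2
      · have h := Hempty_posSemidef hS hpos hπ ht ih.1 ih.2 m0
        exact SC_posSemidef h.1 h.2
    · rintro m0 (m1 | _)
      · exact SC_posSemidef (hH m0 m1).1 (hH m0 m1).2
      · exact Matrix.posSemidef_sum Finset.univ fun m1 _ =>
          (SC_posSemidef (hH m0 m1).1 (hH m0 m1).2).smul (S.π1_nonneg m1)

end Positivity

/-- With `T = t + k`, the matrix at time `t` is the stage `k + 1` of `riccati`, which was built with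
the time index `T - k = t`. -/
lemma Pmat_eq {T t : ℕ} (ht : t ≤ T) :
    S.Pmat T t = S.stepP t (S.Pmat T (t + 1)) (S.Ptmat T (t + 1)) := by
  obtain ⟨k, rfl⟩ := Nat.exists_eq_add_of_le ht
  have h1 : t + k + 1 - t = k + 1 := by omega
  have h2 : t + k + 1 - (t + 1) = k := by omega
  have h3 : t + k - k = t := by omega
  simp only [Pmat, Ptmat, h1, h2, riccati, h3]

lemma Ptmat_eq {T t : ℕ} (ht : t ≤ T) :
    S.Ptmat T t = S.stepPt t (S.Pmat T (t + 1)) (S.Ptmat T (t + 1)) := by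
  obtain ⟨k, rfl⟩ := Nat.exists_eq_add_of_le ht
  have h1 : t + k + 1 - t = k + 1 := by omega
  have h2 : t + k + 1 - (t + 1) = k := by omega
  have h3 : t + k - k = t := by omega
  simp only [Pmat, Ptmat, h1, h2, riccati, h3]

end System

/-! ### Square integrable random vectors and orthogonality -/

section Probability

variable {Ω : Type*} [MeasurableSpace Ω] {P : Measure Ω}
variable {α β ι κ : Type*} [MeasurableSpace α] [MeasurableSpace β]

/-- All components of the random vector `Y` are square integrable. -/
def SqInt (Y : Ω → ι → ℝ) (P : Measure Ω) : Prop := ∀ i, MemLp (fun ω => Y ω i) 2 P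

/-- `Y` is orthogonal to all square integrable functions of `F`, i.e. `E[Y | F] = 0`. -/
def Orth (F : Ω → α) (Y : Ω → ℝ) (P : Measure Ω) : Prop :=
  ∀ φ : α → ℝ, Measurable φ → MemLp (fun ω => φ (F ω)) 2 P → ∫ ω, φ (F ω) * Y ω ∂P = 0

lemma integrable_mul_of_memLp {f g : Ω → ℝ} (hf : MemLp f 2 P) (hg : MemLp g 2 P) :
    Integrable (fun ω => f ω * g ω) P := hf.integrable_mul hg

/-- The selected variable is a finite sum of indicators times the candidates. This handles all
coefficients picked by random modes, channel symbols and link states. -/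
lemma memLp_switch {E : Type*} [NormedAddCommGroup E] {p : ENNReal} [Fintype κ]
    [MeasurableSpace κ] [MeasurableSingletonClass κ] {c : Ω → κ} (hc : Measurable c)
    {f : κ → Ω → E} (hf : ∀ k, MemLp (f k) p P) : MemLp (fun ω => f (c ω) ω) p P := by
  classical
  have h : (fun ω => f (c ω) ω) = fun ω => ∑ k, (c ⁻¹' {k}).indicator (f k) ω := by
    ext ω
    rw [Finset.sum_eq_single (c ω)]
    · simp
    · intro k _ hk
      exact Set.indicator_of_notMem (fun h => hk (by simpa using h.symm)) _
    · simp
  rw [h]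
  exact memLp_finsetSum _ fun k _ => (hf k).indicator (hc (measurableSet_singleton k))

lemma SqInt.of_memLp [Fintype ι] {Y : Ω → ι → ℝ} (h : MemLp Y 2 P) : SqInt Y P :=
  memLp_pi_iff.1 h

lemma SqInt.memLp [Fintype ι] {Y : Ω → ι → ℝ} (h : SqInt Y P) : MemLp Y 2 P :=
  memLp_pi_iff.2 h

lemma SqInt.add {X Y : Ω → ι → ℝ} (hX : SqInt X P) (hY : SqInt Y P) :
    SqInt (fun ω => X ω + Y ω) P := fun i => (hX i).add (hY i)

lemma SqInt.sub {X Y : Ω → ι → ℝ} (hX : SqInt X P) (hY : SqInt Y P) :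
    SqInt (fun ω => X ω - Y ω) P := fun i => (hX i).sub (hY i)

lemma SqInt.const [IsFiniteMeasure P] (x : ι → ℝ) : SqInt (fun _ : Ω => x) P :=
  fun i => memLp_const (x i)

lemma SqInt.elim {X : Ω → ι → ℝ} {Y : Ω → κ → ℝ} (hX : SqInt X P) (hY : SqInt Y P) :
    SqInt (fun ω => Sum.elim (X ω) (Y ω)) P := by
  rintro (i | i)
  · exact hX i
  · exact hY i

lemma SqInt.comp {X : Ω → ι → ℝ} (hX : SqInt X P) (g : κ → ι) :
    SqInt (fun ω => X ω ∘ g) P := fun i => hX (g i)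

lemma SqInt.mulVec [Fintype ι] {X : Ω → ι → ℝ} (hX : SqInt X P) (A : Matrix κ ι ℝ) :
    SqInt (fun ω => A *ᵥ X ω) P := fun i => by
  simpa [Matrix.mulVec, dotProduct] using
    memLp_finsetSum Finset.univ fun j _ => (hX j).const_mul (A i j)

lemma SqInt.switch [Fintype κ] [MeasurableSpace κ] [MeasurableSingletonClass κ] {c : Ω → κ}
    (hc : Measurable c) {X : κ → Ω → ι → ℝ} (hX : ∀ k, SqInt (X k) P) :
    SqInt (fun ω => X (c ω) ω) P := fun i => memLp_switch hc fun k => hX k i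

lemma SqInt.measurable_mulVec {γ : Type*} [Fintype ι] [Fintype κ] [MeasurableSpace κ]
    [MeasurableSingletonClass κ] {c : Ω → κ} (hc : Measurable c) (A : κ → Matrix γ ι ℝ)
    {X : Ω → ι → ℝ} (hX : SqInt X P) : SqInt (fun ω => A (c ω) *ᵥ X ω) P :=
  SqInt.switch (X := fun k ω => A k *ᵥ X ω) hc fun k => hX.mulVec (A k)

lemma measurable_qf [Fintype ι] (A : Matrix ι ι ℝ) : Measurable (qf A) := by
  have h : qf A = fun x => ∑ i, ∑ j, A i j * (x i * x j) := funext fun x => qf_apply A x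
  rw [h]
  fun_prop

lemma integrable_qf [Fintype ι] (A : Matrix ι ι ℝ) {X : Ω → ι → ℝ} (hX : SqInt X P) :
    Integrable (fun ω => qf A (X ω)) P := by
  simp only [qf_apply]
  exact integrable_finsetSum _ fun i _ => integrable_finsetSum _ fun j _ =>
    ((hX i).integrable_mul (hX j)).const_mul _

lemma integrable_qf_switch [Fintype ι] [Fintype κ] [MeasurableSpace κ]
    [MeasurableSingletonClass κ] {c : Ω → κ} (hc : Measurable c) (A : κ → Matrix ι ι ℝ)
    {X : Ω → ι → ℝ} (hX : SqInt X P) : Integrable (fun ω => qf (A (c ω)) (X ω)) P :=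
  memLp_one_iff_integrable.1 <| memLp_switch (f := fun k ω => qf (A k) (X ω)) hc
    fun k => memLp_one_iff_integrable.2 (integrable_qf (A k) hX)

lemma Orth.comp {F : Ω → α} {Y : Ω → ℝ} (h : Orth F Y P) {g : α → β} (hg : Measurable g) :
    Orth (fun ω => g (F ω)) Y P := fun φ hφ hL => h (fun a => φ (g a)) (hφ.comp hg) hL

lemma Orth.add {F : Ω → α} {X Y : Ω → ℝ} (hX : Orth F X P) (hY : Orth F Y P)
    (hXL : MemLp X 2 P) (hYL : MemLp Y 2 P) : Orth F (fun ω => X ω + Y ω) P := by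
  intro φ hφ hL
  simp only [mul_add]
  rw [integral_add (integrable_mul_of_memLp hL hXL) (integrable_mul_of_memLp hL hYL),
    hX φ hφ hL, hY φ hφ hL, add_zero]

lemma Orth.zero {F : Ω → α} : Orth F (fun _ => 0) P := by
  intro φ _ _; simp

lemma Orth.sum {F : Ω → α} {s : Finset κ} {X : κ → Ω → ℝ} (hX : ∀ k ∈ s, Orth F (X k) P)
    (hL : ∀ k ∈ s, MemLp (X k) 2 P) : Orth F (fun ω => ∑ k ∈ s, X k ω) P := by
  intro φ hφ hφL
  simp only [Finset.mul_sum]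
  rw [integral_finsetSum _ fun k hk => integrable_mul_of_memLp hφL (hL k hk)]
  exact Finset.sum_eq_zero fun k hk => hX k hk φ hφ hφL

/-- A coefficient that is a finitely valued function of `F` is absorbed into the test function. -/
lemma Orth.switch_mul [Fintype κ] [MeasurableSpace κ] [MeasurableSingletonClass κ] {F : Ω → α}
    (hF : Measurable F) {Y : Ω → ℝ} (hY : Orth F Y P) {c : α → κ} (hc : Measurable c)
    (a : κ → ℝ) : Orth F (fun ω => a (c (F ω)) * Y ω) P := by
  intro φ hφ hL
  have h := hY (fun x => φ x * a (c x)) (hφ.mul ((measurable_of_finite a).comp hc))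
    (memLp_switch (f := fun k ω => φ (F ω) * a k) (hc.comp hF) fun k => hL.mul_const _)
  simpa only [mul_assoc] using h

lemma Orth.switch_mulVec {γ : Type*} [Fintype ι] [Fintype κ] [MeasurableSpace κ]
    [MeasurableSingletonClass κ] {F : Ω → α} (hF : Measurable F) {Y : Ω → ι → ℝ}
    (hY : ∀ i, Orth F (fun ω => Y ω i) P) (hYL : SqInt Y P) {c : α → κ} (hc : Measurable c)
    (A : κ → Matrix γ ι ℝ) (j : γ) : Orth F (fun ω => (A (c (F ω)) *ᵥ Y ω) j) P := by
  simp only [Matrix.mulVec, dotProduct]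
  refine Orth.sum (fun i _ => (hY i).switch_mul hF hc fun k => A k j i) fun i _ => ?_
  exact memLp_switch (f := fun k ω => A k j i * Y ω i) (hc.comp hF) fun k => (hYL i).const_mul _

/-- Pythagoras for quadratic forms with random, `F`-measurable weights. -/
lemma integral_qf_add [Fintype ι] [Fintype κ] [MeasurableSpace κ] [MeasurableSingletonClass κ]
    {F : Ω → α} (hF : Measurable F) {c : α → κ} (hc : Measurable c) (A : κ → Matrix ι ι ℝ)
    {x : α → ι → ℝ} (hx : Measurable x) (hxL : SqInt (fun ω => x (F ω)) P)
    {Y : Ω → ι → ℝ} (hYL : SqInt Y P) (hY : ∀ i, Orth F (fun ω => Y ω i) P) :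
    ∫ ω, qf (A (c (F ω))) (x (F ω) + Y ω) ∂P =
      ∫ ω, qf (A (c (F ω))) (x (F ω)) ∂P + ∫ ω, qf (A (c (F ω))) (Y ω) ∂P := by
  have hcF := hc.comp hF
  have hxi : ∀ i, Measurable fun a => x a i := fun i => (measurable_pi_apply i).comp hx
  have hA : ∀ i j, Measurable fun a => A (c a) i j := fun i j =>
    (measurable_of_finite fun k => A k i j).comp hc
  have hAx : ∀ i j k, MemLp (fun ω => x (F ω) k * A (c (F ω)) i j) 2 P := fun i j k =>
    memLp_switch (f := fun m ω => x (F ω) k * A m i j) hcF fun m => (hxL k).mul_const _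
  -- Component of `x` times matrix entry is a square integrable function of `F`, hence an admissible
  -- test function. Without symmetry of `A` the two families of cross terms must vanish separately.
  have h1 : ∀ i j, ∫ ω, x (F ω) i * A (c (F ω)) i j * Y ω j ∂P = 0 := fun i j =>
    hY j (fun a => x a i * A (c a) i j) ((hxi i).mul (hA i j)) (hAx i j i)
  have h2 : ∀ i j, ∫ ω, x (F ω) j * A (c (F ω)) i j * Y ω i ∂P = 0 := fun i j =>
    hY i (fun a => x a j * A (c a) i j) ((hxi j).mul (hA i j)) (hAx i j j)
  have hint1 : ∀ i j, Integrable (fun ω => x (F ω) i * A (c (F ω)) i j * Y ω j) P :=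
    fun i j => (hAx i j i).integrable_mul (hYL j)
  have hint2 : ∀ i j, Integrable (fun ω => x (F ω) j * A (c (F ω)) i j * Y ω i) P :=
    fun i j => (hAx i j j).integrable_mul (hYL i)
  have hint : ∀ i j, Integrable (fun ω => x (F ω) i * A (c (F ω)) i j * Y ω j +
      x (F ω) j * A (c (F ω)) i j * Y ω i) P := fun i j => (hint1 i j).add (hint2 i j)
  have hxq : Integrable (fun ω => qf (A (c (F ω))) (x (F ω))) P := integrable_qf_switch hcF A hxL
  have hYq : Integrable (fun ω => qf (A (c (F ω))) (Y ω)) P := integrable_qf_switch hcF A hYL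
  have hxYq : Integrable (fun ω => qf (A (c (F ω))) (x (F ω)) + qf (A (c (F ω))) (Y ω)) P :=
    hxq.add hYq
  have hcross : Integrable (fun ω => ∑ i, ∑ j, (x (F ω) i * A (c (F ω)) i j * Y ω j +
      x (F ω) j * A (c (F ω)) i j * Y ω i)) P :=
    integrable_finsetSum _ fun i _ => integrable_finsetSum _ fun j _ => hint i j
  have hzero : ∫ ω, ∑ i, ∑ j, (x (F ω) i * A (c (F ω)) i j * Y ω j +
      x (F ω) j * A (c (F ω)) i j * Y ω i) ∂P = 0 := by
    rw [integral_finsetSum _ fun i _ => integrable_finsetSum _ fun j _ => hint i j]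
    refine Finset.sum_eq_zero fun i _ => ?_
    rw [integral_finsetSum _ fun j _ => hint i j]
    refine Finset.sum_eq_zero fun j _ => ?_
    rw [integral_add (hint1 i j) (hint2 i j), h1, h2, add_zero]
  have hpt : ∀ ω, qf (A (c (F ω))) (x (F ω) + Y ω) = qf (A (c (F ω))) (x (F ω)) +
      qf (A (c (F ω))) (Y ω) + ∑ i, ∑ j, (x (F ω) i * A (c (F ω)) i j * Y ω j +
      x (F ω) j * A (c (F ω)) i j * Y ω i) := by
    intro ω
    simp only [qf_apply, Pi.add_apply, ← Finset.sum_add_distrib]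
    exact Finset.sum_congr rfl fun i _ => Finset.sum_congr rfl fun j _ => by ring
  simp only [hpt]
  rw [integral_add hxYq hcross, hzero, add_zero]
  exact integral_add hxq hYq

lemma integral_qf_add_const [Fintype ι] {F : Ω → α} (hF : Measurable F) (A : Matrix ι ι ℝ)
    {x : α → ι → ℝ} (hx : Measurable x) (hxL : SqInt (fun ω => x (F ω)) P)
    {Y : Ω → ι → ℝ} (hYL : SqInt Y P) (hY : ∀ i, Orth F (fun ω => Y ω i) P) :
    ∫ ω, qf A (x (F ω) + Y ω) ∂P = ∫ ω, qf A (x (F ω)) ∂P + ∫ ω, qf A (Y ω) ∂P :=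
  integral_qf_add hF (c := fun _ => ()) measurable_const (fun _ => A) hx hxL hYL hY

lemma orth_of_indepFun {F : Ω → α} {Y : Ω → ℝ} (h : IndepFun F Y P)
    (hY : MemLp Y 2 P) (hmean : ∫ ω, Y ω ∂P = 0) : Orth F Y P := by
  intro φ hφ hL
  have h1 : IndepFun (fun ω => φ (F ω)) Y P := h.comp hφ measurable_id
  rw [h1.integral_fun_mul_eq_mul_integral hL.1 hY.1, hmean, mul_zero]

variable [IsProbabilityMeasure P]

/-- Adjoining independent information does not change a conditional mean. -/
lemma Orth.prodMk_of_indepFun {F : Ω → α} {Y : Ω → ℝ} {N : Ω → β} (hF : Measurable F)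
    (hY : Measurable Y) (hN : Measurable N) (h : Orth F Y P) (hYL : MemLp Y 2 P)
    (hind : IndepFun (fun ω => (F ω, Y ω)) N P) : Orth (fun ω => (F ω, N ω)) Y P := by
  intro φ hφ hL
  have hFY : Measurable fun ω => (F ω, Y ω) := hF.prodMk hY
  have hlaw := hind.map_prod_eq_prod_map_map hFY.aemeasurable hN.aemeasurable
  have hmap : Measurable fun ω => ((F ω, Y ω), N ω) := hFY.prodMk hN
  let g : (α × ℝ) × β → ℝ := fun q => φ (q.1.1, q.2) * q.1.2
  have hg : Measurable g := by fun_prop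
  have hsq : Measurable fun q : (α × ℝ) × β => φ (q.1.1, q.2) := by fun_prop
  have : IsProbabilityMeasure (P.map fun ω => (F ω, Y ω)) :=
    Measure.isProbabilityMeasure_map hFY.aemeasurable
  have : IsProbabilityMeasure (P.map N) := Measure.isProbabilityMeasure_map hN.aemeasurable
  have hgint : Integrable g ((P.map fun ω => (F ω, Y ω)).prod (P.map N)) := by
    rw [← hlaw, integrable_map_measure hg.aestronglyMeasurable hmap.aemeasurable]
    exact hL.integrable_mul hYL
  -- After freezing `N = n`, the section `φ (·, n)` must itself be a square integrable test
  -- function; Fubini applied to the square gives this for almost every `n`.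
  have hsqint : Integrable (fun q : (α × ℝ) × β => φ (q.1.1, q.2) ^ 2)
      ((P.map fun ω => (F ω, Y ω)).prod (P.map N)) := by
    rw [← hlaw, integrable_map_measure (hsq.pow_const 2).aestronglyMeasurable hmap.aemeasurable]
    exact hL.integrable_sq
  have key : ∫ ω, φ (F ω, N ω) * Y ω ∂P =
      ∫ q, g q ∂((P.map fun ω => (F ω, Y ω)).prod (P.map N)) := by
    rw [← hlaw, integral_map hmap.aemeasurable hg.aestronglyMeasurable]
  rw [key, integral_prod_symm _ hgint]
  refine integral_eq_zero_of_ae ?_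
  filter_upwards [hsqint.prod_left_ae] with n hn
  have hφn : Measurable fun a => φ (a, n) := by fun_prop
  rw [integrable_map_measure (by
    exact ((hφn.comp measurable_fst).pow_const 2).aestronglyMeasurable) hFY.aemeasurable] at hn
  have := h (fun a => φ (a, n)) hφn
    ((memLp_two_iff_integrable_sq (hφn.comp hF).aestronglyMeasurable).2 hn)
  simp only [g, Pi.zero_apply]
  rw [integral_map hFY.aemeasurable (by fun_prop)]
  exact this

/-- Averaging over an independent random variable with finitely many values. -/
lemma integral_of_indepFun_finite [Fintype κ] [MeasurableSpace κ] [MeasurableSingletonClass κ]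
    {M : Ω → κ} {V : Ω → α} (hM : Measurable M) (hV : Measurable V) (h : IndepFun M V P)
    {f : κ → α → ℝ} (hf : ∀ k, Measurable (f k))
    (hint : Integrable (fun ω => f (M ω) (V ω)) P) :
    ∫ ω, f (M ω) (V ω) ∂P = ∑ k, (P.map M).real {k} * ∫ ω, f k (V ω) ∂P := by
  have hlaw := h.map_prod_eq_prod_map_map hM.aemeasurable hV.aemeasurable
  have hmap : Measurable fun ω => (M ω, V ω) := hM.prodMk hV
  have hg : Measurable fun q : κ × α => f q.1 q.2 :=
    measurable_from_prod_countable_right fun k => hf k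
  have : IsProbabilityMeasure (P.map V) := Measure.isProbabilityMeasure_map hV.aemeasurable
  have : IsProbabilityMeasure (P.map M) := Measure.isProbabilityMeasure_map hM.aemeasurable
  have hgint : Integrable (fun q : κ × α => f q.1 q.2) ((P.map M).prod (P.map V)) := by
    rw [← hlaw, integrable_map_measure hg.aestronglyMeasurable hmap.aemeasurable]
    exact hint
  have key : ∫ ω, f (M ω) (V ω) ∂P = ∫ q, f q.1 q.2 ∂((P.map M).prod (P.map V)) := by
    rw [← hlaw, integral_map hmap.aemeasurable hg.aestronglyMeasurable]
  rw [key, integral_prod _ hgint, integral_fintype .of_finite]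
  refine Finset.sum_congr rfl fun k _ => ?_
  rw [smul_eq_mul, integral_map hV.aemeasurable (hf k).aestronglyMeasurable]

/-- By Fubini almost every section is integrable, and an atom of positive mass cannot lie in the
exceptional null set. -/
lemma integrable_of_indepFun_finite [Fintype κ] [MeasurableSpace κ] [MeasurableSingletonClass κ]
    {M : Ω → κ} {V : Ω → α} (hM : Measurable M) (hV : Measurable V) (h : IndepFun M V P)
    {f : κ → α → ℝ} (hf : ∀ k, Measurable (f k))
    (hint : Integrable (fun ω => f (M ω) (V ω)) P) (k : κ) (hk : 0 < (P.map M).real {k}) :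
    Integrable (fun ω => f k (V ω)) P := by
  have hlaw := h.map_prod_eq_prod_map_map hM.aemeasurable hV.aemeasurable
  have hmap : Measurable fun ω => (M ω, V ω) := hM.prodMk hV
  have hg : Measurable fun q : κ × α => f q.1 q.2 :=
    measurable_from_prod_countable_right fun k => hf k
  have : IsProbabilityMeasure (P.map V) := Measure.isProbabilityMeasure_map hV.aemeasurable
  have : IsProbabilityMeasure (P.map M) := Measure.isProbabilityMeasure_map hM.aemeasurable
  have hgint : Integrable (fun q : κ × α => f q.1 q.2) ((P.map M).prod (P.map V)) := by
    rw [← hlaw, integrable_map_measure hg.aestronglyMeasurable hmap.aemeasurable]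
    exact hint
  have hae := hgint.prod_right_ae
  have hk' : Integrable (f k) (P.map V) := by
    by_contra hcon
    have hle : (P.map M) {k} ≤ 0 := by
      refine le_of_le_of_eq (measure_mono ?_) (ae_iff.1 hae)
      simpa using hcon
    rw [Measure.real, nonpos_iff_eq_zero.1 hle] at hk
    simp at hk
  exact (integrable_map_measure (hf k).aestronglyMeasurable hV.aemeasurable).1 hk'

/-- Every square integrable random vector has a conditional mean given `F`. -/
lemma exists_condMean [Finite ι] {F : Ω → α} (hF : Measurable F) {Y : Ω → ι → ℝ}
    (hY : SqInt Y P) : ∃ b : α → ι → ℝ, Measurable b ∧ SqInt (fun ω => b (F ω)) P ∧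
      ∀ i, Orth F (fun ω => Y ω i - b (F ω) i) P := by
  -- The conditional expectation given the σ-algebra of `F` factors through `F`; orthogonality is
  -- then the pull-out property followed by integration.
  have hm : MeasurableSpace.comap F inferInstance ≤ ‹MeasurableSpace Ω› := hF.comap_le
  have h : ∀ i, ∃ b : α → ℝ, Measurable b ∧
      P[fun ω => Y ω i | MeasurableSpace.comap F inferInstance] = b ∘ F := fun i => by
    obtain ⟨b, hb, hbe⟩ := (stronglyMeasurable_condExp (μ := P) (f := fun ω => Y ω i)
      (m := MeasurableSpace.comap F inferInstance)).exists_eq_measurable_comp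
    exact ⟨b, hb.measurable, hbe⟩
  choose b hb hbe using h
  have hbL : ∀ i, MemLp (fun ω => b i (F ω)) 2 P := fun i => by
    have := (hY i).condExp (m := MeasurableSpace.comap F inferInstance) one_le_two
    rw [hbe i] at this
    exact this
  refine ⟨fun a i => b i a, measurable_pi_lambda _ hb, hbL, fun i φ hφ hL => ?_⟩
  have hφm : StronglyMeasurable[MeasurableSpace.comap F inferInstance] fun ω => φ (F ω) :=
    (hφ.comp (comap_measurable F)).stronglyMeasurable
  have h1 := condExp_mul_of_stronglyMeasurable_left hφm (hL.integrable_mul (hY i))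
    ((hY i).integrable one_le_two)
  have h2 := integral_congr_ae h1
  rw [integral_condExp hm, hbe i] at h2
  simp only [mul_sub]
  rw [integral_sub (integrable_mul_of_memLp hL (hY i)) (integrable_mul_of_memLp hL (hbL i)),
    sub_eq_zero]
  exact h2

/-- Indicators of events `F ∈ B` are admissible test functions, so orthogonality contains the
set-integral characterization of the conditional expectation. -/
lemma condExp_eq_of_orth [Fintype ι] {F : Ω → α} (hF : Measurable F) {Y : Ω → ι → ℝ}
    (hY : SqInt Y P) {a : α → ι → ℝ} (ha : Measurable a) (haL : SqInt (fun ω => a (F ω)) P)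
    (h : ∀ i, Orth F (fun ω => Y ω i - a (F ω) i) P) :
    P[Y | MeasurableSpace.comap F inferInstance] =ᵐ[P] fun ω => a (F ω) := by
  have hYi : Integrable Y P := hY.memLp.integrable one_le_two
  have hai : Integrable (fun ω => a (F ω)) P := haL.memLp.integrable one_le_two
  refine (ae_eq_condExp_of_forall_setIntegral_eq hF.comap_le hYi
    (fun s _ _ => hai.integrableOn) ?_ ?_).symm
  · rintro s ⟨B, hB, rfl⟩ -
    ext i
    rw [eval_integral fun i => (hai.eval i).integrableOn,
      eval_integral fun i => (hYi.eval i).integrableOn]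
    have h0 := h i (B.indicator 1) (measurable_one.indicator hB)
      ((memLp_const (1 : ℝ)).indicator (hF hB))
    have hpt : ∀ ω, B.indicator 1 (F ω) * (Y ω i - a (F ω) i) =
        (F ⁻¹' B).indicator (fun ω => Y ω i - a (F ω) i) ω := by
      intro ω
      by_cases hω : F ω ∈ B <;> simp [hω]
    simp only [hpt] at h0
    rw [integral_indicator (hF hB), integral_sub (hYi.eval i).integrableOn
      (hai.eval i).integrableOn, sub_eq_zero] at h0
    exact h0.symm
  · exact (ha.comp (comap_measurable F)).stronglyMeasurable.aestronglyMeasurable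

end Probability

/-! ### Histories and measurability -/

/-- Lets a channel symbol, a mode or `∅`, serve as the finite index in the `switch` lemmas. -/
instance {α β : Type*} [MeasurableSpace α] [MeasurableSpace β] [MeasurableSingletonClass α]
    [MeasurableSingletonClass β] : MeasurableSingletonClass (α ⊕ β) where
  measurableSet_singleton
    | Sum.inl a => by
      rw [← Set.image_singleton, measurableSet_inl_image]; exact measurableSet_singleton a
    | Sum.inr b => by
      rw [← Set.image_singleton, measurableSet_inr_image]; exact measurableSet_singleton b

namespace Dims

variable {d : Dims}

/-- The history with the current channel outputs replaced by `∅`. -/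
def Hist.erase {t : ℕ} (h : d.Hist t) : d.Hist t :=
  (h.1, h.2.1, Function.update h.2.2.1 (Fin.last t) (Sum.inr ()),
    Function.update h.2.2.2.1 (Fin.last t) (Sum.inr ()), h.2.2.2.2)

section Projections

variable {t : ℕ} (h : d.Hist t) (u : d.U0) (x : d.X0) (m : d.M0) (z : Received d.X1)
  (zt : Received d.M1)

@[simp] lemma Hist.x0_erase : h.erase.x0 = h.x0 := rfl
@[simp] lemma Hist.m0_erase : h.erase.m0 = h.m0 := rfl
@[simp] lemma Hist.z_erase : h.erase.z = Sum.inr () := by simp [Hist.erase, Hist.z]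

/-- This links the information before and after a transmission: on a drop the channel adds nothing,
so statements about the erased history transfer to the history. -/
lemma Hist.erase_eq_self (hz : h.z = Sum.inr ()) (hzt : h.zt = Sum.inr ()) : h.erase = h := by
  unfold Hist.erase
  rw [← hz, ← hzt, Hist.z, Hist.zt, Function.update_eq_self, Function.update_eq_self]

@[simp] lemma Hist.past_erase (h : d.Hist (t + 1)) : h.erase.past = h.past := by
  simp [Hist.erase, Hist.past]

@[simp] lemma Hist.x0_extend : (h.extend u x m z zt).x0 = x := by simp [Hist.extend, Hist.x0]
@[simp] lemma Hist.m0_extend : (h.extend u x m z zt).m0 = m := by simp [Hist.extend, Hist.m0]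
@[simp] lemma Hist.z_extend : (h.extend u x m z zt).z = z := by simp [Hist.extend, Hist.z]
@[simp] lemma Hist.zt_extend : (h.extend u x m z zt).zt = zt := by simp [Hist.extend, Hist.zt]
@[simp] lemma Hist.past_extend : (h.extend u x m z zt).past = h := by
  simp [Hist.extend, Hist.past]
@[simp] lemma Hist.erase_extend :
    (h.extend u x m z zt).erase = h.extend u x m (Sum.inr ()) (Sum.inr ()) := by
  simp [Hist.extend, Hist.erase, Fin.update_snoc_last]

@[simp] lemma Hist.erase_start :
    (Hist.start x m z zt).erase = Hist.start x m (Sum.inr ()) (Sum.inr ()) := by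
  have h : ∀ {α : Type} (a b : α), Function.update (fun _ : Fin (0 + 1) => a) (Fin.last 0) b =
      fun _ => b := fun a b => by ext i; fin_cases i; simp
  simp only [Hist.start, Hist.erase, h]

end Projections

section Measurability

variable {t : ℕ} {Ω : Type*} [MeasurableSpace Ω]

lemma Hist.measurable_x0 : Measurable (Hist.x0 : d.Hist t → d.X0) := by
  unfold Hist.x0; fun_prop
lemma Hist.measurable_m0 : Measurable (Hist.m0 : d.Hist t → d.M0) := by
  unfold Hist.m0; fun_prop
lemma Hist.measurable_z : Measurable (Hist.z : d.Hist t → Received d.X1) := by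
  unfold Hist.z; fun_prop
lemma Hist.measurable_zt : Measurable (Hist.zt : d.Hist t → Received d.M1) := by
  unfold Hist.zt; fun_prop
lemma Hist.measurable_past : Measurable (Hist.past : d.Hist (t + 1) → d.Hist t) := by
  unfold Hist.past; fun_prop

lemma measurable_fin_snoc {α : Type*} [MeasurableSpace α] {f : Ω → Fin t → α} {g : Ω → α}
    (hf : Measurable f) (hg : Measurable g) :
    Measurable fun ω => (Fin.snoc (α := fun _ => α) (f ω) (g ω) : Fin (t + 1) → α) := by
  refine measurable_pi_iff.2 fun i => ?_
  refine Fin.lastCases ?_ (fun j => ?_) i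
  · simpa using hg
  · simpa using measurable_pi_iff.1 hf j

lemma Hist.measurable_extend {h : Ω → d.Hist t} {u : Ω → d.U0} {x : Ω → d.X0} {m : Ω → d.M0}
    {z : Ω → Received d.X1} {zt : Ω → Received d.M1} (hh : Measurable h) (hu : Measurable u)
    (hx : Measurable x) (hm : Measurable m) (hz : Measurable z) (hzt : Measurable zt) :
    Measurable fun ω => (h ω).extend (u ω) (x ω) (m ω) (z ω) (zt ω) := by
  unfold Hist.extend
  exact (measurable_fin_snoc (by fun_prop) hx).prodMk <|
    (measurable_fin_snoc (by fun_prop) hm).prodMk <|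
    (measurable_fin_snoc (by fun_prop) hz).prodMk <|
    (measurable_fin_snoc (by fun_prop) hzt).prodMk <| measurable_fin_snoc (by fun_prop) hu

lemma Hist.measurable_start {x : Ω → d.X0} {m : Ω → d.M0}
    {z : Ω → Received d.X1} {zt : Ω → Received d.M1}
    (hx : Measurable x) (hm : Measurable m) (hz : Measurable z) (hzt : Measurable zt) :
    Measurable fun ω => Hist.start (x ω) (m ω) (z ω) (zt ω) := by
  unfold Hist.start
  fun_prop

lemma Hist.measurable_erase : Measurable (Hist.erase : d.Hist t → d.Hist t) := by
  have h : ∀ {α : Type} [MeasurableSpace α] (a : α),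
      Measurable fun f : Fin (t + 1) → α => Function.update f (Fin.last t) a :=
    fun a => measurable_update_left
  unfold Hist.erase
  exact measurable_fst.prodMk <| (by fun_prop : Measurable fun h : d.Hist t => h.2.1).prodMk <|
    ((h _).comp (by fun_prop)).prodMk <| ((h _).comp (by fun_prop)).prodMk (by fun_prop)

end Measurability

end Dims

lemma measurable_switch_mulVec {Ω ι κ γ : Type*} [MeasurableSpace Ω] [Fintype ι] [Fintype κ]
    [MeasurableSpace κ] [MeasurableSingletonClass κ] {c : Ω → κ} (hc : Measurable c)
    (A : κ → Matrix γ ι ℝ) {x : Ω → ι → ℝ} (hx : Measurable x) :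
    Measurable fun ω => A (c ω) *ᵥ x ω := by
  refine measurable_pi_iff.2 fun i => ?_
  simp only [Matrix.mulVec, dotProduct]
  exact Finset.measurable_sum _ fun j _ =>
    ((measurable_of_finite fun k => A k i j).comp hc).mul ((measurable_pi_apply j).comp hx)

lemma measurable_sum_elim {Ω ι κ : Type*} [MeasurableSpace Ω] {x : Ω → ι → ℝ} {y : Ω → κ → ℝ}
    (hx : Measurable x) (hy : Measurable y) : Measurable fun ω => Sum.elim (x ω) (y ω) := by
  refine measurable_pi_iff.2 fun i => ?_
  rcases i with i | i
  · exact (measurable_pi_apply i).comp hx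
  · exact (measurable_pi_apply i).comp hy

namespace System

variable {d : Dims} (S : System d)

lemma measurable_vec {Ω : Type*} [MeasurableSpace Ω] {x0 : Ω → d.X0} {x1 : Ω → d.X1}
    {u0 : Ω → d.U0} {u1 : Ω → d.U1} (h0 : Measurable x0) (h1 : Measurable x1)
    (h2 : Measurable u0) (h3 : Measurable u1) :
    Measurable fun ω => vec (x0 ω) (x1 ω) (u0 ω) (u1 ω) :=
  measurable_sum_elim (measurable_sum_elim h0 h1) (measurable_sum_elim h2 h3)

lemma measurable_channel {Ω : Type*} [MeasurableSpace Ω] {α : Type} [MeasurableSpace α]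
    {b : Ω → Bool} {a : Ω → α} (hb : Measurable b) (ha : Measurable a) :
    Measurable fun ω => channel (b ω) (a ω) := by
  unfold channel
  exact Measurable.ite (hb (measurableSet_singleton true)) (measurable_inl.comp ha)
    measurable_const

/-! ### The closed loop and its measurability. -/

section ClosedLoop

variable {Ω : Type*} (ξ : Primitives d Ω) (l0 : Strategy0 d) (l1 : Strategy1 d)

lemma D_mulVec_vec (m0 : d.M0) (m1 : d.M1) (x0 : d.X0) (x1 : d.X1) (u0 : d.U0) (u1 : d.U1) :
    S.D m0 m1 *ᵥ vec x0 x1 u0 u1 =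
      S.A m0 m1 *ᵥ Sum.elim x0 x1 + S.B m0 m1 *ᵥ Sum.elim u0 u1 := by
  simp only [D, vec, Matrix.fromCols_mulVec_sumElim]

lemma hist_zero (ω : Ω) : S.hist ξ l0 l1 0 ω = Hist.start (ξ.x0 ω) (ξ.m0 0 ω)
    (channel (ξ.γ 0 ω) (ξ.x1 ω)) (channel (ξ.γ 0 ω) (ξ.m1 0 ω)) := rfl

lemma hist_m0 (t : ℕ) (ω : Ω) : (S.hist ξ l0 l1 t ω).m0 = ξ.m0 t ω := by
  cases t with
  | zero => rfl
  | succ t => exact Hist.m0_extend ..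

lemma hist_zt (t : ℕ) (ω : Ω) :
    (S.hist ξ l0 l1 t ω).zt = channel (ξ.γ t ω) (ξ.m1 t ω) := by
  cases t with
  | zero => rfl
  | succ t => exact Hist.zt_extend ..

lemma hist_z (t : ℕ) (ω : Ω) :
    (S.hist ξ l0 l1 t ω).z = channel (ξ.γ t ω) (S.state1 ξ l0 l1 t ω) := by
  cases t with
  | zero => rfl
  | succ t => exact Hist.z_extend ..

/-- `D(M⁰_t, M¹_t) vec(X_t, U_t)`. -/
def drift (t : ℕ) (ω : Ω) : d.IX → ℝ :=
  S.D (ξ.m0 t ω) (ξ.m1 t ω) *ᵥ vec (S.state0 ξ l0 l1 t ω) (S.state1 ξ l0 l1 t ω)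
    (S.action0 ξ l0 l1 t ω) (S.action1 ξ l0 l1 t ω)

lemma state1_succ (t : ℕ) (ω : Ω) : S.state1 ξ l0 l1 (t + 1) ω =
    S.drift ξ l0 l1 t ω ∘ Sum.inr + ξ.w1 t ω := by
  ext i
  rw [drift, D_mulVec_vec, ← hist_m0 S ξ l0 l1]
  rfl

lemma state0_succ (t : ℕ) (ω : Ω) : S.state0 ξ l0 l1 (t + 1) ω =
    S.drift ξ l0 l1 t ω ∘ Sum.inl + ξ.w0 t ω := by
  have h : S.state0 ξ l0 l1 (t + 1) ω = _ := Hist.x0_extend ..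
  rw [h]
  ext i
  rw [drift, D_mulVec_vec, ← hist_m0 S ξ l0 l1]
  rfl

lemma hist_succ (t : ℕ) (ω : Ω) : S.hist ξ l0 l1 (t + 1) ω =
    (S.hist ξ l0 l1 t ω).extend (S.action0 ξ l0 l1 t ω) (S.state0 ξ l0 l1 (t + 1) ω)
      (ξ.m0 (t + 1) ω) (channel (ξ.γ (t + 1) ω) (S.state1 ξ l0 l1 (t + 1) ω))
      (channel (ξ.γ (t + 1) ω) (ξ.m1 (t + 1) ω)) := by
  have h : S.state0 ξ l0 l1 (t + 1) ω = _ := Hist.x0_extend ..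
  rw [h]
  rfl

section Measurability

/-- The sources of randomness before time `t` and the strategies before time `t` are measurable. -/
structure MeasBefore [MeasurableSpace Ω] (t : ℕ) : Prop where
  x0 : Measurable ξ.x0
  x1 : Measurable ξ.x1
  w0 : ∀ s < t, Measurable (ξ.w0 s)
  w1 : ∀ s < t, Measurable (ξ.w1 s)
  m0 : ∀ s < t, Measurable (ξ.m0 s)
  m1 : ∀ s < t, Measurable (ξ.m1 s)
  γ : ∀ s < t, Measurable (ξ.γ s)
  l0 : ∀ s < t, Measurable (l0 s)
  l1 : ∀ s < t, Measurable (l1 s)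

variable {ξ l0 l1} {t : ℕ} {mΩ : MeasurableSpace Ω}

lemma MeasBefore.mono {s : ℕ} (h : MeasBefore ξ l0 l1 t) (hs : s ≤ t) : MeasBefore ξ l0 l1 s :=
  ⟨h.x0, h.x1, fun r hr => h.w0 r (hr.trans_le hs), fun r hr => h.w1 r (hr.trans_le hs),
    fun r hr => h.m0 r (hr.trans_le hs), fun r hr => h.m1 r (hr.trans_le hs),
    fun r hr => h.γ r (hr.trans_le hs), fun r hr => h.l0 r (hr.trans_le hs),
    fun r hr => h.l1 r (hr.trans_le hs)⟩

/-- Histories and states are built from each other, so the states are assumed measurable here and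
supplied by the induction in `measurable_state`. The σ-algebra on `Ω` is a variable, so that these
lemmas also apply to the σ-algebra generated by a subset of the sources. -/
lemma measurable_hist_of_state (h : MeasBefore ξ l0 l1 t)
    (hstate : ∀ s ≤ t, Measurable (S.state0 ξ l0 l1 s) ∧ Measurable (S.state1 ξ l0 l1 s))
    (hm0 : Measurable (ξ.m0 t)) (hm1 : Measurable (ξ.m1 t)) (hγ : Measurable (ξ.γ t)) :
    Measurable (S.hist ξ l0 l1 t) := by
  induction t with
  | zero =>
    exact Hist.measurable_start h.x0 hm0 (measurable_channel hγ h.x1) (measurable_channel hγ hm1)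
  | succ t ih =>
    have hlt := Nat.lt_succ_self t
    have hh : Measurable (S.hist ξ l0 l1 t) := ih (h.mono hlt.le)
      (fun s hs => hstate s (hs.trans hlt.le)) (h.m0 t hlt) (h.m1 t hlt) (h.γ t hlt)
    have h2 := hstate (t + 1) le_rfl
    have := Hist.measurable_extend hh ((h.l0 t hlt).comp hh) h2.1 hm0
      (measurable_channel hγ h2.2) (measurable_channel hγ hm1)
    exact (funext fun ω => hist_succ S ξ l0 l1 t ω : S.hist ξ l0 l1 (t + 1) = _) ▸ this

lemma measurable_state (h : MeasBefore ξ l0 l1 t) :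
    Measurable (S.state0 ξ l0 l1 t) ∧ Measurable (S.state1 ξ l0 l1 t) := by
  induction t using Nat.strong_induction_on with
  | _ t ih =>
    cases t with
    | zero => exact ⟨h.x0, h.x1⟩
    | succ t =>
      have hlt := Nat.lt_succ_self t
      have hst : ∀ s ≤ t, Measurable (S.state0 ξ l0 l1 s) ∧ Measurable (S.state1 ξ l0 l1 s) :=
        fun s hs => ih s (Nat.lt_succ_of_le hs) (h.mono (hs.trans hlt.le))
      have hh : Measurable (S.hist ξ l0 l1 t) := S.measurable_hist_of_state (h.mono hlt.le) hst
        (h.m0 t hlt) (h.m1 t hlt) (h.γ t hlt)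
      have hm : Measurable fun ω => (ξ.m0 t ω, ξ.m1 t ω) := (h.m0 t hlt).prodMk (h.m1 t hlt)
      have hdrift : Measurable (S.drift ξ l0 l1 t) :=
        measurable_switch_mulVec hm (fun k => S.D k.1 k.2) <| measurable_vec (hst t le_rfl).1
          (hst t le_rfl).2 ((h.l0 t hlt).comp hh)
          ((h.l1 t hlt).comp (hh.prodMk ((hst t le_rfl).2.prodMk (h.m1 t hlt))))
      have hc : ∀ {κ : Type} (g : κ → d.IX), Measurable fun ω => S.drift ξ l0 l1 t ω ∘ g :=
        fun g => measurable_pi_iff.2 fun i => (measurable_pi_apply (g i)).comp hdrift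
      refine ⟨?_, ?_⟩
      · rw [funext fun ω => state0_succ S ξ l0 l1 t ω]
        exact (hc Sum.inl).add (h.w0 t hlt)
      · rw [funext fun ω => state1_succ S ξ l0 l1 t ω]
        exact (hc Sum.inr).add (h.w1 t hlt)

lemma measurable_hist (h : MeasBefore ξ l0 l1 t)
    (hm0 : Measurable (ξ.m0 t)) (hm1 : Measurable (ξ.m1 t)) (hγ : Measurable (ξ.γ t)) :
    Measurable (S.hist ξ l0 l1 t) :=
  S.measurable_hist_of_state h (fun _ hs => S.measurable_state (h.mono hs)) hm0 hm1 hγ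

lemma measurable_hist_of_lt {s : ℕ} (h : MeasBefore ξ l0 l1 t) (hs : s < t) :
    Measurable (S.hist ξ l0 l1 s) :=
  S.measurable_hist (h.mono hs.le) (h.m0 s hs) (h.m1 s hs) (h.γ s hs)

/-- Unlike the history, its erasure does not involve the current local mode or link state; this is
what makes it independent of them. -/
lemma measurable_erase_hist (h : MeasBefore ξ l0 l1 t) (hm0 : Measurable (ξ.m0 t)) :
    Measurable fun ω => (S.hist ξ l0 l1 t ω).erase := by
  cases t with
  | zero =>
    simp only [hist_zero, Hist.erase_start]
    exact Hist.measurable_start h.x0 hm0 measurable_const measurable_const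
  | succ t =>
    have hlt := Nat.lt_succ_self t
    have hh := S.measurable_hist (h.mono hlt.le) (h.m0 t hlt) (h.m1 t hlt) (h.γ t hlt)
    simp only [hist_succ, Hist.erase_extend]
    exact Hist.measurable_extend hh ((h.l0 t hlt).comp hh) (S.measurable_state h).1 hm0
      measurable_const measurable_const

end Measurability

end ClosedLoop

/-! ### Independence of the sources of randomness -/

/-- The σ-algebra generated by a set of primitive random variables. -/
abbrev sig {Ω : Type*} (ξ : Primitives d Ω) {T : ℕ} (s : Set (Src T)) : MeasurableSpace Ω :=
  ⨆ i ∈ s, MeasurableSpace.comap (ξ.family i) (Src.instMeasurableSpace d i)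

lemma measurable_sig {Ω : Type*} (ξ : Primitives d Ω) {T : ℕ} {s : Set (Src T)} {i : Src T}
    (hi : i ∈ s) : Measurable[sig ξ s] (ξ.family i) :=
  Measurable.of_comap_le (le_iSup₂_of_le i hi le_rfl)

/-- The primitive random variables that determine the states at time `t`. -/
def before (T t : ℕ) : Set (Src T) := {i | match i with
  | .x0 => True
  | .x1 => True
  | .w0 s => s < t
  | .w1 s => s < t
  | .m0 s => s < t
  | .m1 s => s < t
  | .γ s => s < t}

/-- Run in the σ-algebra of a group of sources, the measurability lemmas show which sources a state
or history depends on; disjoint groups then give independence through `Realizes.indepFun`. -/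
lemma measBefore_sig {Ω : Type*} {ξ : Primitives d Ω} {l0 : Strategy0 d} {l1 : Strategy1 d}
    {T t : ℕ} (ht : t ≤ T + 1) {s : Set (Src T)} (hs : before T t ⊆ s)
    (h0 : ∀ r < t, Measurable (l0 r)) (h1 : ∀ r < t, Measurable (l1 r)) :
    @MeasBefore d Ω ξ l0 l1 (sig ξ s) t := by
  have hF : ∀ r < t, r < T + 1 := fun r hr => hr.trans_le ht
  exact @MeasBefore.mk d Ω ξ l0 l1 (sig ξ s) t
    (measurable_sig ξ (i := .x0) (hs trivial)) (measurable_sig ξ (i := .x1) (hs trivial))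
    (fun r hr => measurable_sig ξ (i := .w0 ⟨r, hF r hr⟩) (hs hr))
    (fun r hr => measurable_sig ξ (i := .w1 ⟨r, hF r hr⟩) (hs hr))
    (fun r hr => measurable_sig ξ (i := .m0 ⟨r, hF r hr⟩) (hs hr))
    (fun r hr => measurable_sig ξ (i := .m1 ⟨r, hF r hr⟩) (hs hr))
    (fun r hr => measurable_sig ξ (i := .γ ⟨r, hF r hr⟩) (hs hr)) h0 h1

section Realization

variable {S} {Ω : Type*} [MeasurableSpace Ω] {P : Measure Ω} {T : ℕ} {ξ : Primitives d Ω}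
  {l0 : Strategy0 d} {l1 : Strategy1 d}

lemma Realizes.indepFun (hξ : S.Realizes P T ξ) {s s' : Set (Src T)} (hs : Disjoint s s')
    {α β : Type*} [MeasurableSpace α] [MeasurableSpace β] {f : Ω → α} {g : Ω → β}
    (hf : Measurable[sig ξ s] f) (hg : Measurable[sig ξ s'] g) : IndepFun f g P := by
  have h : Indep (sig ξ s) (sig ξ s') P := indep_iSup_of_disjoint
    (fun i => (hξ.measurable i).comap_le) hξ.indep hs
  exact indep_of_indep_of_le_left (indep_of_indep_of_le_right h hg.comap_le) hf.comap_le

lemma Realizes.measurable_w0 (hξ : S.Realizes P T ξ) {t : ℕ} (ht : t ≤ T) :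
    Measurable (ξ.w0 t) := hξ.measurable (.w0 ⟨t, Nat.lt_succ_of_le ht⟩)
lemma Realizes.measurable_w1 (hξ : S.Realizes P T ξ) {t : ℕ} (ht : t ≤ T) :
    Measurable (ξ.w1 t) := hξ.measurable (.w1 ⟨t, Nat.lt_succ_of_le ht⟩)
lemma Realizes.measurable_m0 (hξ : S.Realizes P T ξ) {t : ℕ} (ht : t ≤ T) :
    Measurable (ξ.m0 t) := hξ.measurable (.m0 ⟨t, Nat.lt_succ_of_le ht⟩)
lemma Realizes.measurable_m1 (hξ : S.Realizes P T ξ) {t : ℕ} (ht : t ≤ T) :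
    Measurable (ξ.m1 t) := hξ.measurable (.m1 ⟨t, Nat.lt_succ_of_le ht⟩)
lemma Realizes.measurable_γ (hξ : S.Realizes P T ξ) {t : ℕ} (ht : t ≤ T) :
    Measurable (ξ.γ t) := hξ.measurable (.γ ⟨t, Nat.lt_succ_of_le ht⟩)

lemma Realizes.measBefore (hξ : S.Realizes P T ξ) {t : ℕ} (ht : t ≤ T + 1)
    (h0 : ∀ r < t, Measurable (l0 r)) (h1 : ∀ r < t, Measurable (l1 r)) :
    MeasBefore ξ l0 l1 t := by
  have hF : ∀ r < t, r ≤ T := fun r hr => Nat.lt_succ_iff.1 (hr.trans_le ht)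
  exact ⟨hξ.measurable .x0, hξ.measurable .x1, fun r hr => hξ.measurable_w0 (hF r hr),
    fun r hr => hξ.measurable_w1 (hF r hr), fun r hr => hξ.measurable_m0 (hF r hr),
    fun r hr => hξ.measurable_m1 (hF r hr), fun r hr => hξ.measurable_γ (hF r hr), h0, h1⟩

/-- The local mode is independent of the other data of its time. -/
lemma Realizes.indepFun_m1 (hξ : S.Realizes P T ξ) {t : ℕ} (ht : t ≤ T)
    (h0 : ∀ r < t, Measurable (l0 r)) (h1 : ∀ r < t, Measurable (l1 r)) :
    IndepFun (ξ.m1 t)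
      (fun ω => (((S.hist ξ l0 l1 t ω).erase, S.state1 ξ l0 l1 t ω), ξ.γ t ω)) P := by
  have ht' := Nat.lt_succ_of_le ht
  let s : Set (Src T) := before T t ∪ {.m0 ⟨t, ht'⟩, .γ ⟨t, ht'⟩}
  have hb : @MeasBefore d Ω ξ l0 l1 (sig ξ s) t :=
    measBefore_sig ht'.le Set.subset_union_left h0 h1
  refine hξ.indepFun (s := {.m1 ⟨t, ht'⟩}) (s' := s) ?_ (measurable_sig ξ (i := .m1 ⟨t, ht'⟩) rfl)
    ?_
  · rw [Set.disjoint_singleton_left]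
    simp [s, before]
  · exact ((S.measurable_erase_hist hb (measurable_sig ξ (i := .m0 ⟨t, ht'⟩) (by simp [s]))).prodMk
      (S.measurable_state hb).2).prodMk (measurable_sig ξ (i := .γ ⟨t, ht'⟩) (by simp [s]))

/-- The noises are independent of the data of their time. -/
lemma Realizes.indepFun_noise (hξ : S.Realizes P T ξ) {t : ℕ} (ht : t ≤ T)
    (h0 : ∀ r < t, Measurable (l0 r)) (h1 : ∀ r < t, Measurable (l1 r)) :
    IndepFun (fun ω => (S.hist ξ l0 l1 t ω, S.state1 ξ l0 l1 t ω, ξ.m1 t ω))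
      (fun ω => (ξ.w0 t ω, ξ.w1 t ω)) P := by
  have ht' := Nat.lt_succ_of_le ht
  let s : Set (Src T) := before T t ∪ {.m0 ⟨t, ht'⟩, .m1 ⟨t, ht'⟩, .γ ⟨t, ht'⟩}
  have hb : @MeasBefore d Ω ξ l0 l1 (sig ξ s) t :=
    measBefore_sig ht'.le Set.subset_union_left h0 h1
  refine hξ.indepFun (s := s) (s' := {.w0 ⟨t, ht'⟩, .w1 ⟨t, ht'⟩}) ?_ ?_
    ((measurable_sig ξ (i := .w0 ⟨t, ht'⟩) (by simp)).prodMk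
      (measurable_sig ξ (i := .w1 ⟨t, ht'⟩) (by simp)))
  · rw [Set.disjoint_right]
    rintro i (rfl | rfl) <;> simp [s, before]
  · have hm1 := measurable_sig ξ (s := s) (i := .m1 ⟨t, ht'⟩) (by simp [s])
    exact (S.measurable_hist hb (measurable_sig ξ (i := .m0 ⟨t, ht'⟩) (by simp [s])) hm1
      (measurable_sig ξ (i := .γ ⟨t, ht'⟩) (by simp [s]))).prodMk
      ((S.measurable_state hb).2.prodMk hm1)

/-- The sources of the new common information are independent of the data of the preceding time
and of the noise of the local plant. -/
lemma Realizes.indepFun_next (hξ : S.Realizes P T ξ) {t : ℕ} (ht : t + 1 ≤ T)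
    (h0 : ∀ r < t, Measurable (l0 r)) (h1 : ∀ r < t, Measurable (l1 r)) :
    IndepFun (fun ω => ((S.hist ξ l0 l1 t ω, S.state1 ξ l0 l1 t ω, ξ.m1 t ω), ξ.w1 t ω))
      (fun ω => (ξ.w0 t ω, ξ.m0 (t + 1) ω, ξ.m1 (t + 1) ω, ξ.γ (t + 1) ω)) P := by
  have ht2 := Nat.lt_succ_of_le ht
  have ht' : t < T + 1 := by omega
  let s : Set (Src T) := before T t ∪ {.m0 ⟨t, ht'⟩, .m1 ⟨t, ht'⟩, .γ ⟨t, ht'⟩, .w1 ⟨t, ht'⟩}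
  let s' : Set (Src T) :=
    {.w0 ⟨t, ht'⟩, .m0 ⟨t + 1, ht2⟩, .m1 ⟨t + 1, ht2⟩, .γ ⟨t + 1, ht2⟩}
  have hb : @MeasBefore d Ω ξ l0 l1 (sig ξ s) t :=
    measBefore_sig ht'.le Set.subset_union_left h0 h1
  refine hξ.indepFun (s := s) (s' := s') ?_ ?_ ?_
  · rw [Set.disjoint_right]
    rintro i (rfl | rfl | rfl | rfl) <;> simp [s, before]
  · have hm1 := measurable_sig ξ (s := s) (i := .m1 ⟨t, ht'⟩) (by simp [s])
    exact ((S.measurable_hist hb (measurable_sig ξ (i := .m0 ⟨t, ht'⟩) (by simp [s])) hm1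
      (measurable_sig ξ (i := .γ ⟨t, ht'⟩) (by simp [s]))).prodMk
      ((S.measurable_state hb).2.prodMk hm1)).prodMk
      (measurable_sig ξ (i := .w1 ⟨t, ht'⟩) (by simp [s]))
  · exact (measurable_sig ξ (i := .w0 ⟨t, ht'⟩) (by simp [s'])).prodMk <|
      (measurable_sig ξ (i := .m0 ⟨t + 1, ht2⟩) (by simp [s'])).prodMk <|
      (measurable_sig ξ (i := .m1 ⟨t + 1, ht2⟩) (by simp [s'])).prodMk <|
      measurable_sig ξ (i := .γ ⟨t + 1, ht2⟩) (by simp [s'])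

/-- The initial local state is independent of the other data of time `0`. -/
lemma Realizes.indepFun_x1 (hξ : S.Realizes P T ξ) :
    IndepFun (fun ω => (ξ.x0 ω, ξ.m0 0 ω, ξ.m1 0 ω, ξ.γ 0 ω)) ξ.x1 P := by
  let s : Set (Src T) := {.x0, .m0 0, .m1 0, .γ 0}
  refine hξ.indepFun (s := s) (s' := {.x1}) ?_ ?_ (measurable_sig ξ (i := .x1) rfl)
  · rw [Set.disjoint_singleton_right]
    simp [s]
  · exact (measurable_sig ξ (i := .x0) (by simp [s])).prodMk <|
      (measurable_sig ξ (i := .m0 0) (by simp [s])).prodMk <|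
      (measurable_sig ξ (i := .m1 0) (by simp [s])).prodMk <|
      measurable_sig ξ (i := .γ 0) (by simp [s])

/-- The modes and the link state are successively independent of everything before them. -/
lemma Realizes.indepFun_modes (hξ : S.Realizes P T ξ) {t : ℕ} (ht : t ≤ T) {α : Type*}
    [MeasurableSpace α] {V : Ω → α} (hV : Measurable[sig ξ (before T t)] V) :
    IndepFun (ξ.γ t) (fun ω => (ξ.m1 t ω, ξ.m0 t ω, V ω)) P ∧
      IndepFun (ξ.m1 t) (fun ω => (ξ.m0 t ω, V ω)) P ∧ IndepFun (ξ.m0 t) V P := by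
  have ht' := Nat.lt_succ_of_le ht
  have hmono : ∀ s : Set (Src T), before T t ⊆ s → Measurable[sig ξ s] V := fun s hs =>
    hV.mono (biSup_mono hs) le_rfl
  let s₁ : Set (Src T) := before T t ∪ {.m1 ⟨t, ht'⟩, .m0 ⟨t, ht'⟩}
  let s₂ : Set (Src T) := before T t ∪ {.m0 ⟨t, ht'⟩}
  refine ⟨?_, ?_, ?_⟩
  · refine hξ.indepFun (s := {.γ ⟨t, ht'⟩}) (s' := s₁) ?_
      (measurable_sig ξ (i := .γ ⟨t, ht'⟩) rfl) ?_
    · rw [Set.disjoint_singleton_left]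
      simp [s₁, before]
    · exact (measurable_sig ξ (i := .m1 ⟨t, ht'⟩) (by simp [s₁])).prodMk <|
        (measurable_sig ξ (i := .m0 ⟨t, ht'⟩) (by simp [s₁])).prodMk <|
        hmono s₁ Set.subset_union_left
  · refine hξ.indepFun (s := {.m1 ⟨t, ht'⟩}) (s' := s₂) ?_
      (measurable_sig ξ (i := .m1 ⟨t, ht'⟩) rfl) ?_
    · rw [Set.disjoint_singleton_left]
      simp [s₂, before]
    · exact (measurable_sig ξ (i := .m0 ⟨t, ht'⟩) (by simp [s₂])).prodMk <|
        hmono s₂ Set.subset_union_left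
  · refine hξ.indepFun (s := {.m0 ⟨t, ht'⟩}) ?_
      (measurable_sig ξ (i := .m0 ⟨t, ht'⟩) rfl) hV
    rw [Set.disjoint_singleton_left]
    simp [before]

end Realization

end System

lemma measurable_switch {Ω κ β : Type*} [MeasurableSpace Ω] [MeasurableSpace β] [Countable κ]
    [MeasurableSpace κ] [MeasurableSingletonClass κ] {c : Ω → κ} (hc : Measurable c)
    {f : κ → Ω → β} (hf : ∀ k, Measurable (f k)) : Measurable fun ω => f (c ω) ω :=
  (measurable_from_prod_countable_right (f := fun q : κ × Ω => f q.1 q.2) hf).comp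
    (hc.prodMk measurable_id)

/-- The value on a drop may vary with the sample point, so the function is cut along the event of
reception. The zero is a filler that is never taken there. -/
lemma measurable_received {Ω α β : Type*} [MeasurableSpace Ω] [MeasurableSpace α]
    [MeasurableSpace β] [Zero β] {z : Ω → α ⊕ Unit} (hz : Measurable z) {f : α → β}
    (hf : Measurable f) {g : Ω → β} (hg : Measurable g) :
    Measurable fun ω => Sum.elim f (fun _ => g ω) (z ω) := by
  classical
  have h : (fun ω => Sum.elim f (fun _ => g ω) (z ω)) =
      fun ω => if z ω ∈ Set.range Sum.inl then Sum.elim f (fun _ => 0) (z ω) else g ω := by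
    ext ω
    rcases z ω with a | u <;> simp
  rw [h]
  exact Measurable.ite (hz measurableSet_range_inl)
    ((hf.sumElim measurable_const).comp hz) hg

lemma measurable_comp_right {Ω ι κ : Type*} [MeasurableSpace Ω] {x : Ω → ι → ℝ}
    (hx : Measurable x) (g : κ → ι) : Measurable fun ω => x ω ∘ g :=
  measurable_pi_iff.2 fun i => measurable_pi_iff.1 hx (g i)

namespace System

variable {d : Dims} (S : System d)

/-! ### Averaging over the unobserved local mode -/

/-- The mean of `f(M¹)` given the channel output `zt`. -/
def avg {β : Type*} [AddCommMonoid β] [Module ℝ β] (zt : Received d.M1) (f : d.M1 → β) : β :=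
  match zt with
  | Sum.inr _ => ∑ m, S.π1 m • f m
  | Sum.inl l => f l

lemma measurable_avg {Ω : Type*} [MeasurableSpace Ω] {ι : Type*} {c : Ω → Received d.M1}
    (hc : Measurable c) {f : Ω → d.M1 → ι → ℝ} (hf : ∀ m, Measurable fun ω => f ω m) :
    Measurable fun ω => S.avg (c ω) (f ω) := by
  refine measurable_switch (f := fun k ω => S.avg k (f ω)) hc ?_
  rintro (l | u)
  · exact hf l
  · exact Finset.measurable_sum _ fun m _ => (hf m).const_smul (S.π1 m)

lemma measurable_avg_real {Ω : Type*} [MeasurableSpace Ω] {c : Ω → Received d.M1}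
    (hc : Measurable c) {f : Ω → d.M1 → ℝ} (hf : ∀ m, Measurable fun ω => f ω m) :
    Measurable fun ω => S.avg (c ω) (f ω) := by
  refine measurable_switch (f := fun k ω => S.avg k (f ω)) hc ?_
  rintro (l | u)
  · exact hf l
  · exact Finset.measurable_sum _ fun m _ => (hf m).const_smul (S.π1 m)

lemma avg_apply {ι : Type*} (zt : Received d.M1) (f : d.M1 → ι → ℝ) (i : ι) :
    S.avg zt f i = S.avg zt fun m => f m i := by
  rcases zt with l | u <;> simp [avg]

lemma avg_comp {ι κ : Type*} (zt : Received d.M1) (f : d.M1 → ι → ℝ) (g : κ → ι) :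
    S.avg zt f ∘ g = S.avg zt fun m => f m ∘ g := by
  ext i
  simp [avg_apply]

lemma avg_mul_left (zt : Received d.M1) (a : ℝ) (f : d.M1 → ℝ) :
    S.avg zt (fun m => a * f m) = a * S.avg zt f := by
  rcases zt with l | u
  · rfl
  · simp only [avg, Finset.mul_sum, smul_eq_mul]
    exact Finset.sum_congr rfl fun m _ => by ring

section Unit

variable {S}

lemma avg_const (hπ : ∑ m, S.π1 m = 1) {β : Type*} [AddCommGroup β] [Module ℝ β]
    (zt : Received d.M1) (a : β) : S.avg zt (fun _ => a) = a := by
  rcases zt with l | u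
  · rfl
  · simp [avg, ← Finset.sum_smul, hπ]

/-- Jensen's inequality for the square; it is what makes predictions square integrable in
`Realizes.memLp_avg`. -/
lemma avg_sq_le (hπ : ∑ m, S.π1 m = 1) (zt : Received d.M1) (f : d.M1 → ℝ) :
    S.avg zt f ^ 2 ≤ S.avg zt fun m => f m ^ 2 := by
  rcases zt with l | u
  · exact le_rfl
  · exact (even_two.convexOn_pow (𝕜 := ℝ)).map_sum_le (fun m _ => S.π1_nonneg m) hπ
      (fun m _ => Set.mem_univ _)

end Unit

section Realization

variable {S} {Ω : Type*} [MeasurableSpace Ω] {P : Measure Ω} [IsProbabilityMeasure P] {T : ℕ}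
  {ξ : Primitives d Ω} {l0 : Strategy0 d} {l1 : Strategy1 d}

lemma Realizes.sum_π1 (hξ : S.Realizes P T ξ) : ∑ m, S.π1 m = 1 := by
  have hm := hξ.measurable_m1 (Nat.zero_le T)
  have : IsProbabilityMeasure S.lawM1 := by
    rw [← hξ.law_m1 0 (Nat.zero_le T)]
    exact Measure.isProbabilityMeasure_map hm.aemeasurable
  simp only [π1]
  rw [sum_measureReal_singleton]
  simp

/-- Integrating out the local mode given the common information. -/
lemma Realizes.integral_avg (hξ : S.Realizes P T ξ) (hpos : ∀ m : d.M1, 0 < S.π1 m) {t : ℕ}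
    (ht : t ≤ T) (h0 : ∀ r < t, Measurable (l0 r)) (h1 : ∀ r < t, Measurable (l1 r))
    {f : d.Hist t × d.X1 → d.M1 → ℝ} (hf : ∀ m, Measurable fun a => f a m)
    (hint : Integrable (fun ω => f (S.hist ξ l0 l1 t ω, S.state1 ξ l0 l1 t ω) (ξ.m1 t ω)) P) :
    Integrable (fun ω => S.avg (S.hist ξ l0 l1 t ω).zt
      (f (S.hist ξ l0 l1 t ω, S.state1 ξ l0 l1 t ω))) P ∧
    ∫ ω, S.avg (S.hist ξ l0 l1 t ω).zt
      (f (S.hist ξ l0 l1 t ω, S.state1 ξ l0 l1 t ω)) ∂P =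
      ∫ ω, f (S.hist ξ l0 l1 t ω, S.state1 ξ l0 l1 t ω) (ξ.m1 t ω) ∂P := by
  have hb : MeasBefore ξ l0 l1 t := hξ.measBefore (ht.trans (Nat.le_succ T)) h0 h1
  have hm0 := hξ.measurable_m0 ht
  have hm1 := hξ.measurable_m1 ht
  have hγ := hξ.measurable_γ ht
  let V : Ω → (d.Hist t × d.X1) × Bool := fun ω =>
    (((S.hist ξ l0 l1 t ω).erase, S.state1 ξ l0 l1 t ω), ξ.γ t ω)
  have hV : Measurable V :=
    ((S.measurable_erase_hist hb hm0).prodMk (S.measurable_state hb).2).prodMk hγ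
  -- Only drops require averaging. On reception `avg` evaluates at the received mode, which is the
  -- true one; on a drop the history equals its erasure, and the local mode is independent of `V`.
  let g : d.M1 → (d.Hist t × d.X1) × Bool → ℝ := fun m v => if v.2 then 0 else f v.1 m
  have hg : ∀ m, Measurable (g m) := fun m =>
    Measurable.ite (measurable_snd (measurableSet_singleton true)) measurable_const
      ((hf m).comp measurable_fst)
  have hγset : MeasurableSet (ξ.γ t ⁻¹' {true}) := hγ (measurableSet_singleton true)
  have hrec : Integrable (fun ω => if ξ.γ t ω then
      f (S.hist ξ l0 l1 t ω, S.state1 ξ l0 l1 t ω) (ξ.m1 t ω) else 0) P := by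
    refine (hint.indicator hγset).congr (.of_forall fun ω => ?_)
    by_cases h : ξ.γ t ω <;> simp [h]
  have herase : ∀ ω, ξ.γ t ω = false → (S.hist ξ l0 l1 t ω).erase = S.hist ξ l0 l1 t ω := by
    intro ω h
    exact Hist.erase_eq_self _ (by simp [hist_z, channel, h]) (by simp [hist_zt, channel, h])
  have hsplit : ∀ ω, f (S.hist ξ l0 l1 t ω, S.state1 ξ l0 l1 t ω) (ξ.m1 t ω) =
      (if ξ.γ t ω then f (S.hist ξ l0 l1 t ω, S.state1 ξ l0 l1 t ω) (ξ.m1 t ω) else 0) +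
        g (ξ.m1 t ω) (V ω) := by
    intro ω
    cases h : ξ.γ t ω
    · simp [g, V, h, herase ω h]
    · simp [g, V, h]
  have hsplit' : ∀ ω, S.avg (S.hist ξ l0 l1 t ω).zt
      (f (S.hist ξ l0 l1 t ω, S.state1 ξ l0 l1 t ω)) =
      (if ξ.γ t ω then f (S.hist ξ l0 l1 t ω, S.state1 ξ l0 l1 t ω) (ξ.m1 t ω) else 0) +
        ∑ m, S.π1 m * g m (V ω) := by
    intro ω
    rw [hist_zt]
    cases h : ξ.γ t ω
    · simp [g, V, h, herase ω h, channel, avg]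
    · simp [g, V, h, channel, avg]
  have hgint : Integrable (fun ω => g (ξ.m1 t ω) (V ω)) P := by
    refine (hint.sub hrec).congr (.of_forall fun ω => ?_)
    simp only [Pi.sub_apply]
    rw [sub_eq_iff_eq_add']
    exact hsplit ω
  have hind := hξ.indepFun_m1 (l0 := l0) (l1 := l1) ht h0 h1
  -- Integrability along the actual mode passes to each fixed mode because every mode has positive
  -- probability.
  have hgm : ∀ m, Integrable (fun ω => g m (V ω)) P := fun m =>
    integrable_of_indepFun_finite hm1 hV hind hg hgint m (by
      rw [hξ.law_m1 t ht]; exact hpos m)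
  have hsum : Integrable (fun ω => ∑ m, S.π1 m * g m (V ω)) P :=
    integrable_finsetSum _ fun m _ => (hgm m).const_mul _
  refine ⟨(hrec.add hsum).congr (.of_forall fun ω => (hsplit' ω).symm), ?_⟩
  rw [integral_congr_ae (.of_forall hsplit'), integral_congr_ae (.of_forall hsplit),
    integral_add hrec hsum, integral_add hrec hgint,
    integral_of_indepFun_finite hm1 hV hind hg hgint, hξ.law_m1 t ht,
    integral_finsetSum _ fun m _ => (hgm m).const_mul _]
  simp only [integral_const_mul]
  rfl

lemma Realizes.memLp_avg (hξ : S.Realizes P T ξ) (hpos : ∀ m : d.M1, 0 < S.π1 m) {t : ℕ}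
    (ht : t ≤ T) (h0 : ∀ r < t, Measurable (l0 r)) (h1 : ∀ r < t, Measurable (l1 r))
    {f : d.Hist t → d.M1 → ℝ} (hf : ∀ m, Measurable fun a => f a m)
    (hL : MemLp (fun ω => f (S.hist ξ l0 l1 t ω) (ξ.m1 t ω)) 2 P) :
    MemLp (fun ω => S.avg (S.hist ξ l0 l1 t ω).zt (f (S.hist ξ l0 l1 t ω))) 2 P := by
  have hb : MeasBefore ξ l0 l1 t := hξ.measBefore (ht.trans (Nat.le_succ T)) h0 h1
  have hH := S.measurable_hist hb (hξ.measurable_m0 ht) (hξ.measurable_m1 ht) (hξ.measurable_γ ht)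
  have hmeas : Measurable fun ω => S.avg (S.hist ξ l0 l1 t ω).zt (f (S.hist ξ l0 l1 t ω)) :=
    S.measurable_avg_real (Hist.measurable_zt.comp hH) fun m => (hf m).comp hH
  have hsq := (hξ.integral_avg (l0 := l0) (l1 := l1) hpos ht h0 h1
    (f := fun a m => f a.1 m ^ 2) (fun m => ((hf m).comp measurable_fst).pow_const 2)
    hL.integrable_sq).1
  refine (memLp_two_iff_integrable_sq hmeas.aestronglyMeasurable).2 (hsq.mono'
    (hmeas.pow_const 2).aestronglyMeasurable (.of_forall fun ω => ?_))
  rw [Real.norm_of_nonneg (sq_nonneg _)]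
  exact avg_sq_le hξ.sum_π1 _ _

end Realization

/-! ### The recursive estimate of the local state -/

/-- Candidates for `E[U¹_t | H⁰_t = h, M¹_t = m]`. -/
abbrev MeanAction (d : Dims) : Type := ∀ t : ℕ, d.Hist t → d.M1 → d.U1

section Estimate

variable (l0 : Strategy0 d) (b : MeanAction d)

/-- The recursive estimate of the local state when controller `1` plays `b` in the mean. -/
def est : ∀ t : ℕ, d.Hist t → d.X1
  | 0, h => Sum.elim id (fun _ => ∫ x, x ∂S.lawX1) h.z
  | t + 1, h => Sum.elim id (fun _ => S.avg h.past.zt (fun m => S.D h.past.m0 m *ᵥ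
      vec h.past.x0 (est t h.past) (l0 t h.past) (b t h.past m)) ∘ Sum.inr) h.z

/-- The conditional mean of states and actions given the common information and the mode. -/
def zbar (t : ℕ) (h : d.Hist t) (m : d.M1) : d.IX ⊕ d.IU → ℝ :=
  vec h.x0 (S.est l0 b t h) (l0 t h) (b t h m)

/-- The predicted mean of the next states. -/
def pred (t : ℕ) (h : d.Hist t) : d.IX → ℝ :=
  S.avg h.zt fun m => S.D h.m0 m *ᵥ S.zbar l0 b t h m

lemma est_succ (t : ℕ) (h : d.Hist (t + 1)) :
    S.est l0 b (t + 1) h = Sum.elim id (fun _ => S.pred l0 b t h.past ∘ Sum.inr) h.z := rfl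

lemma est_of_received {t : ℕ} (h : d.Hist t) {x : d.X1} (hz : h.z = Sum.inl x) :
    S.est l0 b t h = x := by
  cases t with
  | zero => simp [est, hz]
  | succ t => simp [est_succ, hz]

variable {l0 b}

lemma measurable_zbar_of_est {t : ℕ} (h0 : Measurable (l0 t)) (hb : ∀ m, Measurable (b t · m))
    (he : Measurable (S.est l0 b t)) (m : d.M1) : Measurable (S.zbar l0 b t · m) :=
  measurable_vec Hist.measurable_x0 he h0 (hb m)

lemma measurable_pred_of_est {t : ℕ} (h0 : Measurable (l0 t)) (hb : ∀ m, Measurable (b t · m))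
    (he : Measurable (S.est l0 b t)) : Measurable (S.pred l0 b t) :=
  S.measurable_avg Hist.measurable_zt fun m =>
    measurable_switch_mulVec Hist.measurable_m0 (fun m0 => S.D m0 m)
      (S.measurable_zbar_of_est h0 hb he m)

lemma measurable_est {t : ℕ} (h0 : ∀ r < t, Measurable (l0 r))
    (hb : ∀ r < t, ∀ m, Measurable (b r · m)) : Measurable (S.est l0 b t) := by
  induction t with
  | zero => exact measurable_received Hist.measurable_z measurable_id measurable_const
  | succ t ih =>
    have hlt := Nat.lt_succ_self t
    have he := ih (fun r hr => h0 r (hr.trans hlt)) fun r hr => hb r (hr.trans hlt)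
    exact measurable_received Hist.measurable_z measurable_id (measurable_comp_right
      ((S.measurable_pred_of_est (h0 t hlt) (hb t hlt) he).comp Hist.measurable_past) Sum.inr)

end Estimate

/-- Block triangularity: neither the local state and action nor the local mode influence the global
plant. Hence the global part of the drift is exactly predictable from the common information, as
used in `drift_inl`. -/
lemma D_mulVec_inl (m0 : d.M0) (m1 : d.M1) (x0 : d.X0) (x1 : d.X1) (u0 : d.U0) (u1 : d.U1) :
    (S.D m0 m1 *ᵥ vec x0 x1 u0 u1) ∘ Sum.inl = S.A00 m0 *ᵥ x0 + S.B00 m0 *ᵥ u0 := by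
  rw [D_mulVec_vec, A, B, Matrix.fromBlocks_mulVec, Matrix.fromBlocks_mulVec]
  ext i
  simp

/-- Deviations have no global components, so only the local blocks act on them. -/
lemma D_mulVec_inr (m0 : d.M0) (m1 : d.M1) (e : d.X1) (q : d.U1) :
    (S.D m0 m1 *ᵥ vec 0 e 0 q) ∘ Sum.inr = S.D11 m0 m1 *ᵥ Sum.elim e q := by
  rw [D_mulVec_vec, A, B, Matrix.fromBlocks_mulVec, Matrix.fromBlocks_mulVec, D11,
    Matrix.fromCols_mulVec_sumElim]
  ext i
  simp

lemma vec_add (x0 y0 : d.X0) (x1 y1 : d.X1) (u0 v0 : d.U0) (u1 v1 : d.U1) :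
    vec (x0 + y0) (x1 + y1) (u0 + v0) (u1 + v1) = vec x0 x1 u0 u1 + vec y0 y1 v0 v1 := by
  ext i
  rcases i with (i | i) | (i | i) <;> rfl

/-! ### Propagation of the conditional means -/

section Propagation

variable {Ω : Type*} [MeasurableSpace Ω] (P : Measure Ω)
  (ξ : Primitives d Ω) (l0 : Strategy0 d) (l1 : Strategy1 d) (b : MeanAction d) (t : ℕ)

/-- At time `t` the states are square integrable and `est` is the conditional mean of the local
state before transmission. -/
structure StateMean : Prop where
  meas_l0 : ∀ r < t, Measurable (l0 r)
  meas_l1 : ∀ r < t, Measurable (l1 r)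
  meas_b : ∀ r < t, ∀ m, Measurable (b r · m)
  x0 : SqInt (S.state0 ξ l0 l1 t) P
  x1 : SqInt (S.state1 ξ l0 l1 t) P
  est_sq : SqInt (fun ω => S.est l0 b t (S.hist ξ l0 l1 t ω).erase) P
  orth : ∀ i, Orth (fun ω => ((S.hist ξ l0 l1 t ω).erase, ξ.m1 t ω, ξ.γ t ω))
    (fun ω => S.state1 ξ l0 l1 t ω i - S.est l0 b t (S.hist ξ l0 l1 t ω).erase i) P

/-- At time `t` the actions are square integrable and `b` is the conditional mean of the local
action given the common information and the mode. -/
structure ActionMean : Prop where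
  meas_l0 : Measurable (l0 t)
  meas_l1 : Measurable (l1 t)
  meas_b : ∀ m, Measurable (b t · m)
  u0 : SqInt (S.action0 ξ l0 l1 t) P
  u1 : SqInt (S.action1 ξ l0 l1 t) P
  bsq : SqInt (fun ω => b t (S.hist ξ l0 l1 t ω) (ξ.m1 t ω)) P
  orth : ∀ i, Orth (fun ω => (S.hist ξ l0 l1 t ω, ξ.m1 t ω))
    (fun ω => S.action1 ξ l0 l1 t ω i - b t (S.hist ξ l0 l1 t ω) (ξ.m1 t ω) i) P

end Propagation

section Propagation

variable {Ω : Type*}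
  (ξ : Primitives d Ω) (l0 : Strategy0 d) (l1 : Strategy1 d) (b : MeanAction d) (t : ℕ)

/-- The deviations of local state and action from their conditional means. -/
def dev (ω : Ω) : Fin d.x1 ⊕ Fin d.u1 → ℝ :=
  Sum.elim (S.state1 ξ l0 l1 t ω - S.est l0 b t (S.hist ξ l0 l1 t ω))
    (S.action1 ξ l0 l1 t ω - b t (S.hist ξ l0 l1 t ω) (ξ.m1 t ω))

/-- The deviation of the mean next local state given the mode from its predicted mean. -/
def modeDev (h : d.Hist t) (m : d.M1) : d.X1 :=
  (S.D h.m0 m *ᵥ S.zbar l0 b t h m - S.pred l0 b t h) ∘ Sum.inr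

/-- The deviation of the next local state, before the noise, from its predicted mean. -/
def innov (ω : Ω) : d.X1 :=
  S.modeDev l0 b t (S.hist ξ l0 l1 t ω) (ξ.m1 t ω) +
    S.D11 (ξ.m0 t ω) (ξ.m1 t ω) *ᵥ S.dev ξ l0 l1 b t ω

/-- `innov` as a function of the common information, the local state and the local mode. -/
def innovFun (a : d.Hist t × d.X1 × d.M1) : d.X1 :=
  (S.D a.1.m0 a.2.2 *ᵥ vec a.1.x0 a.2.1 (l0 t a.1) (l1 t a) - S.pred l0 b t a.1) ∘ Sum.inr

lemma vec_eq_zbar_add (ω : Ω) :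
    vec (S.state0 ξ l0 l1 t ω) (S.state1 ξ l0 l1 t ω) (S.action0 ξ l0 l1 t ω)
      (S.action1 ξ l0 l1 t ω) = S.zbar l0 b t (S.hist ξ l0 l1 t ω) (ξ.m1 t ω) +
      vec 0 (S.state1 ξ l0 l1 t ω - S.est l0 b t (S.hist ξ l0 l1 t ω)) 0
        (S.action1 ξ l0 l1 t ω - b t (S.hist ξ l0 l1 t ω) (ξ.m1 t ω)) := by
  rw [zbar, ← vec_add]
  simp [state0, action0]

lemma drift_inr (ω : Ω) : S.drift ξ l0 l1 t ω ∘ Sum.inr =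
    S.pred l0 b t (S.hist ξ l0 l1 t ω) ∘ Sum.inr + S.innov ξ l0 l1 b t ω := by
  have h := S.D_mulVec_inr (ξ.m0 t ω) (ξ.m1 t ω)
    (S.state1 ξ l0 l1 t ω - S.est l0 b t (S.hist ξ l0 l1 t ω))
    (S.action1 ξ l0 l1 t ω - b t (S.hist ξ l0 l1 t ω) (ξ.m1 t ω))
  rw [innov, dev, ← h, drift, S.vec_eq_zbar_add ξ l0 l1 b, Matrix.mulVec_add, modeDev, hist_m0]
  ext i
  simp only [Function.comp_apply, Pi.add_apply, Pi.sub_apply]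
  ring

/-- Exhibits the innovation as a function of data that are independent of the noise; the form
through `dev` shows its orthogonality, this one its measurability and independence. -/
lemma innovFun_eq (ω : Ω) :
    S.innovFun l0 l1 b t (S.hist ξ l0 l1 t ω, S.state1 ξ l0 l1 t ω, ξ.m1 t ω) =
      S.innov ξ l0 l1 b t ω := by
  have h := S.drift_inr ξ l0 l1 b t ω
  rw [← sub_eq_iff_eq_add'] at h
  rw [← h, innovFun, hist_m0]
  rfl

lemma drift_inl (hπ : ∑ m, S.π1 m = 1) (ω : Ω) : S.drift ξ l0 l1 t ω ∘ Sum.inl =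
    S.pred l0 b t (S.hist ξ l0 l1 t ω) ∘ Sum.inl := by
  rw [drift, pred, avg_comp]
  simp only [zbar, D_mulVec_inl]
  rw [avg_const hπ, hist_m0]
  rfl

lemma state1_succ_eq (ω : Ω) : S.state1 ξ l0 l1 (t + 1) ω =
    S.pred l0 b t (S.hist ξ l0 l1 t ω) ∘ Sum.inr + (S.innov ξ l0 l1 b t ω + ξ.w1 t ω) := by
  rw [state1_succ, S.drift_inr ξ l0 l1 b, add_assoc]

lemma state0_succ_eq (hπ : ∑ m, S.π1 m = 1) (ω : Ω) : S.state0 ξ l0 l1 (t + 1) ω =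
    S.pred l0 b t (S.hist ξ l0 l1 t ω) ∘ Sum.inl + ξ.w0 t ω := by
  rw [state0_succ, S.drift_inl ξ l0 l1 b t hπ]

lemma est_erase_succ (ω : Ω) : S.est l0 b (t + 1) (S.hist ξ l0 l1 (t + 1) ω).erase =
    S.pred l0 b t (S.hist ξ l0 l1 t ω) ∘ Sum.inr := by
  rw [est_succ, Hist.z_erase, Hist.past_erase, hist_succ, Hist.past_extend]
  rfl

lemma est_erase_zero (ω : Ω) :
    S.est l0 b 0 (S.hist ξ l0 l1 0 ω).erase = ∫ x, x ∂S.lawX1 := by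
  rw [est, Hist.z_erase]
  rfl

lemma erase_hist_of_dropped {ω : Ω} (h : ξ.γ t ω = false) :
    (S.hist ξ l0 l1 t ω).erase = S.hist ξ l0 l1 t ω :=
  Hist.erase_eq_self _ (by simp [hist_z, channel, h]) (by simp [hist_zt, channel, h])

/-- Reception reveals the local state, and a drop leaves the estimate made before transmission. -/
lemma est_hist (ω : Ω) : S.est l0 b t (S.hist ξ l0 l1 t ω) =
    if ξ.γ t ω then S.state1 ξ l0 l1 t ω else S.est l0 b t (S.hist ξ l0 l1 t ω).erase := by
  cases h : ξ.γ t ω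
  · simp [S.erase_hist_of_dropped ξ l0 l1 t h]
  · simpa using S.est_of_received l0 b _ (by simp [hist_z, channel, h])

end Propagation

section Propagation

variable {S} {Ω : Type*} [MeasurableSpace Ω] {P : Measure Ω} {T : ℕ}
  {ξ : Primitives d Ω} {l0 : Strategy0 d} {l1 : Strategy1 d} {b : MeanAction d} {t : ℕ}

lemma StateMean.measBefore (hA : S.StateMean P ξ l0 l1 b t) (hξ : S.Realizes P T ξ)
    (ht : t ≤ T) : MeasBefore ξ l0 l1 t :=
  hξ.measBefore (ht.trans (Nat.le_succ T)) hA.meas_l0 hA.meas_l1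

lemma StateMean.measurable_hist (hA : S.StateMean P ξ l0 l1 b t) (hξ : S.Realizes P T ξ)
    (ht : t ≤ T) : Measurable (S.hist ξ l0 l1 t) :=
  S.measurable_hist (hA.measBefore hξ ht) (hξ.measurable_m0 ht) (hξ.measurable_m1 ht)
    (hξ.measurable_γ ht)

lemma StateMean.measurable_est (hA : S.StateMean P ξ l0 l1 b t) : Measurable (S.est l0 b t) :=
  S.measurable_est hA.meas_l0 hA.meas_b

lemma StateMean.est_hist_sq (hA : S.StateMean P ξ l0 l1 b t) (hξ : S.Realizes P T ξ)
    (ht : t ≤ T) : SqInt (fun ω => S.est l0 b t (S.hist ξ l0 l1 t ω)) P := by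
  simp only [S.est_hist ξ l0 l1 b]
  refine SqInt.switch (X := fun (g : Bool) ω => if g then S.state1 ξ l0 l1 t ω else
    S.est l0 b t (S.hist ξ l0 l1 t ω).erase) (hξ.measurable_γ ht) ?_
  rintro (_ | _)
  · simpa using hA.est_sq
  · simpa using hA.x1

/-- The error is zero on reception and equals the error before transmission on a drop. Multiplying
the test function by the indicator of a drop therefore changes nothing, and turns it into a function
of the erased history, the mode and the link state. -/
lemma StateMean.orth_hist (hA : S.StateMean P ξ l0 l1 b t) (hξ : S.Realizes P T ξ)
    (ht : t ≤ T) (i : Fin d.x1) : Orth (fun ω => (S.hist ξ l0 l1 t ω, ξ.m1 t ω))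
      (fun ω => S.state1 ξ l0 l1 t ω i - S.est l0 b t (S.hist ξ l0 l1 t ω) i) P := by
  intro φ hφ hL
  have h := hA.orth i (fun a => if a.2.2 then 0 else φ (a.1, a.2.1))
    (Measurable.ite ((measurable_snd.comp measurable_snd) (measurableSet_singleton true))
      measurable_const (hφ.comp (by fun_prop))) ?_
  · rw [← h]
    refine integral_congr_ae (.of_forall fun ω => ?_)
    simp only [S.est_hist ξ l0 l1 b t ω]
    cases hγ : ξ.γ t ω
    · simp [S.erase_hist_of_dropped ξ l0 l1 t hγ]
    · simp
  · refine (hL.indicator ((hξ.measurable_γ ht) (measurableSet_singleton false))).congr_norm ?_ ?_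
    · have hm : Measurable fun ω => ((S.hist ξ l0 l1 t ω).erase, ξ.m1 t ω, ξ.γ t ω) :=
        (Hist.measurable_erase.comp (hA.measurable_hist hξ ht)).prodMk
          ((hξ.measurable_m1 ht).prodMk (hξ.measurable_γ ht))
      exact ((Measurable.ite ((measurable_snd.comp measurable_snd) (measurableSet_singleton true))
        measurable_const (hφ.comp (by fun_prop)) :
        Measurable fun a : d.Hist t × d.M1 × Bool =>
          if a.2.2 then 0 else φ (a.1, a.2.1)).comp hm).aestronglyMeasurable
    · refine .of_forall fun ω => ?_
      cases hγ : ξ.γ t ω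
      · simp [hγ, S.erase_hist_of_dropped ξ l0 l1 t hγ]
      · simp [hγ]

lemma zbar_sq (hA : S.StateMean P ξ l0 l1 b t) (hB : S.ActionMean P ξ l0 l1 b t)
    (hξ : S.Realizes P T ξ) (ht : t ≤ T) :
    SqInt (fun ω => S.zbar l0 b t (S.hist ξ l0 l1 t ω) (ξ.m1 t ω)) P :=
  (SqInt.elim hA.x0 (hA.est_hist_sq hξ ht)).elim (SqInt.elim hB.u0 hB.bsq)

lemma dev_sq (hA : S.StateMean P ξ l0 l1 b t) (hB : S.ActionMean P ξ l0 l1 b t)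
    (hξ : S.Realizes P T ξ) (ht : t ≤ T) : SqInt (S.dev ξ l0 l1 b t) P :=
  SqInt.elim (hA.x1.sub (hA.est_hist_sq hξ ht)) (hB.u1.sub hB.bsq)

lemma dev_orth (hA : S.StateMean P ξ l0 l1 b t) (hB : S.ActionMean P ξ l0 l1 b t)
    (hξ : S.Realizes P T ξ) (ht : t ≤ T) (i : Fin d.x1 ⊕ Fin d.u1) :
    Orth (fun ω => (S.hist ξ l0 l1 t ω, ξ.m1 t ω)) (fun ω => S.dev ξ l0 l1 b t ω i) P := by
  rcases i with i | i
  · exact hA.orth_hist hξ ht i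
  · exact hB.orth i

lemma measurable_pred (hA : S.StateMean P ξ l0 l1 b t) (hB : S.ActionMean P ξ l0 l1 b t) :
    Measurable (S.pred l0 b t) := S.measurable_pred_of_est hB.meas_l0 hB.meas_b hA.measurable_est

lemma measurable_Dzbar (hA : S.StateMean P ξ l0 l1 b t) (hB : S.ActionMean P ξ l0 l1 b t)
    (m : d.M1) : Measurable fun h : d.Hist t => S.D h.m0 m *ᵥ S.zbar l0 b t h m :=
  measurable_switch_mulVec Hist.measurable_m0 (fun m0 => S.D m0 m)
    (S.measurable_zbar_of_est hB.meas_l0 hB.meas_b hA.measurable_est m)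

lemma measurable_innovFun (hA : S.StateMean P ξ l0 l1 b t) (hB : S.ActionMean P ξ l0 l1 b t) :
    Measurable (S.innovFun l0 l1 b t) := by
  have h1 : Measurable fun a : d.Hist t × d.X1 × d.M1 =>
      S.D a.1.m0 a.2.2 *ᵥ vec a.1.x0 a.2.1 (l0 t a.1) (l1 t a) :=
    measurable_switch_mulVec (c := fun a : d.Hist t × d.X1 × d.M1 => (a.1.m0, a.2.2))
      ((Hist.measurable_m0.comp measurable_fst).prodMk (by fun_prop))
      (fun k => S.D k.1 k.2) (measurable_vec (Hist.measurable_x0.comp measurable_fst)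
        (by fun_prop) (hB.meas_l0.comp measurable_fst) hB.meas_l1)
  exact measurable_comp_right (h1.sub ((measurable_pred hA hB).comp measurable_fst)) Sum.inr

lemma Dzbar_sq (hA : S.StateMean P ξ l0 l1 b t) (hB : S.ActionMean P ξ l0 l1 b t)
    (hξ : S.Realizes P T ξ) (ht : t ≤ T) : SqInt (fun ω => S.D (S.hist ξ l0 l1 t ω).m0 (ξ.m1 t ω) *ᵥ
      S.zbar l0 b t (S.hist ξ l0 l1 t ω) (ξ.m1 t ω)) P :=
  SqInt.measurable_mulVec (c := fun ω => ((S.hist ξ l0 l1 t ω).m0, ξ.m1 t ω))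
    ((Hist.measurable_m0.comp (hA.measurable_hist hξ ht)).prodMk (hξ.measurable_m1 ht))
    (fun k => S.D k.1 k.2) (zbar_sq hA hB hξ ht)

lemma Realizes.w0_sq (hξ : S.Realizes P T ξ) (hS : S.Standing T) (ht : t ≤ T) :
    SqInt (ξ.w0 t) P := by
  have h := hS.w0_sq t ht
  rw [← hξ.law_w0 t ht, memLp_map_measure_iff (by fun_prop) (hξ.measurable_w0 ht).aemeasurable] at h
  exact SqInt.of_memLp h

lemma Realizes.w1_sq (hξ : S.Realizes P T ξ) (hS : S.Standing T) (ht : t ≤ T) :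
    SqInt (ξ.w1 t) P := by
  have h := hS.w1_sq t ht
  rw [← hξ.law_w1 t ht, memLp_map_measure_iff (by fun_prop) (hξ.measurable_w1 ht).aemeasurable] at h
  exact SqInt.of_memLp h

lemma Realizes.x0_sq (hξ : S.Realizes P T ξ) (hS : S.Standing T) : SqInt ξ.x0 P := by
  have h := hS.x0_sq
  have hm : Measurable ξ.x0 := hξ.measurable .x0
  rw [← hξ.law_x0, memLp_map_measure_iff (by fun_prop) hm.aemeasurable] at h
  exact SqInt.of_memLp h

lemma Realizes.x1_sq (hξ : S.Realizes P T ξ) (hS : S.Standing T) : SqInt ξ.x1 P := by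
  have h := hS.x1_sq
  have hm : Measurable ξ.x1 := hξ.measurable .x1
  rw [← hξ.law_x1, memLp_map_measure_iff (by fun_prop) hm.aemeasurable] at h
  exact SqInt.of_memLp h

lemma D11_dev_sq (hA : S.StateMean P ξ l0 l1 b t) (hB : S.ActionMean P ξ l0 l1 b t)
    (hξ : S.Realizes P T ξ) (ht : t ≤ T) :
    SqInt (fun ω => S.D11 (ξ.m0 t ω) (ξ.m1 t ω) *ᵥ S.dev ξ l0 l1 b t ω) P :=
  SqInt.measurable_mulVec (c := fun ω => (ξ.m0 t ω, ξ.m1 t ω))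
    ((hξ.measurable_m0 ht).prodMk (hξ.measurable_m1 ht)) (fun k => S.D11 k.1 k.2)
    (dev_sq hA hB hξ ht)

lemma D11_dev_orth (hA : S.StateMean P ξ l0 l1 b t) (hB : S.ActionMean P ξ l0 l1 b t)
    (hξ : S.Realizes P T ξ) (ht : t ≤ T) (i : Fin d.x1) :
    Orth (fun ω => (S.hist ξ l0 l1 t ω, ξ.m1 t ω))
      (fun ω => (S.D11 (ξ.m0 t ω) (ξ.m1 t ω) *ᵥ S.dev ξ l0 l1 b t ω) i) P := by
  have h := Orth.switch_mulVec (F := fun ω => (S.hist ξ l0 l1 t ω, ξ.m1 t ω))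
    ((hA.measurable_hist hξ ht).prodMk (hξ.measurable_m1 ht)) (dev_orth hA hB hξ ht)
    (dev_sq hA hB hξ ht) (c := fun a : d.Hist t × d.M1 => (a.1.m0, a.2))
    ((Hist.measurable_m0.comp measurable_fst).prodMk measurable_snd) (fun k => S.D11 k.1 k.2) i
  simpa only [hist_m0] using h

variable [IsProbabilityMeasure P]

lemma pred_sq (hA : S.StateMean P ξ l0 l1 b t) (hB : S.ActionMean P ξ l0 l1 b t)
    (hξ : S.Realizes P T ξ) (ht : t ≤ T) (hpos : ∀ m : d.M1, 0 < S.π1 m) :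
    SqInt (fun ω => S.pred l0 b t (S.hist ξ l0 l1 t ω)) P := by
  intro i
  simp only [pred, avg_apply]
  exact hξ.memLp_avg hpos ht hA.meas_l0 hA.meas_l1
    (f := fun h m => (S.D h.m0 m *ᵥ S.zbar l0 b t h m) i)
    (fun m => measurable_pi_iff.1 (measurable_Dzbar hA hB m) i) (Dzbar_sq hA hB hξ ht i)

lemma modeDev_sq (hA : S.StateMean P ξ l0 l1 b t) (hB : S.ActionMean P ξ l0 l1 b t)
    (hξ : S.Realizes P T ξ) (ht : t ≤ T) (hpos : ∀ m : d.M1, 0 < S.π1 m) :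
    SqInt (fun ω => S.modeDev l0 b t (S.hist ξ l0 l1 t ω) (ξ.m1 t ω)) P :=
  ((Dzbar_sq hA hB hξ ht).sub (pred_sq hA hB hξ ht hpos)).comp Sum.inr

/-- The prediction is by construction the average over the mode given the common information, so
`Realizes.integral_avg` gives both terms of the difference the same integral. -/
lemma modeDev_orth (hA : S.StateMean P ξ l0 l1 b t) (hB : S.ActionMean P ξ l0 l1 b t)
    (hξ : S.Realizes P T ξ) (ht : t ≤ T) (hpos : ∀ m : d.M1, 0 < S.π1 m) (i : Fin d.x1) :
    Orth (S.hist ξ l0 l1 t)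
      (fun ω => S.modeDev l0 b t (S.hist ξ l0 l1 t ω) (ξ.m1 t ω) i) P := by
  intro φ hφ hL
  have hD := Dzbar_sq hA hB hξ ht (Sum.inr i)
  have hp := pred_sq hA hB hξ ht hpos (Sum.inr i)
  have hint := integrable_mul_of_memLp hL hD
  have h := hξ.integral_avg (l0 := l0) (l1 := l1) hpos ht hA.meas_l0 hA.meas_l1
    (f := fun a m => φ a.1 * (S.D a.1.m0 m *ᵥ S.zbar l0 b t a.1 m) (Sum.inr i))
    (fun m => (hφ.comp measurable_fst).mul
      ((measurable_pi_iff.1 (measurable_Dzbar hA hB m) _).comp measurable_fst)) hint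
  have hval : ∀ ω, φ (S.hist ξ l0 l1 t ω) *
      S.modeDev l0 b t (S.hist ξ l0 l1 t ω) (ξ.m1 t ω) i =
      φ (S.hist ξ l0 l1 t ω) * (S.D (S.hist ξ l0 l1 t ω).m0 (ξ.m1 t ω) *ᵥ
        S.zbar l0 b t (S.hist ξ l0 l1 t ω) (ξ.m1 t ω)) (Sum.inr i) -
      φ (S.hist ξ l0 l1 t ω) * S.pred l0 b t (S.hist ξ l0 l1 t ω) (Sum.inr i) := by
    intro ω
    simp [modeDev, mul_sub]
  simp only [hval]
  rw [integral_sub hint (integrable_mul_of_memLp hL hp), sub_eq_zero, ← h.2]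
  simp only [avg_mul_left, pred, avg_apply]

lemma innov_sq (hA : S.StateMean P ξ l0 l1 b t) (hB : S.ActionMean P ξ l0 l1 b t)
    (hξ : S.Realizes P T ξ) (ht : t ≤ T) (hpos : ∀ m : d.M1, 0 < S.π1 m) :
    SqInt (S.innov ξ l0 l1 b t) P :=
  (modeDev_sq hA hB hξ ht hpos).add (D11_dev_sq hA hB hξ ht)

/-- Here the conditioning is on the history alone: the part coming from `dev` is orthogonal even
given the mode, but `modeDev` only becomes so once the mode is averaged out. -/
lemma innov_orth (hA : S.StateMean P ξ l0 l1 b t) (hB : S.ActionMean P ξ l0 l1 b t)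
    (hξ : S.Realizes P T ξ) (ht : t ≤ T) (hpos : ∀ m : d.M1, 0 < S.π1 m) (i : Fin d.x1) :
    Orth (S.hist ξ l0 l1 t) (fun ω => S.innov ξ l0 l1 b t ω i) P :=
  (modeDev_orth hA hB hξ ht hpos i).add ((D11_dev_orth hA hB hξ ht i).comp measurable_fst)
    (modeDev_sq hA hB hξ ht hpos i) (D11_dev_sq hA hB hξ ht i)

lemma Realizes.w0_orth (hξ : S.Realizes P T ξ) (hS : S.Standing T) (ht : t ≤ T)
    (h0 : ∀ r < t, Measurable (l0 r)) (h1 : ∀ r < t, Measurable (l1 r)) (i : Fin d.x0) :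
    Orth (fun ω => (S.hist ξ l0 l1 t ω, S.state1 ξ l0 l1 t ω, ξ.m1 t ω))
      (fun ω => ξ.w0 t ω i) P := by
  have hsq := hξ.w0_sq hS ht
  refine orth_of_indepFun ((hξ.indepFun_noise ht h0 h1).comp measurable_id
    ((measurable_pi_apply i).comp measurable_fst)) (hsq i) ?_
  have h := hS.w0_mean t ht
  rw [← hξ.law_w0 t ht, integral_map (hξ.measurable_w0 ht).aemeasurable (by fun_prop)] at h
  rw [← eval_integral fun i => (hsq i).integrable one_le_two, h]
  rfl

lemma Realizes.w1_orth (hξ : S.Realizes P T ξ) (hS : S.Standing T) (ht : t ≤ T)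
    (h0 : ∀ r < t, Measurable (l0 r)) (h1 : ∀ r < t, Measurable (l1 r)) (i : Fin d.x1) :
    Orth (fun ω => (S.hist ξ l0 l1 t ω, S.state1 ξ l0 l1 t ω, ξ.m1 t ω))
      (fun ω => ξ.w1 t ω i) P := by
  have hsq := hξ.w1_sq hS ht
  refine orth_of_indepFun ((hξ.indepFun_noise ht h0 h1).comp measurable_id
    ((measurable_pi_apply i).comp measurable_snd)) (hsq i) ?_
  have h := hS.w1_mean t ht
  rw [← hξ.law_w1 t ht, integral_map (hξ.measurable_w1 ht).aemeasurable (by fun_prop)] at h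
  rw [← eval_integral fun i => (hsq i).integrable one_le_two, h]
  rfl

/-- Before the first transmission the estimate is the mean of $X^1_0$, which is independent of all
other data of time zero. -/
lemma StateMean.zero (hξ : S.Realizes P T ξ) (hS : S.Standing T) :
    S.StateMean P ξ l0 l1 b 0 := by
  have hx1 : Measurable ξ.x1 := hξ.measurable .x1
  have hx0 : Measurable ξ.x0 := hξ.measurable .x0
  have hT := Nat.zero_le T
  have hsq := hξ.x1_sq hS
  have hmean : ∀ i, (∫ x, x ∂S.lawX1) i = ∫ ω, ξ.x1 ω i ∂P := by
    intro i
    rw [← hξ.law_x1, integral_map hx1.aemeasurable (by fun_prop),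
      eval_integral fun i => (hsq i).integrable one_le_two]
  refine ⟨by simp, by simp, by simp, hξ.x0_sq hS, hsq, ?_, fun i => ?_⟩
  · simp only [S.est_erase_zero ξ l0 l1 b]
    exact SqInt.const _
  · simp only [S.est_erase_zero ξ l0 l1 b, hmean]
    simp only [hist_zero, Hist.erase_start]
    have hg : Measurable fun a : d.X0 × d.M0 × d.M1 × Bool =>
        (Hist.start a.1 a.2.1 (Sum.inr ()) (Sum.inr ()), a.2.2.1, a.2.2.2) :=
      (Hist.measurable_start measurable_fst (by fun_prop) measurable_const
        measurable_const).prodMk (by fun_prop)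
    refine Orth.comp (F := fun ω => (ξ.x0 ω, ξ.m0 0 ω, ξ.m1 0 ω, ξ.γ 0 ω)) ?_ hg
    refine orth_of_indepFun (hξ.indepFun_x1.comp measurable_id
      (show Measurable fun x : d.X1 => x i - ∫ ω, ξ.x1 ω i ∂P by fun_prop))
      ((hsq i).sub (memLp_const _)) ?_
    change ∫ ω, (ξ.x1 ω i - ∫ ω, ξ.x1 ω i ∂P) ∂P = 0
    rw [integral_sub ((hsq i).integrable one_le_two) (integrable_const _)]
    simp

/-- The deviation of the next local state from its predicted mean. -/
lemma newDev_sq (hA : S.StateMean P ξ l0 l1 b t) (hB : S.ActionMean P ξ l0 l1 b t)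
    (hξ : S.Realizes P T ξ) (hS : S.Standing T) (ht : t ≤ T) (hpos : ∀ m : d.M1, 0 < S.π1 m) :
    SqInt (fun ω => S.innov ξ l0 l1 b t ω + ξ.w1 t ω) P :=
  (innov_sq hA hB hξ ht hpos).add (hξ.w1_sq hS ht)

lemma newDev_orth (hA : S.StateMean P ξ l0 l1 b t) (hB : S.ActionMean P ξ l0 l1 b t)
    (hξ : S.Realizes P T ξ) (hS : S.Standing T) (ht : t ≤ T) (hpos : ∀ m : d.M1, 0 < S.π1 m)
    (i : Fin d.x1) :
    Orth (S.hist ξ l0 l1 t) (fun ω => (S.innov ξ l0 l1 b t ω + ξ.w1 t ω) i) P :=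
  (innov_orth hA hB hξ ht hpos i).add
    ((hξ.w1_orth hS ht hA.meas_l0 hA.meas_l1 i).comp measurable_fst)
    (innov_sq hA hB hξ ht hpos i) (hξ.w1_sq hS ht i)

/-- The conditional means propagate from one time to the next. -/
lemma StateMean.succ (hA : S.StateMean P ξ l0 l1 b t) (hB : S.ActionMean P ξ l0 l1 b t)
    (hξ : S.Realizes P T ξ) (hS : S.Standing T) (ht : t + 1 ≤ T)
    (hpos : ∀ m : d.M1, 0 < S.π1 m) : S.StateMean P ξ l0 l1 b (t + 1) := by
  have ht' : t ≤ T := (Nat.le_succ t).trans ht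
  have hpred := measurable_pred hA hB
  have hpsq := pred_sq hA hB hξ ht' hpos
  have hnsq := newDev_sq hA hB hξ hS ht' hpos
  have hH := hA.measurable_hist hξ ht'
  have hlt : ∀ {Q : ℕ → Prop}, (∀ r < t, Q r) → Q t → ∀ r < t + 1, Q r := fun h1 h2 r hr =>
    (Nat.lt_succ_iff_lt_or_eq.1 hr).elim (h1 r) fun h => h ▸ h2
  refine ⟨hlt hA.meas_l0 hB.meas_l0, hlt hA.meas_l1 hB.meas_l1, hlt hA.meas_b hB.meas_b,
    ?_, ?_, ?_, fun i => ?_⟩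
  · rw [funext fun ω => S.state0_succ_eq ξ l0 l1 b t hξ.sum_π1 ω]
    exact (hpsq.comp Sum.inl).add (hξ.w0_sq hS ht')
  · rw [funext fun ω => S.state1_succ_eq ξ l0 l1 b t ω]
    exact (hpsq.comp Sum.inr).add hnsq
  · simp only [S.est_erase_succ ξ l0 l1 b]
    exact hpsq.comp Sum.inr
  · have hval : ∀ ω, S.state1 ξ l0 l1 (t + 1) ω i -
        S.est l0 b (t + 1) (S.hist ξ l0 l1 (t + 1) ω).erase i =
        (S.innov ξ l0 l1 b t ω + ξ.w1 t ω) i := by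
      intro ω
      rw [S.est_erase_succ ξ l0 l1 b, S.state1_succ_eq ξ l0 l1 b]
      simp
    simp only [hval]
    -- The pair of old history and new deviation is a function of sources independent of $W^0_t$ and
    -- of the modes and link state at time `t + 1`; by `Orth.prodMk_of_indepFun` these may be
    -- adjoined to the information.
    let g : (d.Hist t × d.X1 × d.M1) × d.X1 → d.Hist t × ℝ := fun a =>
      (a.1.1, S.innovFun l0 l1 b t a.1 i + a.2 i)
    have hg : Measurable g :=
      (by fun_prop : Measurable fun a : (d.Hist t × d.X1 × d.M1) × d.X1 => a.1.1).prodMk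
        ((measurable_pi_iff.1 ((measurable_innovFun hA hB).comp measurable_fst) i).add
          (by fun_prop))
    have hgval : ∀ ω, g ((S.hist ξ l0 l1 t ω, S.state1 ξ l0 l1 t ω, ξ.m1 t ω), ξ.w1 t ω) =
        (S.hist ξ l0 l1 t ω, (S.innov ξ l0 l1 b t ω + ξ.w1 t ω) i) := by
      intro ω
      simp only [g, S.innovFun_eq ξ l0 l1 b t ω, Pi.add_apply]
    have hind := (hξ.indepFun_next ht hA.meas_l0 hA.meas_l1).comp hg measurable_id
    have hind' : IndepFun (fun ω => (S.hist ξ l0 l1 t ω,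
        (S.innov ξ l0 l1 b t ω + ξ.w1 t ω) i))
        (fun ω => (ξ.w0 t ω, ξ.m0 (t + 1) ω, ξ.m1 (t + 1) ω, ξ.γ (t + 1) ω)) P := by
      simpa only [Function.comp_def, hgval, id] using hind
    have hmeasY : Measurable fun ω => (S.innov ξ l0 l1 b t ω + ξ.w1 t ω) i := by
      have hX : Measurable fun ω =>
          ((S.hist ξ l0 l1 t ω, S.state1 ξ l0 l1 t ω, ξ.m1 t ω), ξ.w1 t ω) :=
        (hH.prodMk ((S.measurable_state (hA.measBefore hξ ht')).2.prodMk
          (hξ.measurable_m1 ht'))).prodMk (hξ.measurable_w1 ht')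
      have := measurable_snd.comp (hg.comp hX)
      simpa only [Function.comp_def, hgval] using this
    have horth := (newDev_orth hA hB hξ hS ht' hpos i).prodMk_of_indepFun hH hmeasY
      ((hξ.measurable_w0 ht').prodMk ((hξ.measurable_m0 ht).prodMk
        ((hξ.measurable_m1 ht).prodMk (hξ.measurable_γ ht)))) (hnsq i) hind'
    -- The erased new history is recovered from the old history, $W^0_t$ and the new global mode,
    -- because the global drift is a function of the old history.
    have hk : Measurable fun a : d.Hist t × d.X0 × d.M0 × d.M1 × Bool =>
        (a.1.extend (l0 t a.1) (S.pred l0 b t a.1 ∘ Sum.inl + a.2.1) a.2.2.1 (Sum.inr ())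
          (Sum.inr ()), a.2.2.2.1, a.2.2.2.2) :=
      (Hist.measurable_extend measurable_fst (hB.meas_l0.comp measurable_fst)
        ((measurable_comp_right (hpred.comp measurable_fst) Sum.inl).add (by fun_prop))
        (by fun_prop) measurable_const measurable_const).prodMk (by fun_prop)
    have := horth.comp hk
    simp only [hist_succ, Hist.erase_extend, S.state0_succ_eq ξ l0 l1 b t hξ.sum_π1]
    exact this

end Propagation

/-! ### The value functions before and after transmission -/

section Values

variable {Ω : Type*} (ξ : Primitives d Ω) (l0 : Strategy0 d) (l1 : Strategy1 d)
  (b : MeanAction d) (G : PFam d) (Gt : PtFam d) (t : ℕ)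

/-- The value after the transmission at time `t`. -/
def postValue (ω : Ω) : ℝ :=
  qf (G (S.hist ξ l0 l1 t ω).m0 (S.hist ξ l0 l1 t ω).zt)
    (Sum.elim (S.state0 ξ l0 l1 t ω) (S.est l0 b t (S.hist ξ l0 l1 t ω))) +
  qf (Gt (S.hist ξ l0 l1 t ω).m0 (S.hist ξ l0 l1 t ω).zt)
    (S.state1 ξ l0 l1 t ω - S.est l0 b t (S.hist ξ l0 l1 t ω))

/-- The value before the transmission at time `t`. -/
def priorValue (ω : Ω) : ℝ :=
  qf (S.PiOp G)
    (Sum.elim (S.state0 ξ l0 l1 t ω) (S.est l0 b t (S.hist ξ l0 l1 t ω).erase)) +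
  qf (S.Psi11 G Gt) (S.state1 ξ l0 l1 t ω - S.est l0 b t (S.hist ξ l0 l1 t ω).erase)

/-- The instantaneous cost along the closed loop. -/
def stageCost (ω : Ω) : ℝ :=
  S.cost t (S.state0 ξ l0 l1 t ω) (S.state1 ξ l0 l1 t ω) (ξ.m0 t ω) (ξ.m1 t ω)
    (S.action0 ξ l0 l1 t ω) (S.action1 ξ l0 l1 t ω)

/-- The mean cost-to-go, up to noise, of the conditional means. -/
def meanValue (h : d.Hist t) : ℝ :=
  match h.zt with
  | Sum.inr _ => qf (S.Hempty t G Gt h.m0)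
      (aug (Sum.elim h.x0 (S.est l0 b t h)) (l0 t h) (b t h))
  | Sum.inl l => qf (S.Hmode t G h.m0 l) (S.zbar l0 b t h l)

/-- The contribution of the noises at time `t`. -/
def noiseCost [MeasurableSpace Ω] (P : Measure Ω) : ℝ :=
  ∫ ω, qf (S.PiOp G) (Sum.elim (ξ.w0 t ω) 0) ∂P + ∫ ω, qf (S.Psi11 G Gt) (ξ.w1 t ω) ∂P

lemma cost_eq_qf (x0 : d.X0) (x1 : d.X1) (m0 : d.M0) (m1 : d.M1) (u0 : d.U0) (u1 : d.U1) :
    S.cost t x0 x1 m0 m1 u0 u1 = qf (S.C t m0 m1) (vec x0 x1 u0 u1) := by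
  rw [C, vec, qf_fromBlocks_diag]
  rfl

lemma qf_C_vec_zero (m0 : d.M0) (m1 : d.M1) (x1 : d.X1) (u1 : d.U1) :
    qf (S.C t m0 m1) (vec 0 x1 0 u1) = qf (S.C11 t m0 m1) (Sum.elim x1 u1) := by
  rw [C, C11, vec, qf_fromBlocks_diag, qf_fromBlocks_diag, qf_elim_zero_left, qf_elim_zero_left]

variable {S}

/-- Averaging the cost-to-go of the conditional means over the unobserved mode. -/
lemma avg_eq_meanValue (hπ : ∑ m, S.π1 m = 1) (h : d.Hist t) :
    S.avg h.zt (fun m => qf (S.C t h.m0 m) (S.zbar l0 b t h m) +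
      qf (S.PiOp G) (S.pred l0 b t h) + qf (S.Psi11 G Gt) (S.modeDev l0 b t h m)) =
      S.meanValue l0 b G Gt t h := by
  unfold meanValue modeDev
  cases hz : h.zt with
  | inl l =>
    -- With the mode known the prediction is the mode-conditional mean, so `modeDev` vanishes and no
    -- variance term appears in `Hmode`.
    have hp : S.pred l0 b t h = S.D h.m0 l *ᵥ S.zbar l0 b t h l := by rw [pred, hz]; rfl
    have h0 : (0 : d.IX → ℝ) ∘ (Sum.inr : Fin d.x1 → d.IX) = 0 := rfl
    simp only [avg, qf_Hmode, hp, sub_self, h0, qf_vec_zero, add_zero]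
  | inr u =>
    have hp : S.pred l0 b t h = ∑ m, S.π1 m • (S.D h.m0 m *ᵥ S.zbar l0 b t h m) := by
      rw [pred, hz]; rfl
    simp only [avg, smul_eq_mul, qf_Hempty S hπ, hp, L_mulVec_aug]
    rfl

/-- Whatever `l0` and `b` prescribe at `h` is one particular choice of the action block, and the
Schur complement is the minimum over all choices. -/
lemma qf_step_le_meanValue {T : ℕ} (hS : S.Standing T) (hpos : ∀ m : d.M1, 0 < S.π1 m)
    (hπ : ∑ m, S.π1 m = 1) (ht : t ≤ T) (hG : ∀ m0 z, (G m0 z).PosSemidef)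
    (hGt : ∀ m0 z, (Gt m0 z).PosSemidef) (h : d.Hist t) :
    qf (S.stepP t G Gt h.m0 h.zt) (Sum.elim h.x0 (S.est l0 b t h)) ≤
      S.meanValue l0 b G Gt t h := by
  unfold meanValue
  cases h.zt with
  | inl l =>
    have hH := Hmode_posSemidef hS ht hG h.m0 l
    exact SC_le_qf hH.1.1 hH.2 _ _
  | inr u =>
    have hH := Hempty_posSemidef hS hpos hπ ht hG hGt h.m0
    exact SC_le_qf hH.1.1 hH.2 _ _

lemma avg_SC_Htilde (m0 : d.M0) (zt : Received d.M1) (e : d.X1) :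
    S.avg zt (fun m => qf (SC (S.Htilde t G Gt m0 m)) e) = qf (S.stepPt t G Gt m0 zt) e := by
  cases zt with
  | inl l => rfl
  | inr u => simp only [avg, stepPt, qf_sum, qf_smul, smul_eq_mul]

end Values

section Measurability

variable {S} {Ω : Type*} {mΩ : MeasurableSpace Ω} {ξ : Primitives d Ω} {l0 : Strategy0 d}
  {l1 : Strategy1 d} {b : MeanAction d} {t : ℕ}

/-- The estimate before transmission is a function of the sources before time `t`. -/
lemma measurable_est_erase (h : MeasBefore ξ l0 l1 t) (hb : ∀ r < t, ∀ m, Measurable (b r · m)) :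
    Measurable fun ω => S.est l0 b t (S.hist ξ l0 l1 t ω).erase := by
  cases t with
  | zero =>
    simp only [S.est_erase_zero ξ l0 l1 b]
    exact measurable_const
  | succ t =>
    have hlt := Nat.lt_succ_self t
    have he : Measurable (S.est l0 b t) := S.measurable_est (fun r hr => h.l0 r (hr.trans hlt))
      fun r hr => hb r (hr.trans hlt)
    simp only [S.est_erase_succ ξ l0 l1 b]
    exact measurable_comp_right ((S.measurable_pred_of_est (h.l0 t hlt) (hb t hlt) he).comp
      (S.measurable_hist_of_lt h hlt)) Sum.inr

/-- Bundles everything the value needs apart from the fresh modes and link state, so that one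
independence statement covers it. -/
lemma measurable_states_est_erase (h : MeasBefore ξ l0 l1 t)
    (hb : ∀ r < t, ∀ m, Measurable (b r · m)) :
    Measurable fun ω => ((Sum.elim (S.state0 ξ l0 l1 t ω) (S.state1 ξ l0 l1 t ω) : d.IX → ℝ),
      (Sum.elim (S.state0 ξ l0 l1 t ω) (S.est l0 b t (S.hist ξ l0 l1 t ω).erase) : d.IX → ℝ),
      S.state1 ξ l0 l1 t ω - S.est l0 b t (S.hist ξ l0 l1 t ω).erase) := by
  have hs := S.measurable_state h
  have hp := measurable_est_erase (S := S) h hb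
  exact (measurable_sum_elim hs.1 hs.2).prodMk
    ((measurable_sum_elim hs.1 hp).prodMk (hs.2.sub hp))

end Measurability

/-! ### Averaging the value over the fresh modes and the link state. -/

section Verification

variable {S} {Ω : Type*} [MeasurableSpace Ω] {P : Measure Ω} {T : ℕ}
  {ξ : Primitives d Ω} {l0 : Strategy0 d} {l1 : Strategy1 d} {b : MeanAction d} {t : ℕ}

lemma integral_qf_PsiOp {ι : Type} [Fintype ι] (G1 G2 : d.M0 → Received d.M1 → Matrix ι ι ℝ)
    {X : Ω → ι → ℝ} (hX : SqInt X P) : ∫ ω, qf (S.PsiOp G1 G2) (X ω) ∂P =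
      S.p false * ∑ m0, S.π0 m0 * ∫ ω, qf (G1 m0 (Sum.inr ())) (X ω) ∂P +
      S.p true * ∑ m0, ∑ m1, S.π0 m0 * S.π1 m1 * ∫ ω, qf (G2 m0 (Sum.inl m1)) (X ω) ∂P := by
  have h1 : Integrable (fun ω => ∑ m0, S.π0 m0 * qf (G1 m0 (Sum.inr ())) (X ω)) P :=
    integrable_finsetSum _ fun m0 _ => (integrable_qf _ hX).const_mul _
  have h2 : ∀ m0, Integrable (fun ω => ∑ m1, S.π0 m0 * S.π1 m1 *
      qf (G2 m0 (Sum.inl m1)) (X ω)) P := fun m0 =>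
    integrable_finsetSum _ fun m1 _ => (integrable_qf _ hX).const_mul _
  simp only [PsiOp, qf_add, qf_smul, qf_sum]
  rw [integral_add (h1.const_mul _) ((integrable_finsetSum _ fun m0 _ => h2 m0).const_mul _),
    integral_const_mul, integral_const_mul,
    integral_finsetSum _ fun m0 _ => (integrable_qf _ hX).const_mul _,
    integral_finsetSum _ fun m0 _ => h2 m0]
  simp only [integral_const_mul]
  congr 2
  refine Finset.sum_congr rfl fun m0 _ => ?_
  rw [integral_finsetSum _ fun m1 _ => (integrable_qf _ hX).const_mul _]
  simp only [integral_const_mul]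

variable [IsProbabilityMeasure P]

/-- Pythagoras for the state around its estimate before transmission. -/
lemma StateMean.integral_qf_state (hA : S.StateMean P ξ l0 l1 b t) (hξ : S.Realizes P T ξ)
    (ht : t ≤ T) (A : Matrix d.IX d.IX ℝ) :
    ∫ ω, qf A (Sum.elim (S.state0 ξ l0 l1 t ω) (S.state1 ξ l0 l1 t ω)) ∂P =
      ∫ ω, qf A (Sum.elim (S.state0 ξ l0 l1 t ω)
        (S.est l0 b t (S.hist ξ l0 l1 t ω).erase)) ∂P +
      ∫ ω, qf A.toBlocks₂₂ (S.state1 ξ l0 l1 t ω -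
        S.est l0 b t (S.hist ξ l0 l1 t ω).erase) ∂P := by
  have hH : Measurable fun ω => (S.hist ξ l0 l1 t ω).erase :=
    Hist.measurable_erase.comp (hA.measurable_hist hξ ht)
  have h := integral_qf_add_const (P := P) hH A
    (x := fun h => Sum.elim h.x0 (S.est l0 b t h))
    (measurable_sum_elim Hist.measurable_x0 hA.measurable_est)
    (SqInt.elim hA.x0 hA.est_sq)
    (Y := fun ω => Sum.elim 0 (S.state1 ξ l0 l1 t ω - S.est l0 b t (S.hist ξ l0 l1 t ω).erase))
    ((SqInt.const (0 : d.X0)).elim (hA.x1.sub hA.est_sq)) (by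
      rintro (i | i)
      · exact Orth.zero
      · exact (hA.orth i).comp measurable_fst)
  simp only [qf_elim_zero_left] at h
  refine Eq.trans (integral_congr_ae (.of_forall fun ω => ?_)) h
  refine congrArg (qf A) ?_
  ext (i | i)
  · simp [state0]
  · simp

/-- Averaging the value over the outcome of the transmission. -/
lemma StateMean.integral_postValue (hA : S.StateMean P ξ l0 l1 b t) (hξ : S.Realizes P T ξ)
    (ht : t ≤ T) (G : PFam d) (Gt : PtFam d) :
    ∫ ω, S.postValue ξ l0 l1 b G Gt t ω ∂P = ∫ ω, S.priorValue ξ l0 l1 b G Gt t ω ∂P := by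
  let X : Ω → d.IX → ℝ := fun ω => Sum.elim (S.state0 ξ l0 l1 t ω) (S.state1 ξ l0 l1 t ω)
  let Xp : Ω → d.IX → ℝ := fun ω => Sum.elim (S.state0 ξ l0 l1 t ω)
    (S.est l0 b t (S.hist ξ l0 l1 t ω).erase)
  let e : Ω → d.X1 := fun ω => S.state1 ξ l0 l1 t ω - S.est l0 b t (S.hist ξ l0 l1 t ω).erase
  have hX : SqInt X P := SqInt.elim hA.x0 hA.x1
  have hXp : SqInt Xp P := SqInt.elim hA.x0 hA.est_sq
  have he : SqInt e P := hA.x1.sub hA.est_sq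
  let V : Ω → (d.IX → ℝ) × (d.IX → ℝ) × d.X1 := fun ω => (X ω, Xp ω, e ω)
  have ht1 : t ≤ T + 1 := ht.trans (Nat.le_succ T)
  have hVs : Measurable[sig ξ (before T t)] V := measurable_states_est_erase
    (measBefore_sig ht1 (Set.Subset.refl _) hA.meas_l0 hA.meas_l1) hA.meas_b
  have hV : Measurable V := hVs.mono
    (iSup₂_le fun i _ => (hξ.measurable i).comap_le) le_rfl
  have hm0 := hξ.measurable_m0 ht
  have hm1 := hξ.measurable_m1 ht
  have hγ := hξ.measurable_γ ht
  obtain ⟨hi1, hi2, hi3⟩ := hξ.indepFun_modes ht hVs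
  -- On reception the estimate is the true local state and the error term vanishes, so the value is
  -- the form at the full state. On a drop the estimate and error before transmission remain.
  let f : Bool → d.M1 → d.M0 → (d.IX → ℝ) × (d.IX → ℝ) × d.X1 → ℝ := fun g m1 m0 v =>
    if g then qf (G m0 (Sum.inl m1)) v.1
    else qf (G m0 (Sum.inr ())) v.2.1 + qf (Gt m0 (Sum.inr ())) v.2.2
  have hf : ∀ g m1 m0, Measurable (f g m1 m0) := by
    intro g m1 m0
    cases g
    · exact ((measurable_qf (G m0 (Sum.inr ()))).comp (measurable_fst.comp measurable_snd)).add
        ((measurable_qf (Gt m0 (Sum.inr ()))).comp (measurable_snd.comp measurable_snd))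
    · exact (measurable_qf (G m0 (Sum.inl m1))).comp measurable_fst
  have hfint : ∀ g m1 m0, Integrable (fun ω => f g m1 m0 (V ω)) P := by
    intro g m1 m0
    cases g
    · exact (integrable_qf (G m0 (Sum.inr ())) hXp).add (integrable_qf (Gt m0 (Sum.inr ())) he)
    · exact integrable_qf (G m0 (Sum.inl m1)) hX
  have hfint1 : ∀ g m1, Integrable (fun ω => f g m1 (ξ.m0 t ω) (V ω)) P := fun g m1 =>
    memLp_one_iff_integrable.1 <| memLp_switch (f := fun k ω => f g m1 k (V ω)) hm0
      fun k => memLp_one_iff_integrable.2 (hfint g m1 k)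
  have hfint2 : ∀ g, Integrable (fun ω => f g (ξ.m1 t ω) (ξ.m0 t ω) (V ω)) P := fun g =>
    memLp_one_iff_integrable.1 <| memLp_switch (f := fun k ω => f g k (ξ.m0 t ω) (V ω)) hm1
      fun k => memLp_one_iff_integrable.2 (hfint1 g k)
  have hfint3 : Integrable (fun ω => f (ξ.γ t ω) (ξ.m1 t ω) (ξ.m0 t ω) (V ω)) P :=
    memLp_one_iff_integrable.1 <| memLp_switch
      (f := fun k ω => f k (ξ.m1 t ω) (ξ.m0 t ω) (V ω)) hγ
      fun k => memLp_one_iff_integrable.2 (hfint2 k)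
  have hfm1 : ∀ g m1, Measurable fun a : d.M0 × _ => f g m1 a.1 a.2 := fun g m1 =>
    measurable_from_prod_countable_right fun m0 => hf g m1 m0
  have hfm2 : ∀ g, Measurable fun a : d.M1 × d.M0 × _ => f g a.1 a.2.1 a.2.2 := fun g =>
    measurable_from_prod_countable_right fun m1 => hfm1 g m1
  have hpost : ∀ ω, S.postValue ξ l0 l1 b G Gt t ω =
      f (ξ.γ t ω) (ξ.m1 t ω) (ξ.m0 t ω) (V ω) := by
    intro ω
    rw [postValue, hist_m0, hist_zt, S.est_hist ξ l0 l1 b]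
    cases hg : ξ.γ t ω
    · simp [f, V, Xp, e, channel]
    · simp [f, V, X, channel, qf_vec_zero]
  have h1 := integral_of_indepFun_finite hγ (hm1.prodMk (hm0.prodMk hV)) hi1
    (f := fun g a => f g a.1 a.2.1 a.2.2) hfm2 hfint3
  have h2 := fun g => integral_of_indepFun_finite hm1 (hm0.prodMk hV) hi2
    (f := fun m1 a => f g m1 a.1 a.2) (hfm1 g) (hfint2 g)
  have h3 := fun g m1 => integral_of_indepFun_finite hm0 hV hi3
    (f := fun m0 a => f g m1 m0 a) (hf g m1) (hfint1 g m1)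
  simp only at h1 h2 h3
  simp only [hpost]
  rw [h1]
  simp only [h2, h3, hξ.law_γ t ht, hξ.law_m1 t ht, hξ.law_m0 t ht, Fintype.sum_bool]
  -- Splitting the full state into estimate and error puts the local block of `G` on the error; this
  -- is the origin of the second argument of `Psi11`.
  have htrue : ∀ m1 m0, ∫ ω, f true m1 m0 (V ω) ∂P =
      ∫ ω, qf (G m0 (Sum.inl m1)) (Xp ω) ∂P +
        ∫ ω, qf (G m0 (Sum.inl m1)).toBlocks₂₂ (e ω) ∂P := fun m1 m0 => by
    simpa [f] using hA.integral_qf_state hξ ht (G m0 (Sum.inl m1))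
  have hfalse : ∀ m1 m0, ∫ ω, f false m1 m0 (V ω) ∂P =
      ∫ ω, qf (G m0 (Sum.inr ())) (Xp ω) ∂P + ∫ ω, qf (Gt m0 (Sum.inr ())) (e ω) ∂P :=
    fun m1 m0 => by
      simpa [f] using integral_add (integrable_qf (G m0 (Sum.inr ())) hXp)
        (integrable_qf (Gt m0 (Sum.inr ())) he)
  simp only [htrue, hfalse]
  have hprior : ∫ ω, S.priorValue ξ l0 l1 b G Gt t ω ∂P =
      ∫ ω, qf (S.PsiOp G G) (Xp ω) ∂P +
        ∫ ω, qf (S.PsiOp Gt fun m0 z => (G m0 z).toBlocks₂₂) (e ω) ∂P :=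
    integral_add (integrable_qf _ hXp) (integrable_qf _ he)
  have hπ : ∑ m1, S.lawM1.real {m1} = 1 := hξ.sum_π1
  have hswap : ∀ F : d.M0 → d.M1 → ℝ, ∑ m0, ∑ m1, S.π0 m0 * S.π1 m1 * F m0 m1 =
      ∑ m1, S.lawM1.real {m1} * ∑ m0, S.lawM0.real {m0} * F m0 m1 := by
    intro F
    rw [Finset.sum_comm]
    simp only [Finset.mul_sum, π0, π1]
    exact Finset.sum_congr rfl fun m1 _ => Finset.sum_congr rfl fun m0 _ => by ring
  rw [hprior, integral_qf_PsiOp _ _ hXp, integral_qf_PsiOp _ _ he, hswap, hswap,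
    ← Finset.sum_mul, hπ, one_mul]
  simp only [p, π0, mul_add, Finset.sum_add_distrib]
  ring

end Verification

section Final

variable {S} {Ω : Type*} {T : ℕ} {ξ : Primitives d Ω} {l0 : Strategy0 d} {l1 : Strategy1 d}
  {b : MeanAction d}

lemma priorValue_final (ω : Ω) :
    S.priorValue ξ l0 l1 b (S.Pmat T (T + 1)) (S.Ptmat T (T + 1)) (T + 1) ω = 0 := by
  have h1 : S.Pmat T (T + 1) = 0 := by simp [Pmat, riccati]
  have h2 : S.Ptmat T (T + 1) = 0 := by simp [Ptmat, riccati]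
  have h3 : S.PiOp (0 : PFam d) = 0 := by simp [PiOp]
  have h4 : S.Psi11 (0 : PFam d) (0 : PtFam d) = 0 := by
    have : (0 : Matrix d.IX d.IX ℝ).toBlocks₂₂ = 0 := rfl
    simp [Psi11, PsiOp, this]
  rw [priorValue, h1, h2, h3, h4, qf_zero, qf_zero, add_zero]

end Final

/-! ### The dynamic programming step and the lower bound. -/

section Verification

variable {S} {Ω : Type*} [MeasurableSpace Ω] {P : Measure Ω} {T : ℕ}
  {ξ : Primitives d Ω} {l0 : Strategy0 d} {l1 : Strategy1 d} {b : MeanAction d} {t : ℕ}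

variable (S ξ P T)

/-- The optimal cost. -/
def optCost : ℝ :=
  ∫ ω, (qf (S.PiOp (S.Pmat T 0)) (Sum.elim (ξ.x0 ω) (∫ x, x ∂S.lawX1)) +
    qf (S.Psi11 (S.Pmat T 0) (S.Ptmat T 0)) (ξ.x1 ω - ∫ x, x ∂S.lawX1)) ∂P +
  ∑ t ∈ Finset.range (T + 1), S.noiseCost ξ (S.Pmat T (t + 1)) (S.Ptmat T (t + 1)) t P

variable {S ξ P T}

lemma integral_priorValue_zero :
    ∫ ω, S.priorValue ξ l0 l1 b (S.Pmat T 0) (S.Ptmat T 0) 0 ω ∂P =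
      ∫ ω, (qf (S.PiOp (S.Pmat T 0)) (Sum.elim (ξ.x0 ω) (∫ x, x ∂S.lawX1)) +
        qf (S.Psi11 (S.Pmat T 0) (S.Ptmat T 0)) (ξ.x1 ω - ∫ x, x ∂S.lawX1)) ∂P := by
  simp only [priorValue, S.est_erase_zero ξ l0 l1 b]
  rfl

/-- Telescoping. -/
lemma optCost_eq (V : ℕ → ℝ) (hV : V (T + 1) = 0)
    (hV0 : V 0 = ∫ ω, (qf (S.PiOp (S.Pmat T 0)) (Sum.elim (ξ.x0 ω) (∫ x, x ∂S.lawX1)) +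
      qf (S.Psi11 (S.Pmat T 0) (S.Ptmat T 0)) (ξ.x1 ω - ∫ x, x ∂S.lawX1)) ∂P) :
    S.optCost P T ξ = ∑ t ∈ Finset.range (T + 1),
      (V t + S.noiseCost ξ (S.Pmat T (t + 1)) (S.Ptmat T (t + 1)) t P - V (t + 1)) := by
  have h := Finset.sum_range_sub' V (T + 1)
  rw [hV, sub_zero] at h
  rw [optCost, ← hV0, ← h, ← Finset.sum_add_distrib]
  exact Finset.sum_congr rfl fun t _ => by ring

lemma integrable_stageCost (hA : S.StateMean P ξ l0 l1 b t) (hB : S.ActionMean P ξ l0 l1 b t)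
    (hξ : S.Realizes P T ξ) (ht : t ≤ T) : Integrable (S.stageCost ξ l0 l1 t) P := by
  have h := integrable_qf_switch (P := P) (c := fun ω => (ξ.m0 t ω, ξ.m1 t ω))
    ((hξ.measurable_m0 ht).prodMk (hξ.measurable_m1 ht)) (fun k => S.C t k.1 k.2)
    ((SqInt.elim hA.x0 hA.x1).elim (SqInt.elim hB.u0 hB.u1))
  refine h.congr (.of_forall fun ω => ?_)
  rw [stageCost, cost_eq_qf]
  rfl

lemma J_eq_sum (hA : ∀ t ≤ T, S.StateMean P ξ l0 l1 b t)
    (hB : ∀ t ≤ T, S.ActionMean P ξ l0 l1 b t) (hξ : S.Realizes P T ξ) :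
    S.J ξ l0 l1 P T = ∑ t ∈ Finset.range (T + 1), ∫ ω, S.stageCost ξ l0 l1 t ω ∂P := by
  have ht : ∀ t ∈ Finset.range (T + 1), t ≤ T := fun t h =>
    Nat.lt_succ_iff.1 (Finset.mem_range.1 h)
  exact integral_finsetSum _ fun t h => integrable_stageCost (hA t (ht t h)) (hB t (ht t h)) hξ
    (ht t h)

variable [IsProbabilityMeasure P]

/-- The expected instantaneous cost splits into a cost of the conditional means and a cost of the
deviations. -/
lemma integral_stageCost (hA : S.StateMean P ξ l0 l1 b t) (hB : S.ActionMean P ξ l0 l1 b t)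
    (hξ : S.Realizes P T ξ) (ht : t ≤ T) :
    ∫ ω, S.stageCost ξ l0 l1 t ω ∂P =
      ∫ ω, qf (S.C t (ξ.m0 t ω) (ξ.m1 t ω)) (S.zbar l0 b t (S.hist ξ l0 l1 t ω) (ξ.m1 t ω)) ∂P +
      ∫ ω, qf (S.C11 t (ξ.m0 t ω) (ξ.m1 t ω)) (S.dev ξ l0 l1 b t ω) ∂P := by
  have hH := hA.measurable_hist hξ ht
  have hd := dev_sq hA hB hξ ht
  have ho := dev_orth hA hB hξ ht
  have h := integral_qf_add (P := P) (F := fun ω => (S.hist ξ l0 l1 t ω, ξ.m1 t ω))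
    (hH.prodMk (hξ.measurable_m1 ht)) (c := fun a : d.Hist t × d.M1 => (a.1.m0, a.2))
    ((Hist.measurable_m0.comp measurable_fst).prodMk measurable_snd)
    (fun k => S.C t k.1 k.2) (x := fun a => S.zbar l0 b t a.1 a.2)
    (measurable_from_prod_countable_left fun m =>
      S.measurable_zbar_of_est hB.meas_l0 hB.meas_b hA.measurable_est m)
    (zbar_sq hA hB hξ ht)
    (Y := fun ω => vec 0 (S.state1 ξ l0 l1 t ω - S.est l0 b t (S.hist ξ l0 l1 t ω)) 0
        (S.action1 ξ l0 l1 t ω - b t (S.hist ξ l0 l1 t ω) (ξ.m1 t ω)))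
    (((SqInt.const (0 : d.X0)).elim (hd.comp Sum.inl)).elim
      ((SqInt.const (0 : d.U0)).elim (hd.comp Sum.inr))) (by
        rintro ((i | i) | (i | i))
        · exact Orth.zero
        · exact ho (Sum.inl i)
        · exact Orth.zero
        · exact ho (Sum.inr i))
  simp only [← S.vec_eq_zbar_add ξ l0 l1 b, qf_C_vec_zero, hist_m0] at h
  simp only [stageCost, cost_eq_qf]
  exact h

/-- The expected value before the next transmission. -/
lemma integral_priorValue_succ (hA : S.StateMean P ξ l0 l1 b t)
    (hB : S.ActionMean P ξ l0 l1 b t) (hξ : S.Realizes P T ξ) (hS : S.Standing T) (ht : t ≤ T)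
    (hpos : ∀ m : d.M1, 0 < S.π1 m) (G : PFam d) (Gt : PtFam d) :
    ∫ ω, S.priorValue ξ l0 l1 b G Gt (t + 1) ω ∂P =
      ∫ ω, qf (S.PiOp G) (S.pred l0 b t (S.hist ξ l0 l1 t ω)) ∂P +
      ∫ ω, qf (S.Psi11 G Gt) (S.modeDev l0 b t (S.hist ξ l0 l1 t ω) (ξ.m1 t ω)) ∂P +
      ∫ ω, qf (S.Psi11 G Gt) (S.D11 (ξ.m0 t ω) (ξ.m1 t ω) *ᵥ S.dev ξ l0 l1 b t ω) ∂P +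
      S.noiseCost ξ G Gt t P := by
  have hH := hA.measurable_hist hξ ht
  have hm1 := hξ.measurable_m1 ht
  have hp := pred_sq hA hB hξ ht hpos
  have hw0 : SqInt (fun ω => (Sum.elim (ξ.w0 t ω) 0 : d.IX → ℝ)) P :=
    (hξ.w0_sq hS ht).elim (SqInt.const (0 : d.X1))
  have hx1 := (S.measurable_state (hA.measBefore hξ ht)).2
  -- Three orthogonal splits: the prediction from $W^0$, the innovation from $W^1$, and, inside the
  -- innovation, `modeDev` from the propagated `dev`.
  have h1 := integral_qf_add_const (P := P) hH (S.PiOp G) (measurable_pred hA hB) hp hw0 (by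
    rintro (i | i)
    · exact (hξ.w0_orth hS ht hA.meas_l0 hA.meas_l1 i).comp measurable_fst
    · exact Orth.zero)
  have h2 := integral_qf_add_const (P := P) (hH.prodMk (hx1.prodMk hm1)) (S.Psi11 G Gt)
    (measurable_innovFun hA hB)
    (by simpa only [S.innovFun_eq ξ l0 l1 b t] using innov_sq hA hB hξ ht hpos)
    (hξ.w1_sq hS ht) (hξ.w1_orth hS ht hA.meas_l0 hA.meas_l1)
  have h3 := integral_qf_add_const (P := P) (F := fun ω => (S.hist ξ l0 l1 t ω, ξ.m1 t ω))
    (hH.prodMk hm1) (S.Psi11 G Gt) (x := fun a => S.modeDev l0 b t a.1 a.2)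
    (measurable_from_prod_countable_left fun m => measurable_comp_right
      ((measurable_Dzbar hA hB m).sub (measurable_pred hA hB)) Sum.inr)
    (modeDev_sq hA hB hξ ht hpos) (D11_dev_sq hA hB hξ ht) (D11_dev_orth hA hB hξ ht)
  simp only [S.innovFun_eq ξ l0 l1 b t] at h2
  have hval : ∀ ω, S.priorValue ξ l0 l1 b G Gt (t + 1) ω =
      qf (S.PiOp G) (S.pred l0 b t (S.hist ξ l0 l1 t ω) + Sum.elim (ξ.w0 t ω) 0) +
      qf (S.Psi11 G Gt) (S.innov ξ l0 l1 b t ω + ξ.w1 t ω) := by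
    intro ω
    rw [priorValue, S.est_erase_succ ξ l0 l1 b, S.state1_succ_eq ξ l0 l1 b,
      S.state0_succ_eq ξ l0 l1 b t hξ.sum_π1, add_sub_cancel_left]
    congr 2
    ext (i | i) <;> simp
  simp only [hval]
  rw [integral_add (integrable_qf _ (hp.add hw0))
    (integrable_qf _ (newDev_sq hA hB hξ hS ht hpos)), h1, h2, noiseCost]
  unfold innov
  rw [h3]
  ring

/-- The dynamic programming identity for an arbitrary strategy pair. -/
lemma integral_step (hA : S.StateMean P ξ l0 l1 b t) (hB : S.ActionMean P ξ l0 l1 b t)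
    (hξ : S.Realizes P T ξ) (hS : S.Standing T) (ht : t ≤ T) (hpos : ∀ m : d.M1, 0 < S.π1 m)
    (G : PFam d) (Gt : PtFam d) :
    Integrable (fun ω => S.meanValue l0 b G Gt t (S.hist ξ l0 l1 t ω)) P ∧
    ∫ ω, S.stageCost ξ l0 l1 t ω ∂P + ∫ ω, S.priorValue ξ l0 l1 b G Gt (t + 1) ω ∂P =
      ∫ ω, S.meanValue l0 b G Gt t (S.hist ξ l0 l1 t ω) ∂P +
      ∫ ω, qf (S.Htilde t G Gt (ξ.m0 t ω) (ξ.m1 t ω)) (S.dev ξ l0 l1 b t ω) ∂P +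
      S.noiseCost ξ G Gt t P := by
  have hH := hA.measurable_hist hξ ht
  have hm : Measurable fun ω => (ξ.m0 t ω, ξ.m1 t ω) :=
    (hξ.measurable_m0 ht).prodMk (hξ.measurable_m1 ht)
  have hz := zbar_sq hA hB hξ ht
  have hd := dev_sq hA hB hξ ht
  have hi1 : Integrable (fun ω => qf (S.C t (ξ.m0 t ω) (ξ.m1 t ω))
      (S.zbar l0 b t (S.hist ξ l0 l1 t ω) (ξ.m1 t ω))) P :=
    integrable_qf_switch hm (fun k => S.C t k.1 k.2) hz
  have hi2 := integrable_qf (S.PiOp G) (pred_sq hA hB hξ ht hpos)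
  have hi3 := integrable_qf (S.Psi11 G Gt) (modeDev_sq hA hB hξ ht hpos)
  have hi4 : Integrable (fun ω => qf (S.C11 t (ξ.m0 t ω) (ξ.m1 t ω))
      (S.dev ξ l0 l1 b t ω)) P := integrable_qf_switch hm (fun k => S.C11 t k.1 k.2) hd
  have hi5 := integrable_qf (S.Psi11 G Gt) (D11_dev_sq hA hB hξ ht)
  have hi12 : Integrable (fun ω => qf (S.C t (ξ.m0 t ω) (ξ.m1 t ω))
      (S.zbar l0 b t (S.hist ξ l0 l1 t ω) (ξ.m1 t ω)) +
      qf (S.PiOp G) (S.pred l0 b t (S.hist ξ l0 l1 t ω))) P := hi1.add hi2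
  have hi123 : Integrable (fun ω => qf (S.C t (S.hist ξ l0 l1 t ω).m0 (ξ.m1 t ω))
      (S.zbar l0 b t (S.hist ξ l0 l1 t ω) (ξ.m1 t ω)) +
      qf (S.PiOp G) (S.pred l0 b t (S.hist ξ l0 l1 t ω)) +
      qf (S.Psi11 G Gt) (S.modeDev l0 b t (S.hist ξ l0 l1 t ω) (ξ.m1 t ω))) P := by
    simp only [hist_m0]
    exact hi12.add hi3
  have hp := measurable_pred hA hB
  -- The cost of the means still depends on the actual mode; averaging that mode given the common
  -- information produces the form `meanValue` in the whole table of mean actions.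
  have havg := hξ.integral_avg (l0 := l0) (l1 := l1) hpos ht hA.meas_l0 hA.meas_l1
    (f := fun a m => qf (S.C t a.1.m0 m) (S.zbar l0 b t a.1 m) +
      qf (S.PiOp G) (S.pred l0 b t a.1) + qf (S.Psi11 G Gt) (S.modeDev l0 b t a.1 m))
    (fun m => by
      have h1 : Measurable fun h : d.Hist t => qf (S.C t h.m0 m) (S.zbar l0 b t h m) :=
        measurable_switch (f := fun k h => qf (S.C t k m) (S.zbar l0 b t h m))
          Hist.measurable_m0 fun k => (measurable_qf _).comp
            (S.measurable_zbar_of_est hB.meas_l0 hB.meas_b hA.measurable_est m)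
      have h3 : Measurable fun h : d.Hist t => S.modeDev l0 b t h m :=
        measurable_comp_right ((measurable_Dzbar hA hB m).sub hp) Sum.inr
      exact ((h1.add ((measurable_qf _).comp hp)).add ((measurable_qf _).comp h3)).comp
        measurable_fst) hi123
  simp only [avg_eq_meanValue l0 b G Gt t hξ.sum_π1] at havg
  refine ⟨havg.1, ?_⟩
  rw [havg.2, integral_stageCost hA hB hξ ht, integral_priorValue_succ hA hB hξ hS ht hpos]
  simp only [hist_m0, qf_Htilde]
  rw [integral_add hi12 hi3, integral_add hi1 hi2, integral_add hi4 hi5]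
  ring

/-- The error depends on the history and the local state only, so on a drop the mode can be averaged
out of the coefficient; that average is how `stepPt` is defined at `∅`. -/
lemma integral_SC_Htilde (hA : S.StateMean P ξ l0 l1 b t)
    (hξ : S.Realizes P T ξ) (ht : t ≤ T) (hpos : ∀ m : d.M1, 0 < S.π1 m)
    (G : PFam d) (Gt : PtFam d) :
    ∫ ω, qf (SC (S.Htilde t G Gt (ξ.m0 t ω) (ξ.m1 t ω)))
      (S.state1 ξ l0 l1 t ω - S.est l0 b t (S.hist ξ l0 l1 t ω)) ∂P =
    ∫ ω, qf (S.stepPt t G Gt (S.hist ξ l0 l1 t ω).m0 (S.hist ξ l0 l1 t ω).zt)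
      (S.state1 ξ l0 l1 t ω - S.est l0 b t (S.hist ξ l0 l1 t ω)) ∂P := by
  have hm : Measurable fun ω => (ξ.m0 t ω, ξ.m1 t ω) :=
    (hξ.measurable_m0 ht).prodMk (hξ.measurable_m1 ht)
  have he := hA.x1.sub (hA.est_hist_sq hξ ht)
  have havg := (hξ.integral_avg (l0 := l0) (l1 := l1) hpos ht hA.meas_l0 hA.meas_l1
    (f := fun a m => qf (SC (S.Htilde t G Gt a.1.m0 m)) (a.2 - S.est l0 b t a.1))
    (fun m => measurable_switch
      (f := fun k (a : d.Hist t × d.X1) => qf (SC (S.Htilde t G Gt k m)) (a.2 - S.est l0 b t a.1))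
      (Hist.measurable_m0.comp measurable_fst) fun k => (measurable_qf _).comp
        (measurable_snd.sub (hA.measurable_est.comp measurable_fst)))
    (by
      simp only [hist_m0]
      exact integrable_qf_switch hm (fun k => SC (S.Htilde t G Gt k.1 k.2)) he)).2
  simp only [avg_SC_Htilde] at havg
  simp only [hist_m0] at havg ⊢
  exact havg.symm

/-- Writes the error term with the Schur complement at the actual mode, so that it can be compared
with `Htilde` at each sample point. -/
lemma integral_postValue_eq (hA : S.StateMean P ξ l0 l1 b t) (hξ : S.Realizes P T ξ)
    (ht : t ≤ T) (hpos : ∀ m : d.M1, 0 < S.π1 m) (G : PFam d) (Gt : PtFam d) :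
    ∫ ω, S.postValue ξ l0 l1 b (S.stepP t G Gt) (S.stepPt t G Gt) t ω ∂P =
      ∫ ω, qf (S.stepP t G Gt (S.hist ξ l0 l1 t ω).m0 (S.hist ξ l0 l1 t ω).zt)
        (Sum.elim (S.state0 ξ l0 l1 t ω) (S.est l0 b t (S.hist ξ l0 l1 t ω))) ∂P +
      ∫ ω, qf (SC (S.Htilde t G Gt (ξ.m0 t ω) (ξ.m1 t ω)))
        (S.state1 ξ l0 l1 t ω - S.est l0 b t (S.hist ξ l0 l1 t ω)) ∂P := by
  have hH := hA.measurable_hist hξ ht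
  have hc : Measurable fun ω => ((S.hist ξ l0 l1 t ω).m0, (S.hist ξ l0 l1 t ω).zt) :=
    (Hist.measurable_m0.comp hH).prodMk (Hist.measurable_zt.comp hH)
  rw [integral_SC_Htilde hA hξ ht hpos]
  exact integral_add (integrable_qf_switch hc (fun k => S.stepP t G Gt k.1 k.2)
      (SqInt.elim hA.x0 (hA.est_hist_sq hξ ht)))
    (integrable_qf_switch hc (fun k => S.stepPt t G Gt k.1 k.2)
      (hA.x1.sub (hA.est_hist_sq hξ ht)))

/-- The dynamic programming inequality for an arbitrary strategy pair. -/
lemma step_le (hA : S.StateMean P ξ l0 l1 b t) (hB : S.ActionMean P ξ l0 l1 b t)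
    (hξ : S.Realizes P T ξ) (hS : S.Standing T) (ht : t ≤ T) (hpos : ∀ m : d.M1, 0 < S.π1 m)
    {G : PFam d} {Gt : PtFam d} (hG : ∀ m0 z, (G m0 z).PosSemidef)
    (hGt : ∀ m0 z, (Gt m0 z).PosSemidef) :
    ∫ ω, S.priorValue ξ l0 l1 b (S.stepP t G Gt) (S.stepPt t G Gt) t ω ∂P +
      S.noiseCost ξ G Gt t P ≤
    ∫ ω, S.stageCost ξ l0 l1 t ω ∂P + ∫ ω, S.priorValue ξ l0 l1 b G Gt (t + 1) ω ∂P := by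
  obtain ⟨hint, heq⟩ := integral_step hA hB hξ hS ht hpos G Gt
  have hH := hA.measurable_hist hξ ht
  have hc : Measurable fun ω => ((S.hist ξ l0 l1 t ω).m0, (S.hist ξ l0 l1 t ω).zt) :=
    (Hist.measurable_m0.comp hH).prodMk (Hist.measurable_zt.comp hH)
  have hm : Measurable fun ω => (ξ.m0 t ω, ξ.m1 t ω) :=
    (hξ.measurable_m0 ht).prodMk (hξ.measurable_m1 ht)
  rw [heq, ← hA.integral_postValue hξ ht, integral_postValue_eq hA hξ ht hpos]
  -- Means and deviations are bounded separately and pointwise, each by its own Schur complement.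
  refine add_le_add_left (add_le_add ?_ ?_) _
  · exact integral_mono (integrable_qf_switch hc (fun k => S.stepP t G Gt k.1 k.2)
      (SqInt.elim hA.x0 (hA.est_hist_sq hξ ht))) hint
      fun ω => qf_step_le_meanValue l0 b G Gt t hS hpos hξ.sum_π1 ht hG hGt _
  · refine integral_mono (integrable_qf_switch hm (fun k => SC (S.Htilde t G Gt k.1 k.2))
      (hA.x1.sub (hA.est_hist_sq hξ ht)))
      (integrable_qf_switch hm (fun k => S.Htilde t G Gt k.1 k.2) (dev_sq hA hB hξ ht))
      fun ω => ?_
    have h := Htilde_posSemidef hS ht hG hGt (ξ.m0 t ω) (ξ.m1 t ω)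
    exact SC_le_qf h.1.1 h.2 _ _

/-- The dynamic programming equality for strategies that use the optimal gains. -/
lemma step_eq (hA : S.StateMean P ξ l0 l1 b t) (hB : S.ActionMean P ξ l0 l1 b t)
    (hξ : S.Realizes P T ξ) (hS : S.Standing T) (ht : t ≤ T) (hpos : ∀ m : d.M1, 0 < S.π1 m)
    {G : PFam d} {Gt : PtFam d} (hG : ∀ m0 z, (G m0 z).PosSemidef)
    (hGt : ∀ m0 z, (Gt m0 z).PosSemidef)
    (hmean : ∀ h : d.Hist t, S.meanValue l0 b G Gt t h =
      qf (S.stepP t G Gt h.m0 h.zt) (Sum.elim h.x0 (S.est l0 b t h)))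
    (hdev : ∀ ω, S.action1 ξ l0 l1 t ω - b t (S.hist ξ l0 l1 t ω) (ξ.m1 t ω) =
      gain (S.Htilde t G Gt (ξ.m0 t ω) (ξ.m1 t ω)) *ᵥ
        (S.state1 ξ l0 l1 t ω - S.est l0 b t (S.hist ξ l0 l1 t ω))) :
    ∫ ω, S.priorValue ξ l0 l1 b (S.stepP t G Gt) (S.stepPt t G Gt) t ω ∂P +
      S.noiseCost ξ G Gt t P =
    ∫ ω, S.stageCost ξ l0 l1 t ω ∂P + ∫ ω, S.priorValue ξ l0 l1 b G Gt (t + 1) ω ∂P := by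
  rw [(integral_step hA hB hξ hS ht hpos G Gt).2, ← hA.integral_postValue hξ ht,
    integral_postValue_eq hA hξ ht hpos]
  simp only [hmean, dev, hdev]
  congr 2
  refine integral_congr_ae (.of_forall fun ω => ?_)
  have h := Htilde_posSemidef hS ht hG hGt (ξ.m0 t ω) (ξ.m1 t ω)
  exact (qf_gain h.1.1 h.2 _).symm

/-- The inequalities `step_le` telescope. The final value is zero, and the initial one does not
depend on the strategies because the estimate before the first transmission is a fixed mean. -/
lemma optCost_le_J (hA : ∀ t ≤ T, S.StateMean P ξ l0 l1 b t)
    (hB : ∀ t ≤ T, S.ActionMean P ξ l0 l1 b t) (hξ : S.Realizes P T ξ) (hS : S.Standing T)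
    (hpos : ∀ m : d.M1, 0 < S.π1 m) : S.optCost P T ξ ≤ S.J ξ l0 l1 P T := by
  rw [J_eq_sum hA hB hξ, optCost_eq
    (fun t => ∫ ω, S.priorValue ξ l0 l1 b (S.Pmat T t) (S.Ptmat T t) t ω ∂P)
    (by simp [priorValue_final]) integral_priorValue_zero]
  refine Finset.sum_le_sum fun t h => ?_
  have ht : t ≤ T := Nat.lt_succ_iff.1 (Finset.mem_range.1 h)
  have hR := riccati_posSemidef hS hpos hξ.sum_π1 (T + 1 - (t + 1))
  rw [sub_le_iff_le_add, Pmat_eq S ht, Ptmat_eq S ht]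
  exact step_le (hA t ht) (hB t ht) hξ hS ht hpos hR.1 hR.2

end Verification

/-! ### The candidate strategies -/

section Candidate

variable (T : ℕ)

/-- The conditional mean of the action of the local controller under the candidate strategies. -/
def optMeanAction : MeanAction d := fun t h m => S.qbar T t h.m0 h.zt h.x0 (S.xhat T t h) m

/-- Identifies the candidate's estimate as an instance of the general estimator, so that the
propagation results for arbitrary pairs apply to it. -/
lemma xhat_eq_est (t : ℕ) (h : d.Hist t) :
    S.xhat T t h = S.est (S.optStrategy0 T) (S.optMeanAction T) t h := by
  induction t with
  | zero => rw [xhat, est]; cases h.z <;> rfl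
  | succ t ih =>
    rw [xhat, est_succ]
    cases h.z with
    | inl x => rfl
    | inr u =>
      simp only [Sum.elim_inr, pred, avg_comp, zbar, ← ih]
      cases hz : h.past.zt <;>
        simp only [avg, propagate, toRows₂_mulVec, optStrategy0, optMeanAction, hz]

variable {Ω : Type*} [MeasurableSpace Ω] {t : ℕ}

lemma measurable_uStar {m0 : Ω → d.M0} {zt : Ω → Received d.M1} {x0 : Ω → d.X0} {xh : Ω → d.X1}
    (hm0 : Measurable m0) (hzt : Measurable zt) (hx0 : Measurable x0) (hxh : Measurable xh) :
    Measurable fun ω => S.uStar T t (m0 ω) (zt ω) (x0 ω) (xh ω) := by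
  have hx := measurable_sum_elim hx0 hxh
  refine measurable_switch (f := fun (k : d.M0 × Received d.M1) ω =>
    S.uStar T t k.1 k.2 (x0 ω) (xh ω)) (hm0.prodMk hzt) ?_
  rintro ⟨m, l | u⟩
  · exact measurable_comp_right (measurable_switch_mulVec hm0 (fun _ => S.Kmode T t m l) hx) Sum.inl
  · exact measurable_comp_right (measurable_switch_mulVec hm0 (fun _ => S.Kempty T t m) hx) Sum.inl

lemma measurable_qbar {m0 : Ω → d.M0} {zt : Ω → Received d.M1} {x0 : Ω → d.X0} {xh : Ω → d.X1}
    {m1 : Ω → d.M1} (hm0 : Measurable m0) (hzt : Measurable zt) (hx0 : Measurable x0)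
    (hxh : Measurable xh) (hm1 : Measurable m1) :
    Measurable fun ω => S.qbar T t (m0 ω) (zt ω) (x0 ω) (xh ω) (m1 ω) := by
  have hx := measurable_sum_elim hx0 hxh
  refine measurable_switch (f := fun (k : d.M0 × Received d.M1 × d.M1) ω =>
    S.qbar T t k.1 k.2.1 (x0 ω) (xh ω) k.2.2) (hm0.prodMk (hzt.prodMk hm1)) ?_
  rintro ⟨m, l | u, m'⟩
  · by_cases h : m' = l
    · simp only [qbar, h, if_true]
      exact measurable_comp_right (measurable_switch_mulVec hm0 (fun _ => S.Kmode T t m l) hx)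
        Sum.inr
    · simp only [qbar, h, if_false]
      exact measurable_const
  · exact measurable_comp_right (measurable_switch_mulVec hm0 (fun _ => S.Kempty T t m) hx)
      fun i => Sum.inr (m', i)

lemma measurable_qtilde {m0 : Ω → d.M0} {zt : Ω → Received d.M1} {xh : Ω → d.X1}
    {x1 : Ω → d.X1} {m1 : Ω → d.M1} (hm0 : Measurable m0) (hzt : Measurable zt)
    (hxh : Measurable xh) (hx1 : Measurable x1) (hm1 : Measurable m1) :
    Measurable fun ω => S.qtilde T t (m0 ω) (zt ω) (xh ω) (x1 ω) (m1 ω) := by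
  refine measurable_switch (f := fun (k : Received d.M1) ω =>
    S.qtilde T t (m0 ω) k (xh ω) (x1 ω) (m1 ω)) hzt ?_
  rintro (l | u)
  · exact measurable_const
  · exact measurable_switch_mulVec (hm0.prodMk hm1) (fun k => S.Ktilde T t k.1 k.2) (hx1.sub hxh)

/-- Strong induction, because the candidate strategy at each earlier time is itself a function of
the estimate at that time. -/
lemma measurable_xhat (t : ℕ) : Measurable (S.xhat T t) := by
  induction t using Nat.strong_induction_on with
  | _ t ih =>
    rw [funext fun h => S.xhat_eq_est T t h]
    exact S.measurable_est
      (fun r hr => S.measurable_uStar T Hist.measurable_m0 Hist.measurable_zt Hist.measurable_x0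
        (ih r hr))
      (fun r hr m => S.measurable_qbar T Hist.measurable_m0 Hist.measurable_zt Hist.measurable_x0
        (ih r hr) measurable_const)

lemma measurable_optStrategy0 : Measurable (S.optStrategy0 T t) :=
  S.measurable_uStar T Hist.measurable_m0 Hist.measurable_zt Hist.measurable_x0
    (S.measurable_xhat T t)

lemma measurable_optMeanAction (m : d.M1) : Measurable (S.optMeanAction T t · m) :=
  S.measurable_qbar T Hist.measurable_m0 Hist.measurable_zt Hist.measurable_x0
    (S.measurable_xhat T t) measurable_const

lemma measurable_optStrategy1 : Measurable (S.optStrategy1 T t) := by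
  have hf : Measurable fun i : d.Hist t × d.X1 × d.M1 => i.1 := measurable_fst
  have h1 := Hist.measurable_m0.comp hf
  have h2 := Hist.measurable_zt.comp hf
  have h3 := Hist.measurable_x0.comp hf
  have h4 := (S.measurable_xhat T t).comp hf
  exact (S.measurable_qbar T h1 h2 h3 h4 (by fun_prop)).add
    (S.measurable_qtilde T h1 h2 h4 (by fun_prop) (by fun_prop))

end Candidate

section Deviation

variable {S} {Ω : Type*} {T : ℕ} {ξ : Primitives d Ω} {t : ℕ}

/-- The deviation of the candidate local action from its conditional mean. -/
lemma action1_sub_optMeanAction (ω : Ω) :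
    S.action1 ξ (S.optStrategy0 T) (S.optStrategy1 T) t ω -
      S.optMeanAction T t (S.hist ξ (S.optStrategy0 T) (S.optStrategy1 T) t ω) (ξ.m1 t ω) =
    S.Ktilde T t (ξ.m0 t ω) (ξ.m1 t ω) *ᵥ
      (S.state1 ξ (S.optStrategy0 T) (S.optStrategy1 T) t ω -
        S.est (S.optStrategy0 T) (S.optMeanAction T) t
          (S.hist ξ (S.optStrategy0 T) (S.optStrategy1 T) t ω)) := by
  simp only [action1, optStrategy1, optMeanAction, add_sub_cancel_left, hist_m0, hist_zt]
  cases h : ξ.γ t ω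
  · simp only [channel, qtilde, xhat_eq_est]
    rfl
  -- On reception the error is zero, so setting $\tilde q^* = 0$ agrees with applying the gain.
  · simp [channel, qtilde, est_hist, h]

end Deviation

/-! ### Feasibility and optimality of the candidate. -/

section Optimality

variable {S} {Ω : Type*} [MeasurableSpace Ω] {P : Measure Ω} {T : ℕ} {ξ : Primitives d Ω} {t : ℕ}

lemma optMeanAction_sq (hA : S.StateMean P ξ (S.optStrategy0 T) (S.optStrategy1 T)
      (S.optMeanAction T) t) (hξ : S.Realizes P T ξ) (ht : t ≤ T) :
    SqInt (fun ω => S.optMeanAction T t (S.hist ξ (S.optStrategy0 T) (S.optStrategy1 T) t ω)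
      (ξ.m1 t ω)) P ∧ SqInt (S.action0 ξ (S.optStrategy0 T) (S.optStrategy1 T) t) P := by
  have hH := hA.measurable_hist hξ ht
  have hx := SqInt.elim hA.x0 (hA.est_hist_sq hξ ht)
  have hm0 := Hist.measurable_m0.comp hH
  have hzt := Hist.measurable_zt.comp hH
  simp only [← xhat_eq_est] at hx
  constructor
  · refine SqInt.switch (X := fun (k : d.M0 × Received d.M1 × d.M1) ω =>
      S.qbar T t k.1 k.2.1 (S.hist ξ (S.optStrategy0 T) (S.optStrategy1 T) t ω).x0
        (S.xhat T t (S.hist ξ (S.optStrategy0 T) (S.optStrategy1 T) t ω)) k.2.2)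
      (hm0.prodMk (hzt.prodMk (hξ.measurable_m1 ht))) ?_
    rintro ⟨m, l | u, m'⟩
    · by_cases h : m' = l
      · simp only [qbar, h, if_true]
        exact (hx.mulVec (S.Kmode T t m l)).comp Sum.inr
      · simp only [qbar, h, if_false]
        exact fun i => MemLp.zero
    · exact (hx.mulVec (S.Kempty T t m)).comp fun i => Sum.inr (m', i)
  · refine SqInt.switch (X := fun (k : d.M0 × Received d.M1) ω =>
      S.uStar T t k.1 k.2 (S.hist ξ (S.optStrategy0 T) (S.optStrategy1 T) t ω).x0
        (S.xhat T t (S.hist ξ (S.optStrategy0 T) (S.optStrategy1 T) t ω)))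
      (hm0.prodMk hzt) ?_
    rintro ⟨m, l | u⟩
    · exact (hx.mulVec (S.Kmode T t m l)).comp Sum.inl
    · exact (hx.mulVec (S.Kempty T t m)).comp Sum.inl

/-- `q̄*` is the conditional mean of the candidate local action. -/
lemma actionMean_opt (hA : S.StateMean P ξ (S.optStrategy0 T) (S.optStrategy1 T)
      (S.optMeanAction T) t) (hξ : S.Realizes P T ξ) (ht : t ≤ T) :
    S.ActionMean P ξ (S.optStrategy0 T) (S.optStrategy1 T) (S.optMeanAction T) t := by
  obtain ⟨hb, hu⟩ := optMeanAction_sq hA hξ ht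
  have hH := hA.measurable_hist hξ ht
  have hdev := hA.x1.sub (hA.est_hist_sq hξ ht)
  have hm := (hξ.measurable_m0 ht).prodMk (hξ.measurable_m1 ht)
  have hK := SqInt.measurable_mulVec hm (fun k => S.Ktilde T t k.1 k.2) hdev
  refine ⟨S.measurable_optStrategy0 T, S.measurable_optStrategy1 T,
    S.measurable_optMeanAction T, hu, ?_, hb, fun i => ?_⟩
  · have h := hb.add hK
    simp only [← action1_sub_optMeanAction, add_sub_cancel] at h
    exact h
  · have h := Orth.switch_mulVec
      (F := fun ω => (S.hist ξ (S.optStrategy0 T) (S.optStrategy1 T) t ω, ξ.m1 t ω))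
      (hH.prodMk (hξ.measurable_m1 ht)) (Y := fun ω =>
        S.state1 ξ (S.optStrategy0 T) (S.optStrategy1 T) t ω -
          S.est (S.optStrategy0 T) (S.optMeanAction T) t
            (S.hist ξ (S.optStrategy0 T) (S.optStrategy1 T) t ω)) (hA.orth_hist hξ ht) hdev
      (c := fun a : d.Hist t × d.M1 => (a.1.m0, a.2))
      ((Hist.measurable_m0.comp measurable_fst).prodMk measurable_snd)
      (fun k => S.Ktilde T t k.1 k.2) i
    simp only [hist_m0, ← action1_sub_optMeanAction] at h
    exact h

/-- The candidate gains minimize the mean cost-to-go. -/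
lemma meanValue_opt (hS : S.Standing T) (hpos : ∀ m : d.M1, 0 < S.π1 m)
    (hπ : ∑ m, S.π1 m = 1) (ht : t ≤ T) (h : d.Hist t) :
    S.meanValue (S.optStrategy0 T) (S.optMeanAction T) (S.Pmat T (t + 1)) (S.Ptmat T (t + 1)) t h =
      qf (S.stepP t (S.Pmat T (t + 1)) (S.Ptmat T (t + 1)) h.m0 h.zt)
        (Sum.elim h.x0 (S.est (S.optStrategy0 T) (S.optMeanAction T) t h)) := by
  have hR := riccati_posSemidef hS hpos hπ (T + 1 - (t + 1))
  have hb : S.optMeanAction T t h = S.qbar T t h.m0 h.zt h.x0 (S.xhat T t h) := rfl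
  simp only [meanValue, zbar, ← xhat_eq_est, optStrategy0, hb]
  cases h.zt with
  | inl l =>
    have hH := Hmode_posSemidef hS ht hR.1 h.m0 l
    have hv : vec h.x0 (S.xhat T t h) (S.uStar T t h.m0 (Sum.inl l) h.x0 (S.xhat T t h))
        (S.qbar T t h.m0 (Sum.inl l) h.x0 (S.xhat T t h) l) =
        Sum.elim (Sum.elim h.x0 (S.xhat T t h))
          (S.Kmode T t h.m0 l *ᵥ Sum.elim h.x0 (S.xhat T t h)) := by
      ext i
      rcases i with i | (i | i) <;> simp [vec, uStar, qbar]
    simp only [hv]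
    exact qf_gain hH.1.1 hH.2 _
  | inr u =>
    have hH := Hempty_posSemidef hS hpos hπ ht hR.1 hR.2 h.m0
    have hv : aug (Sum.elim h.x0 (S.xhat T t h))
        (S.uStar T t h.m0 (Sum.inr u) h.x0 (S.xhat T t h))
        (S.qbar T t h.m0 (Sum.inr u) h.x0 (S.xhat T t h)) =
        Sum.elim (Sum.elim h.x0 (S.xhat T t h))
          (S.Kempty T t h.m0 *ᵥ Sum.elim h.x0 (S.xhat T t h)) := by
      ext i
      rcases i with i | (i | i) <;> simp [aug, uStar, qbar]
    simp only [hv]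
    exact qf_gain hH.1.1 hH.2 _

variable [IsProbabilityMeasure P]

/-- The hypothesis is an implication because for the candidate the action property is derived from
the state property at the same time; for an arbitrary feasible pair it holds outright. -/
lemma means_of_actionMean {l0 : Strategy0 d} {l1 : Strategy1 d} {b : MeanAction d}
    (hξ : S.Realizes P T ξ) (hS : S.Standing T) (hpos : ∀ m : d.M1, 0 < S.π1 m)
    (h : ∀ t ≤ T, S.StateMean P ξ l0 l1 b t → S.ActionMean P ξ l0 l1 b t) (ht : t ≤ T) :
    S.StateMean P ξ l0 l1 b t ∧ S.ActionMean P ξ l0 l1 b t := by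
  have hA : S.StateMean P ξ l0 l1 b t := by
    induction t with
    | zero => exact .zero hξ hS
    | succ t ih =>
      have ht' := (Nat.le_succ t).trans ht
      exact (ih ht').succ (h t ht' (ih ht')) hξ hS ht hpos
  exact ⟨hA, h t ht hA⟩

lemma means_opt (hξ : S.Realizes P T ξ) (hS : S.Standing T) (hpos : ∀ m : d.M1, 0 < S.π1 m)
    (ht : t ≤ T) :
    S.StateMean P ξ (S.optStrategy0 T) (S.optStrategy1 T) (S.optMeanAction T) t ∧
      S.ActionMean P ξ (S.optStrategy0 T) (S.optStrategy1 T) (S.optMeanAction T) t :=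
  means_of_actionMean hξ hS hpos (fun _ hs hA => actionMean_opt hA hξ hs) ht

lemma feasible_opt (hξ : S.Realizes P T ξ) (hS : S.Standing T) (hpos : ∀ m : d.M1, 0 < S.π1 m) :
    S.Feasible ξ (S.optStrategy0 T) (S.optStrategy1 T) P T where
  measurable0 _ _ := S.measurable_optStrategy0 T
  measurable1 _ _ := S.measurable_optStrategy1 T
  state0_sq _ ht := (means_opt hξ hS hpos ht).1.x0.memLp
  state1_sq _ ht := (means_opt hξ hS hpos ht).1.x1.memLp
  action0_sq _ ht := (means_opt hξ hS hpos ht).2.u0.memLp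
  action1_sq _ ht := (means_opt hξ hS hpos ht).2.u1.memLp

/-- The candidate strategies attain the optimal cost. -/
lemma J_opt (hξ : S.Realizes P T ξ) (hS : S.Standing T) (hpos : ∀ m : d.M1, 0 < S.π1 m) :
    S.J ξ (S.optStrategy0 T) (S.optStrategy1 T) P T = S.optCost P T ξ := by
  rw [J_eq_sum (fun t ht => (means_opt hξ hS hpos ht).1) (fun t ht => (means_opt hξ hS hpos ht).2)
    hξ, optCost_eq (fun t => ∫ ω, S.priorValue ξ (S.optStrategy0 T) (S.optStrategy1 T)
      (S.optMeanAction T) (S.Pmat T t) (S.Ptmat T t) t ω ∂P)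
    (by simp [priorValue_final]) integral_priorValue_zero]
  refine Finset.sum_congr rfl fun t h => ?_
  have ht : t ≤ T := Nat.lt_succ_iff.1 (Finset.mem_range.1 h)
  have hR := riccati_posSemidef hS hpos hξ.sum_π1 (T + 1 - (t + 1))
  have hm := means_opt hξ hS hpos ht
  rw [eq_sub_iff_add_eq, Pmat_eq S ht, Ptmat_eq S ht]
  exact (step_eq hm.1 hm.2 hξ hS ht hpos hR.1 hR.2
    (fun h => meanValue_opt hS hpos hξ.sum_π1 ht h) action1_sub_optMeanAction).symm

/-- No feasible pair of strategies beats the optimal cost. -/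
lemma Feasible.optCost_le_J {k0 : Strategy0 d} {k1 : Strategy1 d}
    (hk : S.Feasible ξ k0 k1 P T) (hξ : S.Realizes P T ξ) (hS : S.Standing T)
    (hpos : ∀ m : d.M1, 0 < S.π1 m) : S.optCost P T ξ ≤ S.J ξ k0 k1 P T := by
  have hF : ∀ t ≤ T, Measurable fun ω => (S.hist ξ k0 k1 t ω, ξ.m1 t ω) := fun t ht =>
    (S.measurable_hist (hξ.measBefore (ht.trans (Nat.le_succ T))
      (fun r hr => hk.measurable0 r (hr.le.trans ht))
      fun r hr => hk.measurable1 r (hr.le.trans ht)) (hξ.measurable_m0 ht) (hξ.measurable_m1 ht)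
      (hξ.measurable_γ ht)).prodMk (hξ.measurable_m1 ht)
  -- The conditional mean of the local action as a function of common information and mode. Beyond
  -- the horizon nothing is required, and zero is a default that allows choosing `b` for all times
  -- at once.
  have hex : ∀ t, ∃ b : d.Hist t × d.M1 → d.U1, t ≤ T → Measurable b ∧
      SqInt (fun ω => b (S.hist ξ k0 k1 t ω, ξ.m1 t ω)) P ∧
      ∀ i, Orth (fun ω => (S.hist ξ k0 k1 t ω, ξ.m1 t ω))
        (fun ω => S.action1 ξ k0 k1 t ω i - b (S.hist ξ k0 k1 t ω, ξ.m1 t ω) i) P := by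
    intro t
    by_cases ht : t ≤ T
    · obtain ⟨b, hb⟩ := exists_condMean (hF t ht) (.of_memLp (hk.action1_sq t ht))
      exact ⟨b, fun _ => hb⟩
    · exact ⟨0, fun h => absurd h ht⟩
  choose b hb using hex
  have hB : ∀ t ≤ T, S.ActionMean P ξ k0 k1 (fun t h m => b t (h, m)) t := fun t ht =>
    ⟨hk.measurable0 t ht, hk.measurable1 t ht, fun m => (hb t ht).1.comp (by fun_prop),
      .of_memLp (hk.action0_sq t ht), .of_memLp (hk.action1_sq t ht), (hb t ht).2.1, (hb t ht).2.2⟩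
  exact System.optCost_le_J
    (fun t ht => (means_of_actionMean hξ hS hpos (fun s hs _ => hB s hs) ht).1) hB hξ hS hpos

lemma isOptimal_opt (hξ : S.Realizes P T ξ) (hS : S.Standing T)
    (hpos : ∀ m : d.M1, 0 < S.π1 m) :
    S.IsOptimal ξ (S.optStrategy0 T) (S.optStrategy1 T) P T :=
  ⟨feasible_opt hξ hS hpos, fun _ _ hk =>
    (J_opt hξ hS hpos).trans_le (hk.optCost_le_J hξ hS hpos)⟩

/-- `x̂¹_t` is the conditional mean of the local state. -/
lemma condExp_state1_opt (hξ : S.Realizes P T ξ) (hS : S.Standing T)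
    (hpos : ∀ m : d.M1, 0 < S.π1 m) (ht : t ≤ T) :
    P[S.state1 ξ (S.optStrategy0 T) (S.optStrategy1 T) t |
        MeasurableSpace.comap (S.hist ξ (S.optStrategy0 T) (S.optStrategy1 T) t) inferInstance]
      =ᵐ[P] fun ω => S.xhat T t (S.hist ξ (S.optStrategy0 T) (S.optStrategy1 T) t ω) := by
  have hA := (means_opt hξ hS hpos ht).1
  refine condExp_eq_of_orth (hA.measurable_hist hξ ht) hA.x1 (S.measurable_xhat T t) ?_ fun i => ?_
  · simp only [xhat_eq_est]
    exact hA.est_hist_sq hξ ht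
  · simp only [xhat_eq_est]
    exact (hA.orth_hist hξ ht i).comp measurable_fst

/-- `x̂¹_t` is the mean of the common belief. -/
lemma integral_belief_opt (hξ : S.Realizes P T ξ) (hS : S.Standing T)
    (hpos : ∀ m : d.M1, 0 < S.π1 m) (ht : t ≤ T) :
    ∀ᵐ ω ∂P, ∫ x, x ∂(S.belief P ξ (S.optStrategy0 T) (S.optStrategy1 T) t
        (S.hist ξ (S.optStrategy0 T) (S.optStrategy1 T) t ω)) =
      S.xhat T t (S.hist ξ (S.optStrategy0 T) (S.optStrategy1 T) t ω) := by
  have hA := (means_opt hξ hS hpos ht).1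
  exact (condExp_ae_eq_integral_condDistrib' (hA.measurable_hist hξ ht)
    (hA.x1.memLp.integrable one_le_two)).symm.trans (condExp_state1_opt hξ hS hpos ht)

end Optimality

end System

end NCS

end

theorem theorem4 {d : NCS.Dims} (S : NCS.System d) (T : ℕ) (hS : S.Standing T)
    (hpos : ∀ m : d.M1, 0 < S.π1 m)
    {Ω : Type*} [MeasurableSpace Ω] (P : MeasureTheory.Measure Ω)
    [MeasureTheory.IsProbabilityMeasure P]
    (ξ : NCS.Primitives d Ω) (hξ : S.Realizes P T ξ) :
    S.IsOptimal ξ (S.optStrategy0 T) (S.optStrategy1 T) P T ∧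
    ∀ t ≤ T,
      (∀ᵐ ω ∂P,
        ∫ x, x ∂(S.belief P ξ (S.optStrategy0 T) (S.optStrategy1 T) t
            (S.hist ξ (S.optStrategy0 T) (S.optStrategy1 T) t ω)) =
          S.xhat T t (S.hist ξ (S.optStrategy0 T) (S.optStrategy1 T) t ω)) ∧
      P[S.state1 ξ (S.optStrategy0 T) (S.optStrategy1 T) t |
          MeasurableSpace.comap (S.hist ξ (S.optStrategy0 T) (S.optStrategy1 T) t) inferInstance]
        =ᵐ[P] fun ω => S.xhat T t (S.hist ξ (S.optStrategy0 T) (S.optStrategy1 T) t ω) :=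
  ⟨NCS.System.isOptimal_opt hξ hS hpos, fun _ ht =>
    ⟨NCS.System.integral_belief_opt hξ hS hpos ht,
      NCS.System.condExp_state1_opt hξ hS hpos ht⟩⟩
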